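/- Let $n\ge 3$ and let $B_n$ be the Artin braid group with generators $\sigma_1,\dots,\sigma_{n-1}$. For $1\le i<j\le n$ let $a_{ij}=(\sigma_{j-1}\cdots\sigma_{i+1})\,\sigma_i\,(\sigma_{j-1}\cdots\sigma_{i+1})^{-1}$ (the band generators), and let $\delta=\sigma_{n-1}\cdots\sigma_2\sigma_1$. A braid is *strongly quasipositive* (SQP) if it is a product of band generators, and *almost strongly quasipositive* (ASQP) if it is represented by a word in the $a_{ij}^{\pm1}$ with at most one negative letter. Let $\|\beta\|$ be the minimal length of a word in the $a_{ij}^{\pm1}$ representing $\beta$. Write $V\le W$ if $W=PVQ$ with $P,Q$ SQP, and put $\inf(\beta)=\max\{r\in\mathbb Z:\delta^r\le\beta\}$. A *canonical factor* is a braid $A$ with $e\le A\le\delta$. For canonical factors $A,B$, the word $AB$ is *maximally left-weighted* if $AB=A'B'$ with canonical factors $A',B'$ and $A'=AQ$ for a canonical factor $Q$ is possible only with $A'=A$. The *left-canonical form* of $\beta$ is the factorization $\beta=\delta^rA_1\cdots A_k$ with $r\in\mathbb Z$ and canonical factors $A_i\ne e,\delta$ such that every $A_iA_{i+1}$ is maximally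 left-weighted; then $r=\inf(\beta)$. The *summit set* $SS([\beta])$ is the set of conjugates $\beta'$ of $\beta$ for which $\inf(\beta')$ is maximal among all conjugates of $\beta$. **(1)** A braid $\beta\in B_n$ is conjugate to an ASQP braid but not conjugate to any SQP braid if and only if there is $\beta'\in SS([\beta])$ such that $\inf(\beta')=-1$ and the left-canonical form $\beta'=\delta^{-1}A_1\cdots A_k$ has $k\ge1$ and $\|A_1\|=n-2$. **(2)** Consequently, the problem of determining whether a given braid is conjugate to an ASQP braid but not to any SQP braid is solvable in exponential time in the word length and the number of strands: there are a single program of a unit-cost random access machine (with addition and truncated subtraction as its arithmetic) and a polynomial $p$ with coefficients in $\mathbb N$ such that, for every $n\ge3$ and every word $W$ of length $L$ in the $a_{ij}^{\pm1}$ of $B_n$, the program on input $(n,W)$ halts after at most $2^{p(n)(L+1)}$ steps and correctly decides whether the braid represented by $W$ is conjugate to an ASQP braid but not to any SQP braid. -/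

import Mathlib

/-! ## Braid groups and band generators -/

/-- Artin's relators on the free group with generators indexed by `0, …, n - 2`:
far commutativity and the braid relation. -/
def braidRels (n : ℕ) : Set (FreeGroup (Fin (n - 1))) :=
  {w | (∃ i j : Fin (n - 1), i.val + 1 < j.val ∧
          w = FreeGroup.of i * FreeGroup.of j * (FreeGroup.of j * FreeGroup.of i)⁻¹) ∨
       (∃ i j : Fin (n - 1), i.val + 1 = j.val ∧
          w = FreeGroup.of i * FreeGroup.of j * FreeGroup.of i *
            (FreeGroup.of j * FreeGroup.of i * FreeGroup.of j)⁻¹)}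

/-- The braid group `B_n` on `n` strands, by Artin's presentation. -/
abbrev BraidGroup (n : ℕ) : Type := PresentedGroup (braidRels n)

namespace BraidGroup

/-- The Artin generator exchanging the adjacent strands `i` and `i + 1`, strands being numbered
`0, …, n - 1`. (For an index out of range the value is `1`; such indices are never used.) -/
def sigma (n i : ℕ) : BraidGroup n :=
  if h : i < n - 1 then PresentedGroup.of ⟨i, h⟩ else 1

/-- `σ_{j-1} σ_{j-2} ⋯ σ_{i+1}`. -/
def bandConjugator (n i j : ℕ) : BraidGroup n :=
  ((List.range' (i + 1) (j - 1 - i)).reverse.map (sigma n)).prod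

/-- The band generator `a_{ij} = (σ_{j-1} ⋯ σ_{i+1}) σ_i (σ_{j-1} ⋯ σ_{i+1})⁻¹`, for `i < j`. -/
def band (n i j : ℕ) : BraidGroup n :=
  bandConjugator n i j * sigma n i * (bandConjugator n i j)⁻¹

/-- `δ = σ_{n-1} ⋯ σ_2 σ_1` (here with generators numbered from `0`). -/
def delta (n : ℕ) : BraidGroup n :=
  ((List.range (n - 1)).reverse.map (sigma n)).prod

/-- A letter `a_{ij}` (sign `true`) or `a_{ij}⁻¹` (sign `false`), where `i < j`. -/
structure BandLetter (n : ℕ) where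
  i : Fin n
  j : Fin n
  lt : i < j
  sign : Bool

/-- The braid represented by a letter. -/
def BandLetter.toBraid {n : ℕ} (a : BandLetter n) : BraidGroup n :=
  if a.sign then band n a.i a.j else (band n a.i a.j)⁻¹

/-- Braid words in the band generators and their inverses. -/
abbrev BandWord (n : ℕ) : Type := List (BandLetter n)

/-- The braid represented by a word. -/
def BandWord.toBraid {n : ℕ} (W : BandWord n) : BraidGroup n :=
  (W.map BandLetter.toBraid).prod

/-- The number of negative bands in a word. -/
def BandWord.nb {n : ℕ} (W : BandWord n) : ℕ :=
  W.countP fun a => !a.sign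

/-- `ℱ_m`: the braids that some word with at most `m` negative bands represents, that is, the
braids of negative band number at most `m`. -/
def filtration (n m : ℕ) : Set (BraidGroup n) :=
  {β | ∃ W : BandWord n, W.toBraid = β ∧ W.nb ≤ m}

/-- Strongly quasipositive braids: products of positive bands. -/
def SQP (n : ℕ) : Set (BraidGroup n) := filtration n 0

/-- Almost strongly quasipositive braids. -/
def ASQP (n : ℕ) : Set (BraidGroup n) := filtration n 1

/-- `β` is conjugate to an ASQP braid but not to an SQP braid. -/
def ConjASQPNotSQP {n : ℕ} (β : BraidGroup n) : Prop :=
  (∃ γ, IsConj β γ ∧ γ ∈ ASQP n) ∧ ¬ ∃ γ, IsConj β γ ∧ γ ∈ SQP n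

/-- `‖β‖ = m`: the minimal length of a word in the band generators and their inverses that
represents `β` is `m`. -/
def HasBandLength {n : ℕ} (β : BraidGroup n) (m : ℕ) : Prop :=
  IsLeast {k : ℕ | ∃ W : BandWord n, W.toBraid = β ∧ W.length = k} m

/-! ## The left-canonical form -/

/-- The order `V ≤ W`: `W = P V Q` with `P`, `Q` positive words in the band generators. -/
def BraidLE {n : ℕ} (V W : BraidGroup n) : Prop :=
  ∃ P ∈ SQP n, ∃ Q ∈ SQP n, W = P * V * Q

/-- Canonical factors: `e ≤ A ≤ δ`. -/
def IsCanonicalFactor {n : ℕ} (A : BraidGroup n) : Prop :=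
  BraidLE 1 A ∧ BraidLE A (delta n)

/-- `A ≺ B`: `A Q = B` for a canonical factor `Q`. -/
def LeftDivides {n : ℕ} (A B : BraidGroup n) : Prop :=
  ∃ Q, IsCanonicalFactor Q ∧ A * Q = B

/-- The word `A B` in two canonical factors is maximally left-weighted: it cannot be rewritten
as `A' B'` with canonical factors `A'`, `B'` such that `A ≺ A'`, except trivially, with
`A' = A`. -/
def MaxLeftWeighted {n : ℕ} (A B : BraidGroup n) : Prop :=
  ∀ A' B' : BraidGroup n, IsCanonicalFactor A' → IsCanonicalFactor B' →
    A * B = A' * B' → LeftDivides A A' → A' = A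

/-- `δ^r A_1 ⋯ A_k` is the left-canonical form of `β`, where `As = [A_1, …, A_k]`. -/
def IsLCF {n : ℕ} (β : BraidGroup n) (r : ℤ) (As : List (BraidGroup n)) : Prop :=
  β = delta n ^ r * As.prod ∧
  (∀ A ∈ As, IsCanonicalFactor A ∧ A ≠ 1 ∧ A ≠ delta n) ∧
  As.IsChain MaxLeftWeighted

/-- `inf(β) = r`: `r` is the largest integer with `δ^r ≤ β`. -/
def HasInf {n : ℕ} (β : BraidGroup n) (r : ℤ) : Prop :=
  IsGreatest {s : ℤ | BraidLE (delta n ^ s) β} r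

/-- `inf([β]) = r`: `r` is the largest infimum of a conjugate of `β`. -/
def HasClassInf {n : ℕ} (β : BraidGroup n) (r : ℤ) : Prop :=
  IsGreatest {s : ℤ | ∃ γ, IsConj β γ ∧ HasInf γ s} r

/-- The summit set `SS([β])`: the conjugates of `β` whose infimum is maximal among all conjugates
of `β`. -/
def summitSet {n : ℕ} (β : BraidGroup n) : Set (BraidGroup n) :=
  {β' | IsConj β β' ∧ ∃ r : ℤ, HasInf β' r ∧ HasClassInf β r}

end BraidGroup

/-! ## Random access machines

A structured unit-cost random access machine. Every register and memory cell holds a natural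
number, and the only arithmetic is addition and truncated subtraction; this is the usual RAM,
polynomially equivalent to Turing machines. A program is a finite object, so it uses finitely many
registers and finitely many memory banks, and a memory bank is accessed by indirect addressing. -/

namespace RAM

/-- Programs; `x y z` name registers, `b` a memory bank. -/
inductive Program : Type
  /-- do nothing -/
  | skip : Program
  /-- `x := c` -/
  | const (x c : ℕ) : Program
  /-- `x := y + z` -/
  | add (x y z : ℕ) : Program
  /-- `x := y - z` (truncated) -/
  | sub (x y z : ℕ) : Program
  /-- `x := b[y]` -/
  | load (x b y : ℕ) : Program
  /-- `b[x] := y` -/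
  | store (b x y : ℕ) : Program
  /-- sequential composition -/
  | seq (p q : Program) : Program
  /-- run `p` if `x ≠ 0`, and `q` otherwise -/
  | cond (x : ℕ) (p q : Program) : Program
  /-- run `p` as long as `x ≠ 0` -/
  | loop (x : ℕ) (p : Program) : Program

/-- The contents of the registers and of the cells of the memory banks. -/
@[ext] structure State : Type where
  reg : ℕ → ℕ
  mem : ℕ → ℕ → ℕ

/-- Overwrite a register. -/
def State.setReg (s : State) (x v : ℕ) : State :=
  { s with reg := Function.update s.reg x v }

/-- Overwrite a memory cell. -/
def State.setMem (s : State) (b a v : ℕ) : State :=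
  { s with mem := Function.update s.mem b (Function.update (s.mem b) a v) }

/-- `Exec p s t s'`: the program `p`, started in the state `s`, halts after exactly `t` steps in
the state `s'`. Each elementary instruction and each test of a register is one step. -/
inductive Exec : Program → State → ℕ → State → Prop
  | skip (s : State) : Exec .skip s 1 s
  | const (s : State) (x c : ℕ) : Exec (.const x c) s 1 (s.setReg x c)
  | add (s : State) (x y z : ℕ) : Exec (.add x y z) s 1 (s.setReg x (s.reg y + s.reg z))
  | sub (s : State) (x y z : ℕ) : Exec (.sub x y z) s 1 (s.setReg x (s.reg y - s.reg z))
  | load (s : State) (x b y : ℕ) : Exec (.load x b y) s 1 (s.setReg x (s.mem b (s.reg y)))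
  | store (s : State) (b x y : ℕ) : Exec (.store b x y) s 1 (s.setMem b (s.reg x) (s.reg y))
  | seq {p q : Program} {s s' s'' : State} {t t' : ℕ} :
      Exec p s t s' → Exec q s' t' s'' → Exec (.seq p q) s (t + t') s''
  | condPos {x : ℕ} {p q : Program} {s s' : State} {t : ℕ} :
      s.reg x ≠ 0 → Exec p s t s' → Exec (.cond x p q) s (t + 1) s'
  | condZero {x : ℕ} {p q : Program} {s s' : State} {t : ℕ} :
      s.reg x = 0 → Exec q s t s' → Exec (.cond x p q) s (t + 1) s'
  | loopPos {x : ℕ} {p : Program} {s s' s'' : State} {t t' : ℕ} :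
      s.reg x ≠ 0 → Exec p s t s' → Exec (.loop x p) s' t' s'' →
        Exec (.loop x p) s (t + t' + 1) s''
  | loopZero {x : ℕ} {p : Program} {s : State} :
      s.reg x = 0 → Exec (.loop x p) s 1 s

/-- The machine is deterministic: final state and number of steps are functions of the program
and the initial state. -/
theorem Exec.deterministic {p : Program} {s s₁ s₂ : State} {t₁ t₂ : ℕ}
    (h₁ : Exec p s t₁ s₁) (h₂ : Exec p s t₂ s₂) : t₁ = t₂ ∧ s₁ = s₂ := by
  induction h₁ generalizing t₂ s₂ with
  | skip | const | add | sub | load | store => cases h₂; exact ⟨rfl, rfl⟩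
  | seq _ _ ih ih' =>
    cases h₂ with
    | seq a b =>
      obtain ⟨rfl, rfl⟩ := ih a
      obtain ⟨rfl, rfl⟩ := ih' b
      exact ⟨rfl, rfl⟩
  | condPos h _ ih =>
    cases h₂ with
    | condPos _ a => obtain ⟨rfl, rfl⟩ := ih a; exact ⟨rfl, rfl⟩
    | condZero h' _ => exact absurd h' h
  | condZero h _ ih =>
    cases h₂ with
    | condPos h' _ => exact absurd h h'
    | condZero _ a => obtain ⟨rfl, rfl⟩ := ih a; exact ⟨rfl, rfl⟩
  | loopPos h _ _ ih ih' =>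
    cases h₂ with
    | loopPos _ a b =>
      obtain ⟨rfl, rfl⟩ := ih a
      obtain ⟨rfl, rfl⟩ := ih' b
      exact ⟨rfl, rfl⟩
    | loopZero h' => exact absurd h' h
  | loopZero h =>
    cases h₂ with
    | loopPos h' _ _ => exact absurd h h'
    | loopZero _ => exact ⟨rfl, rfl⟩

/-- The initial state for the input `(n, W)`: register `0` holds `n`, register `1` the length of
`W`, and the `k`-th cells of the banks `0`, `1`, `2` hold the indices `i`, `j` and the sign
(`1` or `0`) of the `k`-th letter of `W`; everything else is `0`. -/
def inputState (n : ℕ) (W : BraidGroup.BandWord n) : State where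
  reg x := if x = 0 then n else if x = 1 then W.length else 0
  mem b k :=
    match W[k]? with
    | none => 0
    | some a =>
      if b = 0 then a.i.val
      else if b = 1 then a.j.val
      else if b = 2 then (if a.sign then 1 else 0)
      else 0

end RAM

/-!
The characterization rests on two facts about `δ`: conjugation by `δ` permutes the band generators,
and every band generator divides `δ`, so that `δ a⁻¹` is a canonical factor `A` of length `n - 2`
for each band `a`. A braid with one negative band is conjugate to `a⁻¹ P` with `P` strongly
quasipositive, that is, to `δ⁻¹ A P` with `A = δ a⁻¹`. If no conjugate is strongly quasipositive,
then the infimum of the class is `-1`. Among the factorizations of `A P` into canonical factors with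
first factor at least as long as `A`, one of smallest weight is left-weighted. Its first factor has
length `n - 2`: otherwise it would be `δ`, and `δ⁻¹ A P` would be strongly quasipositive.
Conversely, `A₁` of length `n - 2` is `δ` with a band cut off, so that `δ⁻¹ A₁ ⋯ A_k` is conjugate
to an almost strongly quasipositive braid; and the class contains no strongly quasipositive braid,
since its largest infimum is negative. Lengths are controlled by the exponent sum. This is
`BraidGroup.conjASQPNotSQP_iff`.

The decision procedure does not compute canonical forms. It searches the finite graph whose vertices
are the words of a fixed length `N` in the letters `a_{ij}^{±1}` and blanks, and whose edges are
cyclic rotations and a few rules for the first two letters: free cancellation, moves of blanks, and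
relations between two bands each. A braid is conjugate to one with at most `k ≤ 1` negative bands
if and only if the component of its padded word contains a word with at most `k` negative letters.
The point is that some `N` polynomial in `n` and linear in the word length suffices. This follows
from Garside's theory of the classical braid monoid, developed here for Artin monoids of
triangle-free graphs (`ArtinMonoid.genLcm`): the monoid is cancellative and has conditional least
common multiples, it embeds in the braid group (`BraidMonoid.toGroup_injective`), and the full twist
is central and divisible by every generator. So every word of length `L` becomes `z⁻ᵏ P` with `z`
the full twist, `k` linear in `L` for fixed `n`, and `P` positive, through words of bounded length;
and conjugate positive braids `P`, `Q` are connected by conjugations with divisors of `z` that stay positive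
(`BraidMonoid.conj_chain`). A positive word keeps its length under the relations of the monoid, so
that no step exceeds the bound (`BraidGroup.cyclicEq_of_isConj`). A word with few negative letters
that represents a conjugate may be longer than the input; the exponent sum, which is a conjugacy
invariant, bounds its length (`BraidGroup.exists_conj_filtration_iff`).

Words are numbers in base `2n²`, one digit for each letter, and the program stores the edges in an
array, marks the component of the input by as many passes over the array as there are vertices, and
counts negative letters. It takes `O(K⁴)` steps for `K = (2n²)^N` vertices, which is exponential in
a polynomial in `n` times the word length (`RAM.run_decider`, `RAM.cost_le`). The correctness proof
uses a small program logic with time bounds, `RAM.Run`.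
-/

/-! ### Relations between band generators -/

namespace BraidGroup

variable {n : ℕ}

theorem sigma_of_lt {i : ℕ} (h : i < n - 1) : sigma n i = PresentedGroup.of ⟨i, h⟩ := dif_pos h

theorem sigma_of_le {i : ℕ} (h : n - 1 ≤ i) : sigma n i = 1 := dif_neg (by omega)

theorem sigma_comm {i j : ℕ} (h : i + 1 < j) :
    sigma n i * sigma n j = sigma n j * sigma n i := by
  by_cases hj : j < n - 1
  · rw [sigma_of_lt (show i < n - 1 by omega), sigma_of_lt hj]
    exact PresentedGroup.mk_eq_mk_of_mul_inv_mem (rels := braidRels n)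
      (x := FreeGroup.of ⟨i, by omega⟩ * FreeGroup.of ⟨j, hj⟩)
      (y := FreeGroup.of ⟨j, hj⟩ * FreeGroup.of ⟨i, by omega⟩) (Or.inl ⟨_, _, h, rfl⟩)
  · simp [sigma_of_le (show n - 1 ≤ j by omega)]

theorem sigma_braid {i : ℕ} (h : i + 1 < n - 1) :
    sigma n i * sigma n (i + 1) * sigma n i = sigma n (i + 1) * sigma n i * sigma n (i + 1) := by
  rw [sigma_of_lt (show i < n - 1 by omega), sigma_of_lt h]
  exact PresentedGroup.mk_eq_mk_of_mul_inv_mem (rels := braidRels n)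
    (x := FreeGroup.of ⟨i, by omega⟩ * FreeGroup.of ⟨i + 1, h⟩ * FreeGroup.of ⟨i, by omega⟩)
    (y := FreeGroup.of ⟨i + 1, h⟩ * FreeGroup.of ⟨i, by omega⟩ * FreeGroup.of ⟨i + 1, h⟩)
    (Or.inr ⟨_, _, rfl, rfl⟩)

theorem band_succ_self (i : ℕ) : band n i (i + 1) = sigma n i := by
  simp [band, bandConjugator]

theorem band_succ {i j : ℕ} (h : i < j) :
    band n i (j + 1) = sigma n j * band n i j * (sigma n j)⁻¹ := by
  have : bandConjugator n i (j + 1) = sigma n j * bandConjugator n i j := by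
    obtain ⟨k, rfl⟩ := Nat.exists_eq_add_of_lt h
    have e1 : i + k + 1 - i = k + 1 := by omega
    have e2 : i + 1 + k = i + k + 1 := by omega
    simp [bandConjugator, e1, e2, List.range'_concat]
  rw [band, this, band]
  group

/-- A band generator commutes with the Artin generators to its right. -/
theorem sigma_band_comm {i j k : ℕ} (hij : i < j) (hjk : j < k) :
    sigma n k * band n i j = band n i j * sigma n k := by
  induction j, hij using Nat.le_induction with
  | base => rw [Nat.succ_eq_add_one, band_succ_self, sigma_comm hjk]
  | succ j hij ih =>
    have h1 : Commute (sigma n k) (sigma n j) := (sigma_comm (n := n) (by omega)).symm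
    have h2 : Commute (sigma n k) (band n i j) := ih (by omega)
    rw [band_succ hij]
    exact ((h1.mul_right h2).mul_right h1.inv_right).eq

/-- The braid relation between `a_{ij}` and `σ_j`, solved for one of the band relations. -/
theorem band_mul_band_succ {i j : ℕ} (hij : i < j) (hj : j < n - 1) :
    band n i j * band n i (j + 1) = sigma n j * band n i j := by
  suffices h : band n i j * sigma n j * band n i j = sigma n j * band n i j * sigma n j by
    rw [band_succ hij, ← mul_assoc, ← mul_assoc, h]; group
  induction j, hij using Nat.le_induction with
  | base => rw [Nat.succ_eq_add_one, band_succ_self, sigma_braid hj]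
  | succ j hij ih =>
    have ih := ih (by omega)
    have hc : sigma n (j + 1) * band n i j = band n i j * sigma n (j + 1) :=
      sigma_band_comm hij (by omega)
    have hb := sigma_braid (n := n) hj
    -- by induction `a_{i,j+1}` is also the conjugate of `σ_j` by `a_{ij}⁻¹`
    have e : band n i (j + 1) = (band n i j)⁻¹ * sigma n j * band n i j := by
      rw [band_succ hij, mul_inv_eq_iff_eq_mul]
      rw [show (band n i j)⁻¹ * sigma n j * band n i j * sigma n j
        = (band n i j)⁻¹ * (sigma n j * band n i j * sigma n j) by group, ← ih]
      group
    rw [e]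
    generalize band n i j = a at hc
    calc a⁻¹ * sigma n j * a * sigma n (j + 1) * (a⁻¹ * sigma n j * a)
        = a⁻¹ * sigma n j * (a * sigma n (j + 1)) * a⁻¹ * sigma n j * a := by group
      _ = a⁻¹ * (sigma n j * sigma n (j + 1) * sigma n j) * a := by rw [← hc]; group
      _ = a⁻¹ * sigma n (j + 1) * sigma n j * (sigma n (j + 1) * a) := by rw [hb]; group
      _ = a⁻¹ * (sigma n (j + 1) * a) * a⁻¹ * sigma n j * a * sigma n (j + 1) := by
        nth_rw 1 [hc]; group
      _ = _ := by rw [hc]; group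

/-- `σ_{k-1} ⋯ σ_0`, the element `δ` of the first `k + 1` strands. -/
def partialDelta (n k : ℕ) : BraidGroup n := ((List.range k).reverse.map (sigma n)).prod

theorem partialDelta_succ (k : ℕ) : partialDelta n (k + 1) = sigma n k * partialDelta n k := by
  simp [partialDelta, List.range_succ]

theorem partialDelta_zero : partialDelta n 0 = 1 := by simp [partialDelta]

theorem delta_eq_partialDelta : delta n = partialDelta n (n - 1) := rfl

theorem partialDelta_comm {k j : ℕ} (h : k < j) :
    partialDelta n k * sigma n j = sigma n j * partialDelta n k := by
  induction k with
  | zero => simp [partialDelta_zero]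
  | succ k ih =>
    rw [partialDelta_succ, mul_assoc, ih (by omega), ← mul_assoc, sigma_comm (by omega), mul_assoc]

theorem partialDelta_mul_sigma {k i : ℕ} (hi : i + 1 < k) (hk : k ≤ n - 1) :
    partialDelta n k * sigma n (i + 1) = sigma n i * partialDelta n k := by
  induction k, hi using Nat.le_induction with
  | base =>
    simp only [Nat.succ_eq_add_one, partialDelta_succ]
    have h := partialDelta_comm (n := n) (show i < i + 1 by omega)
    calc _ = sigma n (i + 1) * sigma n i * (partialDelta n i * sigma n (i + 1)) := by group
      _ = sigma n (i + 1) * sigma n i * sigma n (i + 1) * partialDelta n i := by rw [h]; group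
      _ = _ := by rw [← sigma_braid (by omega)]; group
  | succ k hi ih =>
    rw [partialDelta_succ, mul_assoc, ih (by omega), ← mul_assoc, ← sigma_comm (by omega),
      mul_assoc]

theorem sigma_mul_partialDelta {i : ℕ} (hi : i < n - 1) :
    sigma n i * partialDelta n (i + 1) = partialDelta n (i + 1) * band n 0 (i + 1) := by
  induction i with
  | zero => simp [partialDelta_succ, partialDelta_zero, band_succ_self]
  | succ i ih =>
    have ih := ih (by omega)
    have h2 := partialDelta_mul_sigma (n := n) (show i + 1 < i + 2 by omega) (by omega)
    rw [band_succ (by omega), ← mul_assoc, ← mul_assoc, h2, eq_mul_inv_iff_mul_eq]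
    calc sigma n (i + 1) * partialDelta n (i + 1 + 1) * sigma n (i + 1)
        = sigma n (i + 1) * sigma n i * sigma n (i + 1) * partialDelta n (i + 1) := by
          rw [mul_assoc, h2, partialDelta_succ (i + 1)]; group
      _ = sigma n i * sigma n (i + 1) * (sigma n i * partialDelta n (i + 1)) := by
          rw [← sigma_braid hi]; group
      _ = _ := by rw [ih, partialDelta_succ (i + 1)]; group

theorem band_mul_partialDelta {i k : ℕ} (hi : i < k) (hk : k ≤ n - 1) :
    band n i k * partialDelta n k = partialDelta n k * band n 0 (i + 1) := by
  induction k, hi using Nat.le_induction with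
  | base => rw [Nat.succ_eq_add_one, band_succ_self, sigma_mul_partialDelta (by omega)]
  | succ k hi ih =>
    rw [band_succ hi, partialDelta_succ, mul_assoc (sigma n k) (partialDelta n k), ← ih (by omega)]
    group

/-- Conjugation by `δ` rotates a band generator not involving the last strand. -/
theorem delta_mul_band_succ {i j : ℕ} (hij : i < j) (hj : j < n - 1) :
    delta n * band n (i + 1) (j + 1) = band n i j * delta n := by
  rw [delta_eq_partialDelta]
  induction j, hij using Nat.le_induction with
  | base =>
    rw [Nat.succ_eq_add_one, band_succ_self, band_succ_self, partialDelta_mul_sigma hj le_rfl]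
  | succ j hij ih =>
    have ih := ih (by omega)
    have h := partialDelta_mul_sigma (n := n) (show j + 1 < n - 1 by omega) le_rfl
    rw [band_succ (i := i + 1) (by omega), band_succ hij, ← mul_assoc, ← mul_assoc, h,
      mul_inv_eq_iff_eq_mul]
    calc _ = sigma n j * (partialDelta n (n - 1) * band n (i + 1) (j + 1)) := by group
      _ = sigma n j * band n i j * (sigma n j)⁻¹ * (sigma n j * partialDelta n (n - 1)) := by
        rw [ih]; group
      _ = _ := by rw [← h]; group

/-- Conjugation by `δ` rotates a band generator involving the last strand. -/
theorem delta_mul_band_zero {i : ℕ} (hi : i < n - 1) :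
    delta n * band n 0 (i + 1) = band n i (n - 1) * delta n :=
  (band_mul_partialDelta hi le_rfl).symm

/-! ### Strongly quasipositive braids and the exponent sum -/

theorem BandWord.toBraid_append (V W : BandWord n) :
    BandWord.toBraid (V ++ W) = V.toBraid * W.toBraid := by simp [BandWord.toBraid]

theorem BandWord.toBraid_cons (a : BandLetter n) (W : BandWord n) :
    BandWord.toBraid (a :: W) = a.toBraid * W.toBraid := by simp [BandWord.toBraid]

theorem BandWord.nb_append (V W : BandWord n) :
    BandWord.nb (V ++ W) = V.nb + W.nb := by simp [BandWord.nb]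

theorem filtration_mul {k l : ℕ} {x y : BraidGroup n} (hx : x ∈ filtration n k)
    (hy : y ∈ filtration n l) : x * y ∈ filtration n (k + l) := by
  obtain ⟨V, rfl, hV⟩ := hx
  obtain ⟨W, rfl, hW⟩ := hy
  exact ⟨V ++ W, BandWord.toBraid_append V W, by rw [BandWord.nb_append]; omega⟩

theorem SQP.one_mem : (1 : BraidGroup n) ∈ SQP n := ⟨[], rfl, le_rfl⟩

theorem SQP.mul_mem {x y : BraidGroup n} (hx : x ∈ SQP n) (hy : y ∈ SQP n) : x * y ∈ SQP n :=
  filtration_mul hx hy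

theorem SQP.band_mem {i j : ℕ} (hij : i < j) (hj : j < n) : band n i j ∈ SQP n :=
  ⟨[⟨⟨i, by omega⟩, ⟨j, hj⟩, hij, true⟩], by simp [BandWord.toBraid, BandLetter.toBraid],
    by simp [BandWord.nb]⟩

theorem SQP.sigma_mem (i : ℕ) : sigma n i ∈ SQP n := by
  by_cases h : i < n - 1
  · rw [← band_succ_self]; exact SQP.band_mem (by omega) (by omega)
  · rw [sigma_of_le (by omega)]; exact SQP.one_mem

theorem SQP.list_prod_mem {l : List (BraidGroup n)} (h : ∀ x ∈ l, x ∈ SQP n) : l.prod ∈ SQP n := by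
  induction l with
  | nil => exact SQP.one_mem
  | cons a l ih =>
    rw [List.prod_cons]
    exact SQP.mul_mem (h a (by simp)) (ih fun x hx => h x (by simp [hx]))

theorem SQP.delta_mem : delta n ∈ SQP n :=
  SQP.list_prod_mem fun x hx => by
    obtain ⟨i, -, rfl⟩ := List.mem_map.1 hx
    exact SQP.sigma_mem i

/-- A submonoid containing the band generators contains every SQP braid. -/
theorem SQP.induction {p : BraidGroup n → Prop} (one : p 1)
    (band_mul : ∀ i j x, i < j → j < n → p x → p (band n i j * x)) {x : BraidGroup n}
    (hx : x ∈ SQP n) : p x := by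
  obtain ⟨W, rfl, hW⟩ := hx
  induction W with
  | nil => exact one
  | cons a W ih =>
    obtain ⟨i, j, hij, s⟩ := a
    cases s with
    | false => simp [BandWord.nb] at hW
    | true =>
      rw [BandWord.toBraid_cons]
      exact band_mul i j _ hij j.2 (ih (by simpa [BandWord.nb] using hW))

/-- The exponent sum in the Artin generators. -/
def expHom (n : ℕ) : BraidGroup n →* Multiplicative ℤ :=
  PresentedGroup.toGroup (f := fun _ => Multiplicative.ofAdd 1) (by
    rintro w (⟨i, j, -, rfl⟩ | ⟨i, j, -, rfl⟩)
    · simp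
    · simp)

/-- The exponent sum, as an integer. -/
def expSum (x : BraidGroup n) : ℤ := Multiplicative.toAdd (expHom n x)

@[simp] theorem expSum_mul (x y : BraidGroup n) : expSum (x * y) = expSum x + expSum y := by
  simp [expSum]

@[simp] theorem expSum_inv (x : BraidGroup n) : expSum x⁻¹ = -expSum x := by simp [expSum]

@[simp] theorem expSum_one : expSum (1 : BraidGroup n) = 0 := by simp [expSum]

@[simp] theorem expSum_zpow (x : BraidGroup n) (k : ℤ) : expSum (x ^ k) = k * expSum x := by
  simp [expSum]

theorem expSum_sigma {i : ℕ} (h : i < n - 1) : expSum (sigma n i) = 1 := by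
  rw [sigma_of_lt h, expSum, expHom, PresentedGroup.toGroup.of]; rfl

theorem expSum_conj {x y : BraidGroup n} (h : IsConj x y) : expSum x = expSum y := by
  obtain ⟨c, rfl⟩ := isConj_iff.1 h
  simp

theorem expSum_band {i j : ℕ} (hij : i < j) (hj : j < n) : expSum (band n i j) = 1 := by
  simp [band, expSum_sigma (show i < n - 1 by omega)]

theorem expSum_delta : expSum (delta n) = (n - 1 : ℕ) := by
  have : ∀ k ≤ n - 1, expSum (partialDelta n k) = k := by
    intro k
    induction k with
    | zero => simp [partialDelta_zero]
    | succ k ih =>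
      intro hk
      rw [partialDelta_succ, expSum_mul, expSum_sigma (by omega), ih (by omega)]
      push_cast; ring
  exact this _ le_rfl

theorem BandLetter.expSum_toBraid (a : BandLetter n) :
    expSum a.toBraid = if a.sign then 1 else -1 := by
  obtain ⟨i, j, hij, s⟩ := a
  cases s <;> simp [BandLetter.toBraid, expSum_band (show i.val < j from hij) j.2]

theorem BandWord.expSum_toBraid (W : BandWord n) :
    expSum W.toBraid = W.length - 2 * W.nb := by
  induction W with
  | nil => simp [BandWord.toBraid, BandWord.nb]
  | cons a W ih =>
    rw [BandWord.toBraid_cons, expSum_mul, ih, BandLetter.expSum_toBraid]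
    cases h : a.sign <;> simp [BandWord.nb, h] <;> ring

theorem SQP.expSum_nonneg {x : BraidGroup n} (hx : x ∈ SQP n) : 0 ≤ expSum x := by
  obtain ⟨W, rfl, hW⟩ := hx
  rw [BandWord.expSum_toBraid]; omega

theorem SQP.eq_one_of_expSum {x : BraidGroup n} (hx : x ∈ SQP n) (h : expSum x ≤ 0) : x = 1 := by
  obtain ⟨W, rfl, hW⟩ := hx
  rw [BandWord.expSum_toBraid] at h
  have : W = [] := List.length_eq_zero_iff.1 (by omega)
  rw [this]; rfl

theorem SQP.eq_band_of_expSum {x : BraidGroup n} (hx : x ∈ SQP n) (h : expSum x = 1) :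
    ∃ i j, i < j ∧ j < n ∧ x = band n i j := by
  obtain ⟨W, rfl, hW⟩ := hx
  rw [BandWord.expSum_toBraid] at h
  obtain ⟨a, rfl⟩ := List.length_eq_one_iff.1 (show W.length = 1 by omega)
  obtain ⟨i, j, hij, s⟩ := a
  cases s with
  | false => simp [BandWord.nb] at hW
  | true => exact ⟨i, j, hij, j.2, by simp [BandWord.toBraid, BandLetter.toBraid]⟩

/-- On SQP braids the band length is the exponent sum. -/
theorem SQP.hasBandLength {x : BraidGroup n} (hx : x ∈ SQP n) {m : ℕ} :
    HasBandLength x m ↔ expSum x = m := by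
  have key : ∀ k : ℕ, expSum x = k → HasBandLength x k := by
    intro k hk
    constructor
    · obtain ⟨W, rfl, hW⟩ := hx
      rw [BandWord.expSum_toBraid] at hk
      exact ⟨W, rfl, by omega⟩
    · rintro l ⟨W, rfl, rfl⟩
      rw [BandWord.expSum_toBraid] at hk
      omega
  obtain ⟨k, hk⟩ := Int.eq_ofNat_of_zero_le (SQP.expSum_nonneg hx)
  refine ⟨fun h => ?_, key m⟩
  rw [h.unique (key k hk)]; exact hk

/-! ### Conjugation by `δ`, canonical factors and the infimum -/

theorem SQP.delta_conj {x : BraidGroup n} (hx : x ∈ SQP n) :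
    (delta n)⁻¹ * x * delta n ∈ SQP n := by
  refine SQP.induction (p := fun x => (delta n)⁻¹ * x * delta n ∈ SQP n)
    (by simpa using SQP.one_mem) (fun i j x hij hj ih => ?_) hx
  have h : (delta n)⁻¹ * (band n i j * x) * delta n
      = ((delta n)⁻¹ * (band n i j * delta n)) * ((delta n)⁻¹ * x * delta n) := by group
  rw [h]
  refine SQP.mul_mem ?_ ih
  by_cases hj' : j < n - 1
  · rw [← delta_mul_band_succ hij hj', inv_mul_cancel_left]
    exact SQP.band_mem (by omega) (by omega)
  · obtain rfl : j = n - 1 := by omega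
    rw [← delta_mul_band_zero hij, inv_mul_cancel_left]
    exact SQP.band_mem (by omega) (by omega)

theorem SQP.delta_conj' {x : BraidGroup n} (hx : x ∈ SQP n) :
    delta n * x * (delta n)⁻¹ ∈ SQP n := by
  refine SQP.induction (p := fun x => delta n * x * (delta n)⁻¹ ∈ SQP n)
    (by simpa using SQP.one_mem) (fun i j x hij hj ih => ?_) hx
  have h : delta n * (band n i j * x) * (delta n)⁻¹
      = (delta n * band n i j) * (delta n)⁻¹ * (delta n * x * (delta n)⁻¹) := by group
  rw [h]
  refine SQP.mul_mem ?_ ih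
  obtain _ | i := i
  · obtain ⟨j, rfl⟩ := Nat.exists_eq_succ_of_ne_zero (show j ≠ 0 by omega)
    rw [Nat.succ_eq_add_one, delta_mul_band_zero (by omega), mul_inv_cancel_right]
    exact SQP.band_mem (by omega) (by omega)
  · obtain ⟨j, rfl⟩ := Nat.exists_eq_succ_of_ne_zero (show j ≠ 0 by omega)
    rw [Nat.succ_eq_add_one, delta_mul_band_succ (by omega) (by omega), mul_inv_cancel_right]
    exact SQP.band_mem (by omega) (by omega)

theorem SQP.delta_zpow_conj {x : BraidGroup n} (hx : x ∈ SQP n) (r : ℤ) :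
    (delta n) ^ (-r) * x * (delta n) ^ r ∈ SQP n := by
  induction r with
  | zero => simpa using hx
  | succ r ih =>
    have := SQP.delta_conj ih
    rw [show (delta n) ^ (-((r : ℤ) + 1)) * x * (delta n) ^ ((r : ℤ) + 1)
      = (delta n)⁻¹ * ((delta n) ^ (-(r : ℤ)) * x * (delta n) ^ (r : ℤ)) * delta n by group]
    exact this
  | pred r ih =>
    have := SQP.delta_conj' ih
    rw [show (delta n) ^ (-(-(r : ℤ) - 1)) * x * (delta n) ^ (-(r : ℤ) - 1)
      = delta n * ((delta n) ^ (-(-(r : ℤ))) * x * (delta n) ^ (-(r : ℤ))) * (delta n)⁻¹ by group]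
    exact this

/-- The order `≤` against a power of `δ`, with the positive part collected on the right. -/
theorem braidLE_delta_zpow {r : ℤ} {x : BraidGroup n} :
    BraidLE (delta n ^ r) x ↔ delta n ^ (-r) * x ∈ SQP n := by
  constructor
  · rintro ⟨P, hP, Q, hQ, rfl⟩
    rw [show delta n ^ (-r) * (P * delta n ^ r * Q) = delta n ^ (-r) * P * delta n ^ r * Q by group]
    exact SQP.mul_mem (SQP.delta_zpow_conj hP r) hQ
  · intro h
    exact ⟨1, SQP.one_mem, _, h, by group⟩

theorem braidLE_one {x : BraidGroup n} : BraidLE 1 x ↔ x ∈ SQP n := by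
  simpa using braidLE_delta_zpow (r := 0) (x := x)

theorem braidLE_delta_zpow_mono {r s : ℤ} (hrs : r ≤ s) {x : BraidGroup n}
    (h : BraidLE (delta n ^ s) x) : BraidLE (delta n ^ r) x := by
  rw [braidLE_delta_zpow] at *
  obtain ⟨k, hk⟩ := Int.eq_ofNat_of_zero_le (show 0 ≤ s - r by omega)
  rw [show delta n ^ (-r) * x = delta n ^ (s - r) * (delta n ^ (-s) * x) by group, hk]
  refine SQP.mul_mem ?_ h
  rw [zpow_natCast, ← List.prod_replicate]
  exact SQP.list_prod_mem fun y hy => by rw [List.eq_of_mem_replicate hy]; exact SQP.delta_mem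

/-- The infimum exists: the exponent sum bounds it above. -/
theorem exists_hasInf (hn : 2 ≤ n) {r : ℤ} {x : BraidGroup n} (h : BraidLE (delta n ^ r) x) :
    ∃ s, r ≤ s ∧ HasInf x s := by
  obtain ⟨s, hs, hmax⟩ := Int.exists_greatest_of_bdd (P := fun s => BraidLE (delta n ^ s) x)
    ⟨max 0 (expSum x), fun s hs => by
      have := SQP.expSum_nonneg (braidLE_delta_zpow.1 hs)
      rw [expSum_mul, expSum_zpow, expSum_delta] at this
      have hn' : (1 : ℤ) ≤ ((n - 1 : ℕ) : ℤ) := by omega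
      by_contra hc
      rw [not_le, max_lt_iff] at hc
      nlinarith⟩ ⟨r, h⟩
  exact ⟨s, hmax r h, hs, fun t ht => hmax t ht⟩

theorem IsCanonicalFactor.mem_SQP {A : BraidGroup n} (h : IsCanonicalFactor A) : A ∈ SQP n :=
  braidLE_one.1 h.1

theorem isCanonicalFactor_one : IsCanonicalFactor (1 : BraidGroup n) :=
  ⟨braidLE_one.2 SQP.one_mem, 1, SQP.one_mem, delta n, SQP.delta_mem, by simp⟩

/-- Bands right-divide `δ`. -/
theorem delta_mul_band_inv_mem {i j : ℕ} (hij : i < j) (hj : j < n) :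
    delta n * (band n i j)⁻¹ ∈ SQP n := by
  -- cut `δ` after its letters `σ_k` with `k ≥ j`
  have h1 : ∀ k, j ≤ k → ∃ X ∈ SQP n, partialDelta n k = X * partialDelta n j := by
    intro k hk
    induction k, hk using Nat.le_induction with
    | base => exact ⟨1, SQP.one_mem, by simp⟩
    | succ k hk ih =>
      obtain ⟨X, hX, h⟩ := ih
      exact ⟨sigma n k * X, SQP.mul_mem (SQP.sigma_mem k) hX, by
        rw [partialDelta_succ, h, mul_assoc]⟩
  have h2 : ∃ Y ∈ SQP n, partialDelta n j = band n i j * Y := by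
    clear h1 hj
    induction j, hij using Nat.le_induction with
    | base =>
      exact ⟨partialDelta n i, SQP.list_prod_mem fun x hx => by
        obtain ⟨i, -, rfl⟩ := List.mem_map.1 hx
        exact SQP.sigma_mem i, by rw [Nat.succ_eq_add_one, band_succ_self, partialDelta_succ]⟩
    | succ j hij ih =>
      obtain ⟨Y, hY, h⟩ := ih
      refine ⟨sigma n j * Y, SQP.mul_mem (SQP.sigma_mem j) hY, ?_⟩
      rw [partialDelta_succ, h, band_succ hij]
      group
  obtain ⟨X, hX, hδ⟩ := h1 (n - 1) (by omega)
  obtain ⟨Y, hY, h⟩ := h2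
  rw [← delta_eq_partialDelta, h] at hδ
  have : delta n * (band n i j)⁻¹
      = delta n * (Y * ((delta n)⁻¹ * X * delta n)) * (delta n)⁻¹ := by
    have e : (band n i j)⁻¹ = Y * (delta n)⁻¹ * X := by rw [hδ]; group
    rw [e]; group
  rw [this]
  exact SQP.delta_conj' (SQP.mul_mem hY (SQP.delta_conj hX))

/-- A canonical factor of length `n - 2` is `δ` with one band cut off on the right. -/
theorem IsCanonicalFactor.eq_delta_mul_band_inv (hn : 2 ≤ n) {A : BraidGroup n}
    (hA : IsCanonicalFactor A) (hlen : expSum A = (n - 2 : ℕ)) :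
    ∃ i j, i < j ∧ j < n ∧ A = delta n * (band n i j)⁻¹ := by
  obtain ⟨P, hP, Q, hQ, h⟩ := hA.2
  have h1 : expSum P + expSum Q = 1 := by
    have := congrArg expSum h
    rw [expSum_delta, expSum_mul, expSum_mul, hlen] at this
    omega
  have hx : (delta n)⁻¹ * P * delta n * Q ∈ SQP n := SQP.mul_mem (SQP.delta_conj hP) hQ
  obtain ⟨i, j, hij, hj, e⟩ := SQP.eq_band_of_expSum hx (by simp; omega)
  refine ⟨i, j, hij, hj, ?_⟩
  rw [← e]
  have : A = P⁻¹ * delta n * Q⁻¹ := by rw [h]; group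
  -- one of `P`, `Q` is trivial, so that the two cut-off factors can be merged
  rcases (show expSum P ≤ 0 ∨ expSum Q ≤ 0 by omega) with hp | hq
  · rw [this, SQP.eq_one_of_expSum hP hp]; group
  · rw [this, SQP.eq_one_of_expSum hQ hq]; group

/-! ### Existence of left-canonical forms -/

/-- The sum of the lengths of the factors, each weighted by its position. Moving letters to the
left decreases it. -/
def weight : List (BraidGroup n) → ℤ
  | [] => 0
  | _ :: l => expSum l.prod + weight l

theorem weight_nonneg {l : List (BraidGroup n)} (h : ∀ A ∈ l, IsCanonicalFactor A) :
    0 ≤ weight l := by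
  induction l with
  | nil => exact le_rfl
  | cons A l ih =>
    have h' : ∀ B ∈ l, IsCanonicalFactor B := fun B hB => h B (by simp [hB])
    have := SQP.expSum_nonneg (SQP.list_prod_mem fun x hx => (h' x hx).mem_SQP)
    have := ih h'
    rw [weight]; omega

theorem weight_append (l l' : List (BraidGroup n)) :
    weight (l ++ l') = weight l + l.length * expSum l'.prod + weight l' := by
  induction l with
  | nil => simp [weight]
  | cons A l ih =>
    rw [List.cons_append, weight, weight, ih, List.prod_append, expSum_mul, List.length_cons]
    push_cast; ring

/-- A product of canonical factors can be rewritten as a maximally left-weighted one, the first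
factor getting no shorter. -/
theorem exists_leftWeighted (A : BraidGroup n) (l : List (BraidGroup n))
    (h : ∀ B ∈ A :: l, IsCanonicalFactor B) :
    ∃ B l', (∀ C ∈ B :: l', IsCanonicalFactor C) ∧ (B :: l').prod = (A :: l).prod ∧
      expSum A ≤ expSum B ∧ (B :: l').IsChain MaxLeftWeighted := by
  induction hw : (weight (A :: l)).toNat using Nat.strong_induction_on generalizing A l with
  | _ w ih =>
  by_cases hc : (A :: l).IsChain MaxLeftWeighted
  · exact ⟨A, l, h, rfl, le_rfl, hc⟩
  simp only [List.isChain_iff_forall_rel_of_append_cons_cons, not_forall, MaxLeftWeighted] at hc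
  obtain ⟨X, Y, l₁, l₂, e, X', Y', hX', hY', hXY, ⟨Q, hQ, rfl⟩, hne⟩ := hc
  have hQ1 : 1 ≤ expSum Q := by
    by_contra hc
    exact hne (by rw [SQP.eq_one_of_expSum hQ.mem_SQP (by omega), mul_one])
  have hY : expSum Y = expSum Q + expSum Y' := by
    have := congrArg expSum hXY
    simp only [expSum_mul] at this
    omega
  rw [e] at h
  have hnew : ∀ C ∈ l₁ ++ X * Q :: Y' :: l₂, IsCanonicalFactor C := by
    intro C hC
    simp only [List.mem_append, List.mem_cons] at hC h
    rcases hC with hC | rfl | rfl | hC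
    · exact h C (Or.inl hC)
    · exact hX'
    · exact hY'
    · exact h C (by tauto)
  have hw' : weight (l₁ ++ X * Q :: Y' :: l₂) < weight (A :: l) := by
    rw [e, weight_append, weight_append]
    simp only [weight, List.prod_cons, expSum_mul, hY]
    rw [show expSum X + expSum Q + (expSum Y' + expSum l₂.prod)
      = expSum X + (expSum Q + expSum Y' + expSum l₂.prod) by ring]
    omega
  have hprod : (l₁ ++ X * Q :: Y' :: l₂).prod = (A :: l).prod := by
    rw [e]
    simp only [List.prod_append, List.prod_cons]
    rw [← mul_assoc X Y, hXY]; group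
  have hw0 := weight_nonneg hnew
  obtain ⟨B, l', hB⟩ : ∃ B l', l₁ ++ X * Q :: Y' :: l₂ = B :: l' := by
    cases l₁ <;> simp
  have hAB : expSum A ≤ expSum B := by
    cases l₁ with
    | nil =>
      simp only [List.nil_append, List.cons.injEq] at hB e
      rw [← hB.1, e.1, expSum_mul]; omega
    | cons C l₁ =>
      simp only [List.cons_append, List.cons.injEq] at hB e
      rw [← hB.1, e.1]
  rw [hB] at hw' hnew hprod hw0
  obtain ⟨C, l'', hC, hp, hle, hch⟩ := ih _ (by omega) B l' hnew rfl
  exact ⟨C, l'', hC, hp.trans hprod, hAB.trans hle, hch⟩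

/-- In a maximally left-weighted product the trivial factors come last; they can be dropped. -/
theorem exists_prefix_ne_one {l : List (BraidGroup n)} (h : ∀ C ∈ l, IsCanonicalFactor C)
    (hl : l.IsChain MaxLeftWeighted) :
    ∃ l', l' <+: l ∧ l'.prod = l.prod ∧ (∀ C ∈ l', C ≠ 1) ∧
      (l.head? ≠ some 1 → l'.head? = l.head?) := by
  induction l with
  | nil => exact ⟨[], by simp⟩
  | cons A l ih =>
    obtain ⟨l', hpre, hprod, hne, hhead⟩ := ih (fun C hC => h C (by simp [hC])) hl.tail
    by_cases hA : A = 1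
    · subst hA
      refine ⟨[], by simp, ?_, by simp, by simp⟩
      have : l.head? = none ∨ l.head? = some 1 := by
        cases l with
        | nil => simp
        | cons B l =>
          right
          have hB := h B (by simp)
          rw [List.isChain_cons_cons] at hl
          have := hl.1 B 1 hB isCanonicalFactor_one (by simp) ⟨B, hB, by simp⟩
          simp [this]
      rw [List.prod_cons, one_mul, ← hprod]
      have hl' : l' = [] := by
        cases l' with
        | nil => rfl
        | cons B l' =>
          obtain ⟨t, ht⟩ := hpre
          rw [← ht] at this
          simp only [List.cons_append, List.head?_cons, reduceCtorEq, Option.some.injEq, false_or]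
            at this
          exact absurd this (hne B (by simp))
      simp [hl']
    · refine ⟨A :: l', ?_, by simp [hprod], ?_, by simp⟩
      · obtain ⟨t, ht⟩ := hpre
        exact ⟨t, by simp [ht]⟩
      · intro C hC
        rcases List.mem_cons.1 hC with rfl | hC
        · exact hA
        · exact hne C hC

/-! ### The characterization of conjugates of almost strongly quasipositive braids -/

theorem ASQP.of_delta_inv (hn : 2 ≤ n) {A x : BraidGroup n} (hA : IsCanonicalFactor A)
    (hlen : expSum A = (n - 2 : ℕ)) (hx : x ∈ SQP n) : (delta n)⁻¹ * A * x ∈ ASQP n := by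
  obtain ⟨i, j, hij, hj, rfl⟩ := hA.eq_delta_mul_band_inv hn hlen
  rw [inv_mul_cancel_left]
  refine filtration_mul (k := 1) (l := 0) ?_ hx
  exact ⟨[⟨⟨i, by omega⟩, ⟨j, hj⟩, hij, false⟩], by simp [BandWord.toBraid, BandLetter.toBraid],
    by simp [BandWord.nb]⟩

theorem ASQP.exists_conj {x : BraidGroup n} (hx : x ∈ ASQP n) (hx' : x ∉ SQP n) :
    ∃ i j, i < j ∧ j < n ∧ ∃ y ∈ SQP n, IsConj x ((band n i j)⁻¹ * y) := by
  obtain ⟨W, rfl, hW⟩ := hx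
  have h1 : W.nb = 1 := by
    by_contra h
    exact hx' ⟨W, rfl, by omega⟩
  have hpos : 0 < W.countP fun a => !a.sign := by rw [BandWord.nb] at h1; omega
  obtain ⟨a, ha, hs⟩ := List.countP_pos_iff.1 hpos
  obtain ⟨U, V, rfl⟩ := List.append_of_mem ha
  obtain ⟨i, j, hij, s⟩ := a
  simp only [Bool.not_eq_eq_eq_not, Bool.not_true] at hs
  subst hs
  have hUV : BandWord.nb (V ++ U) = 0 := by
    simp only [BandWord.nb, List.countP_append, List.countP_cons, Bool.not_false, if_true] at h1 ⊢
    omega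
  refine ⟨i, j, hij, j.2, _, ⟨V ++ U, rfl, hUV.le⟩, isConj_iff.2 ⟨(BandWord.toBraid U)⁻¹, ?_⟩⟩
  rw [BandWord.toBraid_append, BandWord.toBraid_append, BandWord.toBraid_cons]
  simp only [BandLetter.toBraid, Bool.false_eq_true, if_false]
  group

theorem conjASQPNotSQP_iff (hn : 3 ≤ n) (β : BraidGroup n) :
    ConjASQPNotSQP β ↔ ∃ β' ∈ summitSet β, HasInf β' (-1) ∧
      ∃ (A : BraidGroup n) (l : List (BraidGroup n)),
        IsLCF β' (-1) (A :: l) ∧ HasBandLength A (n - 2) := by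
  constructor
  · rintro ⟨⟨γ, hβγ, hγ⟩, hnot⟩
    obtain ⟨i, j, hij, hj, y, hy, hc⟩ := ASQP.exists_conj hγ fun h => hnot ⟨γ, hβγ, h⟩
    have hβ' : IsConj β ((band n i j)⁻¹ * y) := hβγ.trans hc
    have hAy : (band n i j)⁻¹ * y
        = delta n ^ (-1 : ℤ) * ((delta n * (band n i j)⁻¹) * y) := by group
    generalize (band n i j)⁻¹ * y = β' at *
    have hA := delta_mul_band_inv_mem hij hj
    have hAlen : expSum (delta n * (band n i j)⁻¹) = (n - 2 : ℕ) := by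
      rw [expSum_mul, expSum_inv, expSum_delta, expSum_band hij hj]; omega
    have hAδ : BraidLE (delta n * (band n i j)⁻¹) (delta n) :=
      ⟨1, SQP.one_mem, _, SQP.band_mem hij hj, by group⟩
    have hAcan : IsCanonicalFactor (delta n * (band n i j)⁻¹) := ⟨braidLE_one.2 hA, hAδ⟩
    generalize delta n * (band n i j)⁻¹ = A at *
    have hneg : ∀ γ, IsConj β γ → ∀ s : ℤ, BraidLE (delta n ^ s) γ → s ≤ -1 := by
      intro γ hγ s hs
      by_contra hc
      refine hnot ⟨γ, hγ, ?_⟩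
      have := braidLE_delta_zpow_mono (r := 0) (by omega) hs
      rwa [zpow_zero, braidLE_one] at this
    have hinf : HasInf β' (-1) := by
      refine ⟨braidLE_delta_zpow.2 ?_, fun s hs => hneg β' hβ' s hs⟩
      rw [hAy, ← mul_assoc, ← zpow_add]
      simpa using SQP.mul_mem hA hy
    refine ⟨β', ⟨hβ', -1, hinf, ⟨β', hβ', hinf⟩, ?_⟩, hinf, ?_⟩
    · rintro s ⟨γ, hγ, hs⟩
      exact hneg γ hγ s hs.1
    -- the bands of `y` are canonical factors
    obtain ⟨l, hl, hly⟩ : ∃ l : List (BraidGroup n), (∀ B ∈ l, IsCanonicalFactor B) ∧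
        l.prod = y := by
      refine SQP.induction (p := fun y => ∃ l : List (BraidGroup n),
        (∀ B ∈ l, IsCanonicalFactor B) ∧ l.prod = y) ⟨[], by simp⟩ ?_ hy
      rintro i j _ hij hj ⟨l, hl, rfl⟩
      refine ⟨band n i j :: l, ?_, by simp⟩
      intro B hB
      rcases List.mem_cons.1 hB with rfl | hB
      · exact ⟨braidLE_one.2 (SQP.band_mem hij hj), _, delta_mul_band_inv_mem hij hj, 1,
          SQP.one_mem, by group⟩
      · exact hl B hB
    obtain ⟨B, l', hcan, hprod, hle, hch⟩ := exists_leftWeighted A l (by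
      intro C hC
      rcases List.mem_cons.1 hC with rfl | hC
      · exact hAcan
      · exact hl C hC)
    have hB1 : B ≠ 1 := by
      rintro rfl
      rw [hAlen, expSum_one] at hle; omega
    obtain ⟨m, hpre, hmprod, hm1, hhead⟩ := exists_prefix_ne_one hcan hch
    obtain ⟨m', rfl⟩ : ∃ m', m = B :: m' := by
      have := hhead (by simpa using hB1)
      cases m with
      | nil => simp at this
      | cons C m => simp at this; exact ⟨m, by rw [this]⟩
    have hmcan : ∀ C ∈ B :: m', IsCanonicalFactor C := fun C hC => hcan C (hpre.subset hC)
    have hβeq : β' = delta n ^ (-1 : ℤ) * (B :: m').prod := by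
      rw [hAy, hmprod, hprod, List.prod_cons, hly]
    have hmδ : ∀ C ∈ B :: m', C ≠ delta n := by
      rintro _ hC rfl
      obtain ⟨U, V, e⟩ := List.append_of_mem hC
      rw [e] at hmcan hβeq
      have hU : U.prod ∈ SQP n := SQP.list_prod_mem fun x hx => (hmcan x (by simp [hx])).mem_SQP
      have hV : V.prod ∈ SQP n := SQP.list_prod_mem fun x hx => (hmcan x (by simp [hx])).mem_SQP
      have : β' ∈ SQP n := by
        rw [hβeq, List.prod_append, List.prod_cons,
          show delta n ^ (-1 : ℤ) * (U.prod * (delta n * V.prod))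
            = (delta n)⁻¹ * U.prod * delta n * V.prod by group]
        exact SQP.mul_mem (SQP.delta_conj hU) hV
      exact hnot ⟨β', hβ', this⟩
    refine ⟨B, m', ⟨hβeq, fun C hC => ⟨hmcan C hC, hm1 C hC, hmδ C hC⟩, hch.prefix hpre⟩, ?_⟩
    have hBcan := hmcan B (by simp)
    rw [SQP.hasBandLength hBcan.mem_SQP]
    obtain ⟨P, hP, Q, hQ, hδ⟩ := hBcan.2
    have hPQ := congrArg expSum hδ
    rw [expSum_delta, expSum_mul, expSum_mul] at hPQ
    have hP0 := SQP.expSum_nonneg hP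
    have hQ0 := SQP.expSum_nonneg hQ
    have : expSum B ≠ (n - 1 : ℕ) := by
      intro hB
      have hP1 := SQP.eq_one_of_expSum hP (by omega)
      have hQ1 := SQP.eq_one_of_expSum hQ (by omega)
      exact hmδ B (by simp) (by rw [hδ, hP1, hQ1]; simp)
    omega
  · rintro ⟨β', ⟨hconj, r, hr, hcls⟩, hinf, A, l, ⟨heq, hcan, -⟩, hlen⟩
    obtain rfl : r = -1 := hr.unique hinf
    have hA := (hcan A (by simp)).1
    refine ⟨⟨β', hconj, ?_⟩, ?_⟩
    · rw [SQP.hasBandLength hA.mem_SQP] at hlen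
      rw [heq, List.prod_cons, zpow_neg_one, ← mul_assoc]
      exact ASQP.of_delta_inv (by omega) hA hlen
        (SQP.list_prod_mem fun x hx => (hcan x (by simp [hx])).1.mem_SQP)
    · rintro ⟨γ, hγ, hSQP⟩
      obtain ⟨s, hs, hsinf⟩ := exists_hasInf (n := n) (by omega) (r := 0)
        (by rw [zpow_zero, braidLE_one]; exact hSQP)
      have := hcls.2 ⟨γ, hγ, hsinf⟩
      omega

end BraidGroup

/-! ### Artin monoids of triangle-free graphs: cancellation and least common multiples -/

/-- The relations of the Artin monoid of a graph: adjacent generators satisfy the braid relation,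
the others commute. -/
inductive ArtinRel {S : Type*} (G : SimpleGraph S) : FreeMonoid S → FreeMonoid S → Prop
  | far {a b : S} : ¬ G.Adj a b →
      ArtinRel G (FreeMonoid.of a * FreeMonoid.of b) (FreeMonoid.of b * FreeMonoid.of a)
  | near {a b : S} : G.Adj a b →
      ArtinRel G (FreeMonoid.of a * FreeMonoid.of b * FreeMonoid.of a)
        (FreeMonoid.of b * FreeMonoid.of a * FreeMonoid.of b)

/-- The Artin monoid (of small type) of a graph. -/
abbrev ArtinMonoid {S : Type*} (G : SimpleGraph S) : Type _ := PresentedMonoid (ArtinRel G)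

namespace ArtinMonoid

variable {S : Type*} {G : SimpleGraph S}

/-- The generator attached to a vertex. -/
def gen (G : SimpleGraph S) (a : S) : ArtinMonoid G := PresentedMonoid.of (ArtinRel G) a

/-- The element represented by a word. -/
def ofWord (G : SimpleGraph S) (l : List S) : ArtinMonoid G := (l.map (gen G)).prod

theorem mk_ofList (l : List S) :
    PresentedMonoid.mk (ArtinRel G) (FreeMonoid.ofList l) = ofWord G l := by
  induction l with
  | nil => simp [ofWord]
  | cons a l ih => rw [FreeMonoid.ofList_cons, map_mul, ih]; simp [ofWord, gen, PresentedMonoid.of]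

theorem ofWord_surjective (x : ArtinMonoid G) : ∃ l, ofWord G l = x := by
  induction x using PresentedMonoid.inductionOn with
  | _ w => exact ⟨FreeMonoid.toList w, by rw [← mk_ofList]; rfl⟩

@[simp] theorem ofWord_nil : ofWord G [] = 1 := rfl

@[simp] theorem ofWord_cons (a : S) (l : List S) : ofWord G (a :: l) = gen G a * ofWord G l := by
  simp [ofWord]

@[simp] theorem ofWord_append (l l' : List S) :
    ofWord G (l ++ l') = ofWord G l * ofWord G l' := by
  simp [ofWord]

theorem eq_one_or_gen_mul (x : ArtinMonoid G) : x = 1 ∨ ∃ a y, x = gen G a * y := by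
  obtain ⟨l, rfl⟩ := ofWord_surjective x
  cases l with
  | nil => exact Or.inl rfl
  | cons a l => exact Or.inr ⟨a, ofWord G l, by simp⟩

theorem gen_comm {a b : S} (h : ¬ G.Adj a b) : gen G a * gen G b = gen G b * gen G a :=
  PresentedMonoid.mk_eq_mk_of_rel (ArtinRel.far h)

theorem gen_braid {a b : S} (h : G.Adj a b) :
    gen G a * gen G b * gen G a = gen G b * gen G a * gen G b :=
  PresentedMonoid.mk_eq_mk_of_rel (ArtinRel.near h)

/-- The length homomorphism. -/
def lenHom (G : SimpleGraph S) : ArtinMonoid G →* Multiplicative ℕ :=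
  PresentedMonoid.lift (fun _ => Multiplicative.ofAdd 1) (by
    rintro _ _ (_ | _) <;> simp)

/-- The length of an element, that is, of any word representing it. -/
def len (x : ArtinMonoid G) : ℕ := Multiplicative.toAdd (lenHom G x)

@[simp] theorem len_mul (x y : ArtinMonoid G) : len (x * y) = len x + len y := by simp [len]

@[simp] theorem len_one : len (1 : ArtinMonoid G) = 0 := by simp [len]

@[simp] theorem len_gen (a : S) : len (gen G a) = 1 := rfl

@[simp] theorem len_ofWord (l : List S) : len (ofWord G l) = l.length := by
  induction l with
  | nil => simp
  | cons a l ih => simp [ih, add_comm]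

theorem eq_one_of_len {x : ArtinMonoid G} (h : len x = 0) : x = 1 := by
  rcases eq_one_or_gen_mul x with rfl | ⟨a, y, rfl⟩
  · rfl
  · simp at h

open Classical in
/-- The right complement: `gen a * comp a b = gen b * comp b a` is the least common right multiple
of two generators. -/
noncomputable def comp (G : SimpleGraph S) (a b : S) : ArtinMonoid G :=
  if a = b then 1 else if G.Adj a b then gen G b * gen G a else gen G b

theorem comp_self (a : S) : comp G a a = 1 := if_pos rfl

theorem comp_near {a b : S} (h : G.Adj a b) : comp G a b = gen G b * gen G a := by
  rw [comp, if_neg h.ne, if_pos h]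

theorem comp_far {a b : S} (hab : a ≠ b) (h : ¬ G.Adj a b) : comp G a b = gen G b := by
  rw [comp, if_neg hab, if_neg h]

theorem gen_mul_comp (a b : S) : gen G a * comp G a b = gen G b * comp G b a := by
  by_cases hab : a = b
  · rw [hab]
  by_cases h : G.Adj a b
  · rw [comp_near h, comp_near h.symm, ← mul_assoc, gen_braid h, mul_assoc]
  · rw [comp_far hab h, comp_far (Ne.symm hab) fun h' => h h'.symm, gen_comm h]

/-- Common multiples of two generators, of length at most `m`, are multiples of the least one. -/
def GenLcm (G : SimpleGraph S) (m : ℕ) : Prop :=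
  ∀ (a b : S) (x y : ArtinMonoid G), len x + 1 ≤ m → gen G a * x = gen G b * y →
    ∃ z, x = comp G a b * z ∧ y = comp G b a * z

theorem GenLcm.cancel {m : ℕ} (H : GenLcm G m) {a : S} {x y : ArtinMonoid G} (hx : len x + 1 ≤ m)
    (h : gen G a * x = gen G a * y) : x = y := by
  obtain ⟨z, hz, hz'⟩ := H a a x y hx h
  rw [hz, hz']

/-- The cube condition for three generators, where `a`, `b` are at symmetric places: a part of the
case analysis. -/
theorem GenLcm.cube_aux (htri : ∀ a b c, G.Adj a b → G.Adj b c → ¬ G.Adj a c) {m : ℕ}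
    (H : GenLcm G m) {a b c : S} {u v : ArtinMonoid G} (hac : a ≠ c) (hbc : b ≠ c) (hab : a ≠ b)
    (hAdj : G.Adj c a → G.Adj c b)
    (h : comp G c a * u = comp G c b * v) (hlen : len (comp G c a * u) ≤ m) :
    ∃ t, comp G a c * u = comp G a b * t ∧ comp G b c * v = comp G b a * t := by
  have far : ∀ {p q : S}, ¬ G.Adj p q → ∀ x, gen G p * (gen G q * x) = gen G q * (gen G p * x) :=
    fun hpq x => by rw [← mul_assoc, gen_comm hpq, mul_assoc]
  have near : ∀ {p q : S}, G.Adj p q → ∀ x,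
      gen G p * (gen G q * (gen G p * x)) = gen G q * (gen G p * (gen G q * x)) :=
    fun hpq x => by simpa only [mul_assoc] using congrArg (· * x) (gen_braid hpq)
  have nsymm : ∀ {p q : S}, ¬ G.Adj p q → ¬ G.Adj q p := fun h h' => h h'.symm
  have hlen' := congrArg len h
  by_cases h1 : G.Adj c a
  · have h2 := hAdj h1
    have h3 : ¬ G.Adj a b := htri _ _ _ h1.symm h2
    rw [comp_near h1, comp_near h2, mul_assoc, mul_assoc] at h
    rw [comp_near h1, comp_near h2] at hlen'
    rw [comp_near h1] at hlen
    simp only [len_mul, len_gen] at hlen hlen'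
    obtain ⟨z, hz, hz'⟩ := H _ _ _ _ (by simp; omega) h
    rw [comp_far hab h3] at hz
    rw [comp_far hab.symm (nsymm h3)] at hz'
    have l1 := congrArg len hz
    have l2 := congrArg len hz'
    simp only [len_mul, len_gen] at l1 l2
    obtain ⟨p, rfl, hp⟩ := H _ _ _ _ (by omega) hz
    obtain ⟨q, rfl, hq⟩ := H _ _ _ _ (by omega) hz'
    rw [comp_near h2.symm] at hp
    rw [comp_near h1.symm] at hq
    have l3 := congrArg len hp
    rw [hp, mul_assoc, mul_assoc] at hq
    simp only [len_mul, len_gen] at l3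
    have hbq := H.cancel (by simp; omega) hq
    obtain ⟨r, rfl, rfl⟩ := H _ _ _ _ (by omega) hbq
    rw [comp_near h1.symm, comp_near h2.symm, comp_near h1, comp_near h2, comp_far hab h3,
      comp_far hab.symm (nsymm h3)]
    simp only [mul_assoc]
    refine ⟨gen G c * (gen G b * (gen G a * (gen G c * r))), ?_, ?_⟩
    · rw [near h2.symm, far h3 (gen G c * (gen G a * r)), near h1 r]
    · rw [← far h3 (gen G c * r), near h1.symm, near h2, far h3]
  · by_cases h2 : G.Adj c b
    · rw [comp_far hac.symm h1, comp_near h2, mul_assoc] at h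
      rw [comp_far hac.symm h1, comp_near h2] at hlen'
      rw [comp_far hac.symm h1] at hlen
      simp only [len_mul, len_gen] at hlen hlen'
      obtain ⟨z, rfl, hz'⟩ := H _ _ _ _ (by omega) h
      by_cases h3 : G.Adj a b
      · rw [comp_near h3] at hlen
        rw [comp_near h3.symm, mul_assoc] at hz'
        simp only [len_mul, len_gen] at hlen
        have l1 := congrArg len hz'
        simp only [len_mul, len_gen] at l1
        obtain ⟨y, rfl, hy⟩ := H _ _ _ _ (by omega) hz'
        rw [comp_far hac (nsymm h1)] at hy
        have l2 := congrArg len hy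
        simp only [len_mul, len_gen] at l2
        obtain ⟨w, rfl, rfl⟩ := H _ _ _ _ (by omega) hy
        rw [comp_far hac.symm h1, comp_near h2, comp_near h2.symm, comp_near h3, comp_near h3.symm,
          comp_far hac (nsymm h1)]
        simp only [mul_assoc]
        refine ⟨gen G c * (gen G b * (gen G a * w)), ?_, ?_⟩
        · rw [far (nsymm h1) (gen G b * w), near h2, near h3.symm, far h1]
        · rw [near h3.symm, far h1 (gen G b * (gen G a * (gen G c * w))), near h2.symm, far h1 w]
      · rw [comp_far hab h3] at hlen
        rw [comp_far hab.symm (nsymm h3)] at hz'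
        simp only [len_mul, len_gen] at hlen
        have l1 := congrArg len hz'
        simp only [len_mul, len_gen] at l1
        obtain ⟨y, rfl, rfl⟩ := H _ _ _ _ (by omega) hz'
        rw [comp_far hac.symm h1, comp_near h2.symm, comp_far hab h3,
          comp_far hab.symm (nsymm h3), comp_far hac (nsymm h1)]
        simp only [mul_assoc]
        refine ⟨gen G c * (gen G b * y), ?_, ?_⟩
        · rw [near h2]
        · rw [far (nsymm h3), far h1]
    · rw [comp_far hac.symm h1, comp_far hbc.symm h2] at h
      rw [comp_far hac.symm h1] at hlen
      simp only [len_mul, len_gen] at hlen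
      obtain ⟨z, rfl, rfl⟩ := H _ _ _ _ (by omega) h
      rw [comp_far hac (nsymm h1), comp_far hbc (nsymm h2)]
      refine ⟨gen G c * z, ?_, ?_⟩
      · by_cases h3 : G.Adj a b
        · rw [comp_near h3, mul_assoc, mul_assoc, far h2, far h1]
        · rw [comp_far hab h3, far h2]
      · by_cases h3 : G.Adj b a
        · rw [comp_near h3, mul_assoc, mul_assoc, far h1, far h2]
        · rw [comp_far hab.symm h3, far h1]

theorem GenLcm.cube (htri : ∀ a b c, G.Adj a b → G.Adj b c → ¬ G.Adj a c) {m : ℕ}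
    (H : GenLcm G m) {a b c : S} {u v : ArtinMonoid G}
    (h : comp G c a * u = comp G c b * v) (hlen : len (comp G c a * u) ≤ m) :
    ∃ t, comp G a c * u = comp G a b * t ∧ comp G b c * v = comp G b a * t := by
  by_cases hac : a = c
  · subst hac
    rw [comp_self, one_mul] at h
    exact ⟨v, by rw [comp_self, one_mul, h], rfl⟩
  by_cases hbc : b = c
  · subst hbc
    rw [comp_self, one_mul] at h
    exact ⟨u, rfl, by rw [comp_self, one_mul, h]⟩
  by_cases hab : a = b
  · subst hab
    refine ⟨comp G a c * u, by rw [comp_self, one_mul], ?_⟩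
    have : u = v := by
      by_cases h1 : G.Adj c a
      · rw [comp_near h1, mul_assoc, mul_assoc] at h
        rw [comp_near h1] at hlen
        simp only [len_mul, len_gen] at hlen
        exact H.cancel (by omega) (H.cancel (by simp; omega) h)
      · rw [comp_far (Ne.symm hac) h1] at h hlen
        simp only [len_mul, len_gen] at hlen
        exact H.cancel (by omega) h
    rw [this, comp_self, one_mul]
  by_cases hAdj : G.Adj c a → G.Adj c b
  · exact H.cube_aux htri hac hbc hab hAdj h hlen
  · obtain ⟨t, h1, h2⟩ := H.cube_aux htri hbc hac (Ne.symm hab) (by tauto) h.symm (h ▸ hlen)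
    exact ⟨t, h2, h1⟩

/-- The property of two words, that the elements they represent are equal through the least common
multiple of their first letters. -/
def HeadRel (G : SimpleGraph S) : List S → List S → Prop
  | [], [] => True
  | a :: x, b :: y => ∃ z, ofWord G x = comp G a b * z ∧ ofWord G y = comp G b a * z
  | _, _ => False

/-- Garside's argument: the words connected to a given one through `HeadRel` form a class closed
under the defining relations, the cube condition providing transitivity. -/
theorem GenLcm.headRel (htri : ∀ a b c, G.Adj a b → G.Adj b c → ¬ G.Adj a c) {m : ℕ}
    (H : GenLcm G m) {u v : FreeMonoid S} (h : ConGen.Rel (ArtinRel G) u v) :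
    u.toList.length = v.toList.length ∧
      (u.toList.length ≤ m + 1 → HeadRel G u.toList v.toList) := by
  have hlen : ∀ {u v : FreeMonoid S}, ConGen.Rel (ArtinRel G) u v →
      ofWord G u.toList = ofWord G v.toList := fun h => by
    rw [← mk_ofList, ← mk_ofList]
    exact PresentedMonoid.mk_eq_mk_iff.2 h
  induction h with
  | of u v h =>
    cases h with
    | @far a b h =>
      refine ⟨rfl, fun _ => ?_⟩
      by_cases hab : a = b
      · subst hab
        exact ⟨gen G a, by simp [comp_self], by simp [comp_self]⟩
      · exact ⟨1, by simp [comp_far hab h],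
          by simp [comp_far (Ne.symm hab) fun h' => h h'.symm]⟩
    | near h => exact ⟨rfl, fun _ => ⟨1, by simp [comp_near h], by simp [comp_near h.symm]⟩⟩
  | refl u =>
    refine ⟨rfl, fun _ => ?_⟩
    cases u.toList with
    | nil => trivial
    | cons a x => exact ⟨ofWord G x, by simp [comp_self], by simp [comp_self]⟩
  | @symm u v _ ih =>
    refine ⟨ih.1.symm, fun h => ?_⟩
    have := ih.2 (by omega)
    revert this
    cases u.toList <;> cases v.toList <;> try exact id
    rintro ⟨z, h1, h2⟩
    exact ⟨z, h2, h1⟩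
  | @trans u w v _ _ ih ih' =>
    refine ⟨ih.1.trans ih'.1, fun h => ?_⟩
    have h1 := ih.2 h
    have h2 := ih'.2 (by omega)
    revert h h1 h2
    cases u.toList <;> cases w.toList <;> cases v.toList <;> simp only [HeadRel, imp_self,
      implies_true, false_imp_iff, imp_false, not_true_eq_false]
    rename_i a x c z b y
    rintro hl ⟨p, h1, h2⟩ ⟨q, h3, h4⟩
    have hz : (ofWord G z).len ≤ m := by
      have := ih.1
      have h5 := congrArg len h1
      have h6 := congrArg len h2
      have h7 := congrArg len (gen_mul_comp (G := G) a c)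
      simp only [len_mul, len_ofWord, len_gen, List.length_cons] at *
      omega
    obtain ⟨t, ht, ht'⟩ := H.cube htri (h2.symm.trans h3) (h2 ▸ hz)
    exact ⟨t, h1.trans ht, h4.trans ht'⟩
  | @mul u v u' v' hu hv ih ih' =>
    refine ⟨by simp [ih.1, ih'.1], fun h => ?_⟩
    have hl : u.toList.length ≤ m + 1 := by
      simp only [FreeMonoid.toList_mul, List.length_append] at h
      omega
    have h1 := ih.2 hl
    have h2 := fun h => ih'.2 h
    have h3 := ih.1
    have h4 := hlen hv
    revert h h1 h2 h3
    simp only [FreeMonoid.toList_mul]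
    cases u.toList <;> cases v.toList
    · intro h h1 h2 h3
      exact h2 (by simpa using h)
    · simp
    · simp
    · rintro - ⟨z, h1, h2⟩ - -
      exact ⟨z * ofWord G u'.toList, by simp [h1, mul_assoc], by simp [h2, h4, mul_assoc]⟩

theorem genLcm (htri : ∀ a b c, G.Adj a b → G.Adj b c → ¬ G.Adj a c) (m : ℕ) : GenLcm G m := by
  induction m with
  | zero => intro a b x y hx; omega
  | succ m ih =>
    intro a b x y hx h
    obtain ⟨u, rfl⟩ := ofWord_surjective x
    obtain ⟨v, rfl⟩ := ofWord_surjective y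
    rw [← ofWord_cons, ← ofWord_cons, ← mk_ofList, ← mk_ofList, PresentedMonoid.mk_eq_mk_iff] at h
    exact (ih.headRel htri h).2 (by simpa using hx)

/-- A common multiple of two generators is a multiple of their least common multiple. -/
theorem exists_comp (htri : ∀ a b c, G.Adj a b → G.Adj b c → ¬ G.Adj a c) {a b : S}
    {x y : ArtinMonoid G} (h : gen G a * x = gen G b * y) :
    ∃ z, x = comp G a b * z ∧ y = comp G b a * z :=
  genLcm htri _ a b x y le_rfl h

theorem mul_left_cancel_of_triangleFree (htri : ∀ a b c, G.Adj a b → G.Adj b c → ¬ G.Adj a c)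
    (x : ArtinMonoid G) {y z : ArtinMonoid G} (h : x * y = x * z) : y = z := by
  obtain ⟨l, rfl⟩ := ofWord_surjective x
  induction l with
  | nil => simpa using h
  | cons a l ih =>
    rw [ofWord_cons, mul_assoc, mul_assoc] at h
    exact ih ((genLcm htri _).cancel le_rfl h)

theorem mul_dvd_mul_left_iff (htri : ∀ a b c, G.Adj a b → G.Adj b c → ¬ G.Adj a c)
    {x y z : ArtinMonoid G} : x * y ∣ x * z ↔ y ∣ z := by
  constructor
  · rintro ⟨w, hw⟩
    exact ⟨w, mul_left_cancel_of_triangleFree htri x (by rw [hw, mul_assoc])⟩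
  · rintro ⟨w, rfl⟩
    exact ⟨w, by rw [mul_assoc]⟩

/-- Two elements with a common right multiple have a least one. -/
theorem exists_lcm (htri : ∀ a b c, G.Adj a b → G.Adj b c → ¬ G.Adj a c) {x y w : ArtinMonoid G}
    (hx : x ∣ w) (hy : y ∣ w) : ∃ d, x ∣ d ∧ y ∣ d ∧ ∀ e, x ∣ e → y ∣ e → d ∣ e := by
  induction hm : len w using Nat.strong_induction_on generalizing x y w with
  | _ m ih =>
  have cancel := @mul_dvd_mul_left_iff _ _ htri
  rcases eq_one_or_gen_mul x with rfl | ⟨a, x, rfl⟩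
  · exact ⟨y, one_dvd y, dvd_rfl, fun e _ h => h⟩
  rcases eq_one_or_gen_mul y with rfl | ⟨b, y, rfl⟩
  · exact ⟨_, dvd_rfl, one_dvd _, fun e h _ => h⟩
  obtain ⟨u, hu⟩ := hx
  obtain ⟨v, hv⟩ := hy
  have huv := hu.symm.trans hv
  rw [mul_assoc, mul_assoc] at huv
  obtain ⟨z, hz, hz'⟩ := exists_comp htri huv
  have l1 := congrArg len hu
  have l2 := congrArg len hv
  have l3 := congrArg len hz
  simp only [len_mul, len_gen] at l1 l2 l3
  obtain ⟨_, hx1, ⟨p, rfl⟩, hmin1⟩ := ih (len (x * u)) (by simp; omega) (x := x)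
    (y := comp G a b) ⟨u, rfl⟩ ⟨z, hz⟩ rfl
  obtain ⟨_, hy1, ⟨r, rfl⟩, hmin2⟩ := ih (len (y * v)) (by simp; omega) (x := y)
    (y := comp G b a) ⟨v, rfl⟩ ⟨z, hz'⟩ rfl
  have hp : p ∣ z := cancel.1 (hz ▸ hmin1 _ ⟨u, rfl⟩ ⟨z, hz⟩)
  have hr : r ∣ z := cancel.1 (hz' ▸ hmin2 _ ⟨v, rfl⟩ ⟨z, hz'⟩)
  obtain ⟨d, hpd, hrd, hmin3⟩ := ih (len z) (by omega) hp hr rfl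
  refine ⟨gen G a * (comp G a b * d), cancel.2 (hx1.trans (cancel.2 hpd)), ?_, ?_⟩
  · rw [← mul_assoc, gen_mul_comp, mul_assoc]
    exact cancel.2 (hy1.trans (cancel.2 hrd))
  · rintro e ⟨α, hα⟩ ⟨β, hβ⟩
    have hαβ := hα.symm.trans hβ
    rw [mul_assoc, mul_assoc] at hαβ
    obtain ⟨z', h1, h2⟩ := exists_comp htri hαβ
    have hp' : p ∣ z' := cancel.1 (h1 ▸ hmin1 _ ⟨α, rfl⟩ ⟨z', h1⟩)
    have hr' : r ∣ z' := cancel.1 (h2 ▸ hmin2 _ ⟨β, rfl⟩ ⟨z', h2⟩)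
    rw [hα, mul_assoc, h1]
    exact cancel.2 (cancel.2 (hmin3 _ hp' hr'))

/-- Convexity: if conjugation by `c` keeps `P` positive, then so does conjugation by a nontrivial
left divisor of `c` that divides `z`, namely the greatest common divisor of `c` and `z`. -/
theorem exists_conj_step (htri : ∀ a b c, G.Adj a b → G.Adj b c → ¬ G.Adj a c)
    {P c z : ArtinMonoid G} (hc : c ∣ P * c) (hz : z ∣ P * z) (hgen : ∀ a, gen G a ∣ z)
    (hc1 : c ≠ 1) : ∃ s, s ≠ 1 ∧ s ∣ c ∧ s ∣ z ∧ s ∣ P * s := by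
  have cancel := @mul_dvd_mul_left_iff _ _ htri
  have len_le : ∀ {x y : ArtinMonoid G}, x ∣ y → len x ≤ len y := by
    rintro x _ ⟨y, rfl⟩
    simp
  obtain ⟨s, ⟨hsc, hsz⟩, hmax⟩ := WellFounded.has_min
    (measure fun s : ArtinMonoid G => len z - len s).wf {s | s ∣ c ∧ s ∣ z}
    ⟨1, one_dvd _, one_dvd _⟩
  have hmax : ∀ t, t ∣ c → t ∣ z → len t ≤ len s := fun t htc htz => by
    have := hmax t ⟨htc, htz⟩
    have h1 := len_le htz
    simp only [InvImage, WellFoundedRelation.rel] at this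
    omega
  refine ⟨s, ?_, hsc, hsz, ?_⟩
  · rintro rfl
    rcases eq_one_or_gen_mul c with rfl | ⟨a, c, rfl⟩
    · exact hc1 rfl
    · simpa using hmax (gen G a) ⟨c, rfl⟩ (hgen a)
  · obtain ⟨_, hsd, ⟨u, rfl⟩, hmin⟩ := exists_lcm htri (hsc.trans hc) (Dvd.intro c rfl : P ∣ P * c)
    have huc : u ∣ c := cancel.1 (hmin _ (hsc.trans hc) ⟨c, rfl⟩)
    have huz : u ∣ z := cancel.1 (hmin _ (hsz.trans hz) ⟨z, rfl⟩)
    obtain ⟨d, hud, ⟨e, rfl⟩, hmin'⟩ := exists_lcm htri huc hsc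
    have h := hmax _ (hmin' _ huc hsc) (hmin' _ huz hsz)
    rw [len_mul] at h
    rw [eq_one_of_len (show len e = 0 by omega), mul_one] at hud
    exact hsd.trans (cancel.2 hud)

end ArtinMonoid

/-! ### The braid monoid: a central element, and the passage to the braid group -/

/-- The monoid of positive braids, by Artin's presentation. -/
abbrev BraidMonoid (n : ℕ) : Type := ArtinMonoid (SimpleGraph.pathGraph (n - 1))

namespace BraidMonoid

open ArtinMonoid

variable {n : ℕ}

theorem pathGraph_triangleFree (m : ℕ) (a b c : Fin m) (hab : (SimpleGraph.pathGraph m).Adj a b)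
    (hbc : (SimpleGraph.pathGraph m).Adj b c) : ¬ (SimpleGraph.pathGraph m).Adj a c := by
  rw [SimpleGraph.pathGraph_adj] at *
  omega

theorem mul_left_cancel' {x y z : BraidMonoid n} (h : x * y = x * z) : y = z :=
  mul_left_cancel_of_triangleFree (pathGraph_triangleFree _) x h

/-- The generator with a natural number as index; it is `1` for indices out of range. -/
def s (n i : ℕ) : BraidMonoid n := if h : i < n - 1 then gen _ ⟨i, h⟩ else 1

theorem s_of_lt {i : ℕ} (h : i < n - 1) : s n i = gen _ ⟨i, h⟩ := dif_pos h

theorem s_comm {i j : ℕ} (h : i + 1 < j) : s n i * s n j = s n j * s n i := by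
  by_cases hj : j < n - 1
  · rw [s_of_lt hj, s_of_lt (by omega)]
    exact gen_comm (by rw [SimpleGraph.pathGraph_adj]; simp; omega)
  · simp [show s n j = 1 from dif_neg hj]

theorem s_braid {i : ℕ} (h : i + 1 < n - 1) :
    s n i * s n (i + 1) * s n i = s n (i + 1) * s n i * s n (i + 1) := by
  rw [s_of_lt h, s_of_lt (by omega)]
  exact gen_braid (by rw [SimpleGraph.pathGraph_adj]; simp)

/-- The product of the first `k` generators, in increasing order. -/
def ascent (n : ℕ) : ℕ → BraidMonoid n
  | 0 => 1
  | k + 1 => ascent n k * s n k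

theorem ascent_succ (k : ℕ) : ascent n (k + 1) = ascent n k * s n k := rfl

theorem ascent_comm {k j : ℕ} (h : k < j) : ascent n k * s n j = s n j * ascent n k := by
  induction k with
  | zero => simp [ascent]
  | succ k ih =>
    rw [ascent, mul_assoc, s_comm (by omega), ← mul_assoc, ih (by omega), mul_assoc]

theorem ascent_mul_s {k i : ℕ} (hi : i + 1 < k) (hk : k ≤ n - 1) :
    ascent n k * s n i = s n (i + 1) * ascent n k := by
  induction k, hi using Nat.le_induction with
  | base =>
    simp only [ascent]
    rw [mul_assoc, mul_assoc, ← mul_assoc (s n i), s_braid (by omega), ← mul_assoc, ← mul_assoc,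
      ascent_comm (by omega)]
    simp only [mul_assoc]
  | succ k hi ih =>
    rw [ascent, mul_assoc, ← s_comm (by omega), ← mul_assoc, ih (by omega), mul_assoc]

theorem ascent_pow_mul_s {i k : ℕ} (h : i + k < n - 1) :
    ascent n (n - 1) ^ k * s n i = s n (i + k) * ascent n (n - 1) ^ k := by
  induction k with
  | zero => simp
  | succ k ih =>
    rw [pow_succ', mul_assoc, ih (by omega), ← mul_assoc, ascent_mul_s (by omega) le_rfl,
      mul_assoc, add_assoc]

theorem ascent_sq_mul_s (hn : 2 ≤ n) :
    ascent n (n - 1) ^ 2 * s n (n - 2) = s n 0 * ascent n (n - 1) ^ 2 := by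
  -- shifting the letters of a partial product by one
  have key : ∀ k, k + 1 ≤ n - 1 → ∃ F, ascent n (n - 1) * ascent n k = F * ascent n (n - 1) ∧
      s n 0 * F = ascent n (k + 1) := by
    intro k
    induction k with
    | zero => exact fun _ => ⟨1, by simp [ascent], by simp [ascent]⟩
    | succ k ih =>
      intro hk
      obtain ⟨F, h1, h2⟩ := ih (by omega)
      refine ⟨F * s n (k + 1), ?_, ?_⟩
      · rw [ascent, ← mul_assoc, h1, mul_assoc, ascent_mul_s (by omega) le_rfl, mul_assoc]
      · rw [← mul_assoc, h2, ← ascent_succ]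
  obtain ⟨F, h1, h2⟩ := key (n - 2) (by omega)
  have e : n - 2 + 1 = n - 1 := by omega
  rw [e] at h2
  have h3 : ascent n (n - 1) = ascent n (n - 2) * s n (n - 2) := by
    rw [← ascent_succ, e]
  have h4 : ascent n (n - 1) ^ 2 = F * ascent n (n - 1) * s n (n - 2) := by
    rw [sq]; nth_rw 2 [h3]; rw [← mul_assoc, h1]
  nth_rw 2 [h4]
  rw [← mul_assoc, ← mul_assoc, h2, sq]

theorem sigma_artinRel {x y : FreeMonoid (Fin (n - 1))}
    (h : ArtinRel (SimpleGraph.pathGraph (n - 1)) x y) :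
    FreeMonoid.lift (fun a : Fin (n - 1) => BraidGroup.sigma n a) x
      = FreeMonoid.lift (fun a : Fin (n - 1) => BraidGroup.sigma n a) y := by
  rcases h with @⟨a, b, h⟩ | @⟨a, b, h⟩
  · rw [SimpleGraph.pathGraph_adj] at h
    simp only [map_mul, FreeMonoid.lift_eval_of]
    rcases lt_trichotomy a b with hab | rfl | hab
    · exact BraidGroup.sigma_comm (by omega)
    · rfl
    · exact (BraidGroup.sigma_comm (by omega)).symm
  · rw [SimpleGraph.pathGraph_adj] at h
    simp only [map_mul, FreeMonoid.lift_eval_of]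
    rcases h with h | h
    · rw [← h]; exact BraidGroup.sigma_braid (by omega)
    · rw [← h]; exact (BraidGroup.sigma_braid (by omega)).symm

theorem commute_of_gen {z : BraidMonoid n} (h : ∀ a, z * gen _ a = gen _ a * z)
    (x : BraidMonoid n) : z * x = x * z := by
  obtain ⟨l, rfl⟩ := ofWord_surjective x
  induction l with
  | nil => simp
  | cons a l ih => rw [ofWord_cons, ← mul_assoc, h, mul_assoc, ih, mul_assoc]

theorem len_ascent {k : ℕ} (hk : k ≤ n - 1) : len (ascent n k) = k := by
  induction k with
  | zero => simp [ascent]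
  | succ k ih => simp [ascent, ih (by omega), s_of_lt (show k < n - 1 by omega)]

/-- The full twist `(σ_0 σ_1 ⋯ σ_{n-2})^n`. -/
def twist (n : ℕ) : BraidMonoid n := ascent n (n - 1) ^ n

theorem len_twist : len (twist n) = n * (n - 1) := by
  have : ∀ k, len (ascent n (n - 1) ^ k) = k * (n - 1) := by
    intro k
    induction k with
    | zero => simp
    | succ k ih => rw [pow_succ, len_mul, ih, len_ascent le_rfl]; ring
  exact this n

theorem twist_comm (x : BraidMonoid n) : twist n * x = x * twist n := by
  refine commute_of_gen (fun ⟨i, hi⟩ => ?_) x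
  rw [← s_of_lt hi]
  have e : twist n =
      ascent n (n - 1) ^ i * ascent n (n - 1) ^ 2 * ascent n (n - 1) ^ (n - 2 - i) := by
    rw [twist, ← pow_add, ← pow_add]; congr 1; omega
  have h1 := ascent_pow_mul_s (n := n) (i := i) (k := n - 2 - i) (by omega)
  have h2 := ascent_pow_mul_s (n := n) (i := 0) (k := i) (by omega)
  rw [show i + (n - 2 - i) = n - 2 by omega] at h1
  rw [zero_add] at h2
  rw [e, mul_assoc, h1, mul_assoc, ← mul_assoc _ (s n (n - 2)), ascent_sq_mul_s (by omega),
    ← mul_assoc, ← mul_assoc, h2]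
  simp only [mul_assoc]

theorem gen_dvd_twist (a : Fin (n - 1)) : gen _ a ∣ twist n := by
  obtain ⟨i, hi⟩ := a
  rw [← s_of_lt hi]
  have h : ∀ k, s n 0 ∣ ascent n (k + 1) := by
    intro k
    induction k with
    | zero => simp [ascent]
    | succ k ih => rw [ascent]; exact ih.mul_right _
  obtain ⟨F, hF⟩ := h (n - 2)
  rw [show n - 2 + 1 = n - 1 by omega] at hF
  have h2 := ascent_pow_mul_s (n := n) (i := 0) (k := i) (by omega)
  rw [zero_add] at h2
  have e : twist n = ascent n (n - 1) ^ i * ascent n (n - 1) * ascent n (n - 1) ^ (n - 1 - i) := by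
    rw [twist, ← pow_succ, ← pow_add]; congr 1; omega
  refine ⟨ascent n (n - 1) ^ i * F * ascent n (n - 1) ^ (n - 1 - i), ?_⟩
  rw [e]
  nth_rw 2 [hF]
  rw [← mul_assoc (_ ^ i), h2]
  simp only [mul_assoc]

/-- The homomorphism from positive braids to braids. -/
def toGroup (n : ℕ) : BraidMonoid n →* BraidGroup n :=
  PresentedMonoid.lift (fun a : Fin (n - 1) => BraidGroup.sigma n a) fun _ _ h => sigma_artinRel h

@[simp] theorem toGroup_gen (a : Fin (n - 1)) :
    toGroup n (gen _ a) = BraidGroup.sigma n a := rfl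

/-- Fractions `z^{-k} x`, with `x` a positive braid and `z` the full twist, encoded as pairs
`(x, k)`: the congruence that identifies equal fractions. -/
def fracCon (n : ℕ) : Con (BraidMonoid n × Multiplicative ℕ) where
  r p q := twist n ^ (Multiplicative.toAdd q.2) * p.1 = twist n ^ (Multiplicative.toAdd p.2) * q.1
  iseqv :=
    { refl := fun _ => rfl
      symm := fun h => h.symm
      trans := by
        rintro ⟨x, k⟩ ⟨y, l⟩ ⟨w, m⟩ h1 h2
        dsimp only at *
        refine mul_left_cancel' (x := twist n ^ (Multiplicative.toAdd l)) ?_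
        rw [← mul_assoc, ← mul_assoc, pow_mul_comm, mul_assoc, h1, ← mul_assoc,
          pow_mul_comm, mul_assoc, h2, ← mul_assoc, pow_mul_comm, mul_assoc] }
  mul' := by
    rintro ⟨x, k⟩ ⟨y, l⟩ ⟨x', k'⟩ ⟨y', l'⟩ h1 h2
    have hc : ∀ (m : ℕ) (x : BraidMonoid n), x * twist n ^ m = twist n ^ m * x := fun m x =>
      ((show Commute (twist n) x from twist_comm x).pow_left m).eq.symm
    dsimp only [Prod.mk_mul_mk, toAdd_mul] at *
    rw [pow_add, pow_add, mul_assoc, ← mul_assoc _ x, ← hc _ x, mul_assoc x, h2, ← mul_assoc, h1,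
      mul_assoc, mul_assoc, ← mul_assoc y, hc _ y, mul_assoc]

/-- A positive braid as an invertible fraction. -/
theorem exists_unit_frac (a : Fin (n - 1)) :
    ∃ u : (fracCon n).Quotientˣ, (u : (fracCon n).Quotient) = (fracCon n).mk' (gen _ a, 1) := by
  obtain ⟨b, hb⟩ := gen_dvd_twist a
  have hb' : b * gen _ a = twist n := by
    refine mul_left_cancel' (x := gen _ a) ?_
    rw [← mul_assoc, ← hb, twist_comm]
  refine ⟨⟨(fracCon n).mk' (gen _ a, 1), (fracCon n).mk' (b, Multiplicative.ofAdd 1), ?_, ?_⟩,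
    rfl⟩
  · rw [← map_mul, ← map_one (fracCon n).mk']
    refine (Con.eq _).2 ?_
    simp [fracCon, ← hb]
  · rw [← map_mul, ← map_one (fracCon n).mk']
    refine (Con.eq _).2 ?_
    simp [fracCon, hb']

/-- The braid monoid embeds in the braid group. -/
theorem toGroup_injective : Function.Injective (toGroup n) := by
  choose u hu using exists_unit_frac (n := n)
  -- the braid group maps to the invertible fractions
  let ι : BraidMonoid n →* (fracCon n).Quotient :=
    (fracCon n).mk'.comp (MonoidHom.inl _ (Multiplicative ℕ))
  have hι : ∀ a, ι (gen _ a) = u a := fun a => (hu a).symm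
  let φ : BraidGroup n →* (fracCon n).Quotientˣ := PresentedGroup.toGroup (f := u) (by
    rintro w (⟨i, j, hij, rfl⟩ | ⟨i, j, hij, rfl⟩)
    · rw [map_mul, map_inv, mul_inv_eq_one]
      ext
      simp only [map_mul, FreeGroup.lift_apply_of, Units.val_mul, ← hι]
      rw [← map_mul, ← map_mul, gen_comm (by rw [SimpleGraph.pathGraph_adj]; omega)]
    · rw [map_mul, map_inv, mul_inv_eq_one]
      ext
      simp only [map_mul, FreeGroup.lift_apply_of, Units.val_mul, ← hι]
      simp only [← map_mul]
      rw [gen_braid (by rw [SimpleGraph.pathGraph_adj]; omega)])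
  have hφ : ∀ x, ((φ (toGroup n x) : (fracCon n).Quotientˣ) : (fracCon n).Quotient) = ι x := by
    intro x
    obtain ⟨l, rfl⟩ := ofWord_surjective x
    induction l with
    | nil => simp
    | cons a l ih =>
      rw [ofWord_cons, map_mul, map_mul, map_mul, Units.val_mul, ih, hι, toGroup_gen,
        BraidGroup.sigma_of_lt a.2, PresentedGroup.toGroup.of]
  intro x y hxy
  have h : ι x = ι y := by rw [← hφ, ← hφ, hxy]
  simpa [fracCon] using (Con.eq _).1 h

theorem toGroup_twist_comm (g : BraidGroup n) :
    toGroup n (twist n) * g = g * toGroup n (twist n) := by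
  have h := PresentedGroup.generated_by (braidRels n)
    (Subgroup.centralizer {toGroup n (twist n)}) (fun a => by
      rw [Subgroup.mem_centralizer_singleton_iff, ← BraidGroup.sigma_of_lt a.2, ← toGroup_gen,
        ← map_mul, ← map_mul, twist_comm]) g
  rw [Subgroup.mem_centralizer_singleton_iff] at h
  exact h.symm

/-- Every braid becomes positive when multiplied by a power of the full twist. -/
theorem exists_twist_pow_mul (g : BraidGroup n) :
    ∃ (k : ℕ) (x : BraidMonoid n), toGroup n (twist n) ^ k * g = toGroup n x := by
  induction g using PresentedGroup.induction_on with
  | _ w =>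
  induction w using FreeGroup.induction_on with
  | C1 => exact ⟨0, 1, by simp⟩
  | of a => exact ⟨0, gen _ a, by rw [toGroup_gen, BraidGroup.sigma_of_lt a.2]; simp; rfl⟩
  | inv_of a _ =>
    obtain ⟨b, hb⟩ := gen_dvd_twist a
    refine ⟨1, b, ?_⟩
    have : PresentedGroup.mk (braidRels n) (FreeGroup.of a) = toGroup n (gen _ a) := by
      rw [toGroup_gen, BraidGroup.sigma_of_lt a.2]; rfl
    rw [pow_one, map_inv, this, toGroup_twist_comm, hb, map_mul, inv_mul_cancel_left]
  | mul v w hv hw =>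
    obtain ⟨k, x, hx⟩ := hv
    obtain ⟨l, y, hy⟩ := hw
    refine ⟨k + l, x * y, ?_⟩
    have hc := ((show Commute _ _ from toGroup_twist_comm (PresentedGroup.mk (braidRels n) v)
      ).pow_left l).eq
    rw [map_mul, map_mul, ← hx, ← hy, pow_add, mul_assoc, ← mul_assoc (_ ^ l), hc]
    simp only [mul_assoc]

/-- Conjugate positive braids are connected through positive braids by conjugations with left
divisors of the full twist. -/
theorem conj_chain {P Q : BraidMonoid n} (h : IsConj (toGroup n P) (toGroup n Q)) :
    Relation.ReflTransGen (fun P Q : BraidMonoid n => ∃ s, s ∣ twist n ∧ P * s = s * Q) P Q := by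
  obtain ⟨c, hc⟩ : ∃ c, P * c = c * Q := by
    obtain ⟨g, hg⟩ := isConj_iff.1 h
    obtain ⟨k, c, hc⟩ := exists_twist_pow_mul g⁻¹
    refine ⟨c, toGroup_injective ?_⟩
    have h1 := ((show Commute _ _ from toGroup_twist_comm (toGroup n P)).pow_left k).eq
    rw [map_mul, map_mul, ← hc, ← hg, ← mul_assoc, ← h1]
    group
  clear h
  induction hm : len c using Nat.strong_induction_on generalizing c P with
  | _ m ih =>
  by_cases hc1 : c = 1
  · subst hc1
    rw [show P = Q by simpa using hc]
  obtain ⟨s, hs1, ⟨d, rfl⟩, hsz, R, hR⟩ := exists_conj_step (pathGraph_triangleFree _)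
    (P := P) (c := c) (z := twist n) ⟨Q, hc⟩ ⟨P, (twist_comm P).symm⟩ gen_dvd_twist hc1
  refine Relation.ReflTransGen.head ⟨s, hsz, hR⟩ (ih (len d) ?_ d ?_ rfl)
  · have : len s ≠ 0 := fun h => hs1 (eq_one_of_len h)
    rw [← hm, len_mul]; omega
  · refine mul_left_cancel' (x := s) ?_
    rw [← mul_assoc, ← hR, mul_assoc, hc, mul_assoc]

end BraidMonoid

/-! ### Band words, rewritten within a bounded length -/

namespace BraidGroup

open Relation ArtinMonoid BraidMonoid

variable {n : ℕ}

/-- The letter `a_{ij}` or its inverse, with natural numbers as indices. -/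
def letter {i j : ℕ} (hij : i < j) (hj : j < n) (s : Bool) : BandLetter n :=
  ⟨⟨i, hij.trans hj⟩, ⟨j, hj⟩, hij, s⟩

/-- The inverse letter. -/
def BandLetter.inv (x : BandLetter n) : BandLetter n := ⟨x.i, x.j, x.lt, !x.sign⟩

@[simp] theorem BandLetter.inv_inv (x : BandLetter n) : x.inv.inv = x := by simp [BandLetter.inv]

theorem BandLetter.toBraid_inv (x : BandLetter n) : x.inv.toBraid = x.toBraid⁻¹ := by
  obtain ⟨i, j, h, s⟩ := x
  cases s <;> simp [BandLetter.inv, BandLetter.toBraid]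

theorem toBraid_letter_true {i j : ℕ} (hij : i < j) (hj : j < n) :
    (letter hij hj true).toBraid = band n i j := rfl

/-- The rewriting rules: free cancellation and some relations between two band generators each,
which suffice to present the braid group. -/
inductive Rule : BandWord n → BandWord n → Prop
  | cancel (x : BandLetter n) : Rule [x, x.inv] []
  | slide {i j : ℕ} (hij : i < j) (hj : j + 1 < n) :
      Rule [letter j.lt_succ_self hj true, letter hij (by omega) true]
        [letter (Nat.lt_succ_of_lt hij) hj true, letter j.lt_succ_self hj true]
  | turn {i j : ℕ} (hij : i < j) (hj : j + 1 < n) :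
      Rule [letter hij (by omega) true, letter (Nat.lt_succ_of_lt hij) hj true]
        [letter j.lt_succ_self hj true, letter hij (by omega) true]
  | comm {i j : ℕ} (hij : i < j) (hj : j + 2 < n) :
      Rule [letter i.lt_succ_self (by omega) true, letter (j + 1).lt_succ_self hj true]
        [letter (j + 1).lt_succ_self hj true, letter i.lt_succ_self (by omega) true]

theorem Rule.toBraid {u v : BandWord n} (h : Rule u v) :
    BandWord.toBraid u = BandWord.toBraid v := by
  cases h with
  | cancel x => simp [BandWord.toBraid, BandLetter.toBraid_inv]
  | @slide i j hij hj =>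
    simp [BandWord.toBraid, toBraid_letter_true, band_succ hij, band_succ_self]
  | @turn i j hij hj =>
    simp [BandWord.toBraid, toBraid_letter_true, band_succ_self,
      band_mul_band_succ hij (show j < n - 1 by omega)]
  | @comm i j hij hj =>
    simp [BandWord.toBraid, toBraid_letter_true, band_succ_self,
      sigma_comm (n := n) (show i + 1 < j + 1 by omega)]

/-- Application of a rule inside a word. -/
def RuleStep (u v : BandWord n) : Prop :=
  ∃ p s l r, Rule l r ∧ u = p ++ l ++ s ∧ v = p ++ r ++ s

/-- Equivalence of words through words of length at most `B`. -/
def WordEq (B : ℕ) : BandWord n → BandWord n → Prop :=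
  EqvGen fun u v => RuleStep u v ∧ u.length ≤ B ∧ v.length ≤ B

/-- Equivalence of words up to cyclic rotation, through words of length at most `B`. -/
def CyclicEq (B : ℕ) : BandWord n → BandWord n → Prop :=
  EqvGen fun u v => (RuleStep u v ∨ ∃ p s, u = p ++ s ∧ v = s ++ p) ∧ u.length ≤ B ∧ v.length ≤ B

theorem WordEq.refl (B : ℕ) (u : BandWord n) : WordEq B u u := EqvGen.refl u

theorem WordEq.symm {B : ℕ} {u v : BandWord n} (h : WordEq B u v) : WordEq B v u :=
  EqvGen.symm _ _ h

theorem WordEq.trans {B : ℕ} {u v w : BandWord n} (h : WordEq B u v) (h' : WordEq B v w) :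
    WordEq B u w := EqvGen.trans _ _ _ h h'

theorem WordEq.mono {B B' : ℕ} (hB : B ≤ B') {u v : BandWord n} (h : WordEq B u v) :
    WordEq B' u v :=
  EqvGen.mono (fun _ _ ⟨h, h1, h2⟩ => ⟨h, h1.trans hB, h2.trans hB⟩) _ _ h

theorem WordEq.cyclicEq {B : ℕ} {u v : BandWord n} (h : WordEq B u v) : CyclicEq B u v :=
  EqvGen.mono (fun _ _ ⟨h, h1, h2⟩ => ⟨Or.inl h, h1, h2⟩) _ _ h

theorem WordEq.toBraid {B : ℕ} {u v : BandWord n} (h : WordEq B u v) :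
    BandWord.toBraid u = BandWord.toBraid v := by
  induction h with
  | rel u v h =>
    obtain ⟨⟨p, s, l, r, h, rfl, rfl⟩, -⟩ := h
    simp only [BandWord.toBraid_append, h.toBraid]
  | refl => rfl
  | symm _ _ _ ih => exact ih.symm
  | trans _ _ _ _ _ ih ih' => exact ih.trans ih'

/-- Rewriting in context. -/
theorem WordEq.context {B B' : ℕ} {u v : BandWord n} (h : WordEq B u v) (p s : BandWord n)
    (hB : p.length + B + s.length ≤ B') : WordEq B' (p ++ u ++ s) (p ++ v ++ s) := by
  induction h with
  | rel u v h =>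
    obtain ⟨⟨p', s', l, r, h, rfl, rfl⟩, h1, h2⟩ := h
    refine EqvGen.rel _ _ ⟨⟨p ++ p', s' ++ s, l, r, h, by simp, by simp⟩, ?_, ?_⟩
    · simp only [List.length_append] at *; omega
    · simp only [List.length_append] at *; omega
  | refl => exact WordEq.refl _ _
  | symm _ _ _ ih => exact ih.symm
  | trans _ _ _ _ _ ih ih' => exact ih.trans ih'

theorem Rule.wordEq {B : ℕ} {u v : BandWord n} (h : Rule u v) (hB : 2 ≤ B) : WordEq B u v := by
  refine EqvGen.rel _ _ ⟨⟨[], [], u, v, h, by simp, by simp⟩, ?_, ?_⟩ <;> cases h <;> simp <;> omega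

/-- The formal inverse of a word. -/
def invWord (u : BandWord n) : BandWord n := (u.map BandLetter.inv).reverse

@[simp] theorem length_invWord (u : BandWord n) : (invWord u).length = u.length := by
  simp [invWord]

@[simp] theorem invWord_invWord (u : BandWord n) : invWord (invWord u) = u := by
  simp [invWord, Function.comp_def]

theorem wordEq_mul_inv (u : BandWord n) {B : ℕ} (hB : 2 * u.length ≤ B) :
    WordEq B (u ++ invWord u) [] := by
  induction u generalizing B with
  | nil => exact WordEq.refl _ _
  | cons x u ih =>
    rw [List.length_cons] at hB
    have h1 : WordEq B ([x] ++ (u ++ invWord u) ++ [x.inv]) ([x] ++ [] ++ [x.inv]) :=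
      (ih le_rfl).context [x] [x.inv] (by simp; omega)
    have h2 : WordEq B [x, x.inv] [] := (Rule.cancel x).wordEq (by omega)
    simpa [invWord] using h1.trans h2

theorem wordEq_inv_mul (u : BandWord n) {B : ℕ} (hB : 2 * u.length ≤ B) :
    WordEq B (invWord u ++ u) [] := by
  simpa using wordEq_mul_inv (invWord u) (by simpa using hB)

theorem WordEq.invWord {B B' : ℕ} {u v : BandWord n} (h : WordEq B u v)
    (hB : B + u.length + v.length ≤ B') (hu : u.length ≤ B) (hv : v.length ≤ B) :
    WordEq B' (invWord u) (invWord v) := by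
  have h1 := (wordEq_mul_inv v le_rfl).symm.context (BraidGroup.invWord u) [] (B' := B')
    (by simp; omega)
  have h2 := h.symm.context (BraidGroup.invWord u) (BraidGroup.invWord v) (B' := B')
    (by simp; omega)
  have h3 := (wordEq_inv_mul u le_rfl).context [] (BraidGroup.invWord v) (B' := B')
    (by simp; omega)
  simp only [List.append_nil, List.nil_append, ← List.append_assoc] at h1 h2 h3
  exact h1.trans (h2.trans h3)

/-- The band word of a positive word in the Artin generators. -/
def posWord (w : List (Fin (n - 1))) : BandWord n :=
  w.map fun i => letter (i.val.lt_succ_self) (by omega) true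

@[simp] theorem length_posWord (w : List (Fin (n - 1))) : (posWord w).length = w.length := by
  simp [posWord]

@[simp] theorem posWord_append (v w : List (Fin (n - 1))) :
    posWord (v ++ w) = posWord v ++ posWord w := by simp [posWord]

theorem toBraid_posWord (w : List (Fin (n - 1))) :
    BandWord.toBraid (posWord w) = toGroup n (ofWord _ w) := by
  induction w with
  | nil => simp [posWord, BandWord.toBraid]
  | cons i w ih =>
    rw [ofWord_cons, map_mul, ← ih, toGroup_gen, ← band_succ_self]
    simp [posWord, BandWord.toBraid, toBraid_letter_true]

/-- Equal elements of the braid monoid are equivalent through words of constant length. -/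
theorem wordEq_posWord {v w : List (Fin (n - 1))} (h : ofWord (SimpleGraph.pathGraph (n - 1)) v
    = ofWord _ w) : v.length = w.length ∧ WordEq v.length (posWord v) (posWord w) := by
  have braid : ∀ {a b : Fin (n - 1)}, a.val + 1 = b.val →
      WordEq 3 (posWord [a, b, a]) (posWord [b, a, b]) := by
    rintro ⟨a, ha⟩ ⟨b, hb⟩ h
    obtain rfl : a + 1 = b := h
    have h1 := ((Rule.slide (n := n) a.lt_succ_self (by omega)).wordEq le_rfl).context
      (B' := 3) [letter a.lt_succ_self (by omega) true] [] (by simp)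
    have h2 := ((Rule.turn (n := n) a.lt_succ_self (by omega)).wordEq le_rfl).context
      (B' := 3) [] [letter (a + 1).lt_succ_self (by omega) true] (by simp)
    exact h1.trans h2
  have comm : ∀ {a b : Fin (n - 1)}, a.val + 1 < b.val →
      WordEq 2 (posWord [a, b]) (posWord [b, a]) := by
    rintro ⟨a, ha⟩ ⟨b, hb⟩ hab
    obtain ⟨k, rfl⟩ := Nat.exists_eq_succ_of_ne_zero (show b ≠ 0 by simp at hab; omega)
    exact (Rule.comm (n := n) (show a < k by simp at hab; omega) (by omega)).wordEq le_rfl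
  rw [← mk_ofList, ← mk_ofList, PresentedMonoid.mk_eq_mk_iff] at h
  change ConGen.Rel _ _ _ at h
  suffices H : ∀ {v w : FreeMonoid (Fin (n - 1))},
      ConGen.Rel (ArtinRel (SimpleGraph.pathGraph (n - 1))) v w →
      v.toList.length = w.toList.length ∧
        WordEq v.toList.length (posWord v.toList) (posWord w.toList) from H h
  clear h v w
  intro v w h
  induction h with
  | of v w h =>
    rcases h with @⟨a, b, h⟩ | @⟨a, b, h⟩
    · refine ⟨rfl, ?_⟩
      rw [SimpleGraph.pathGraph_adj] at h
      rcases lt_trichotomy a b with hab | rfl | hab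
      · exact comm (by omega)
      · exact WordEq.refl _ _
      · exact (comm (by omega)).symm
    · refine ⟨rfl, ?_⟩
      rw [SimpleGraph.pathGraph_adj] at h
      rcases h with h | h
      · exact braid h
      · exact (braid h).symm
  | refl => exact ⟨rfl, WordEq.refl _ _⟩
  | symm _ ih => exact ⟨ih.1.symm, ih.1 ▸ ih.2.symm⟩
  | trans _ _ ih ih' => exact ⟨ih.1.trans ih'.1, ih.2.trans (ih.1 ▸ ih'.2)⟩
  | @mul v w v' w' _ _ ih ih' =>
    refine ⟨by simp [ih.1, ih'.1], ?_⟩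
    simp only [FreeMonoid.toList_mul, posWord_append, List.length_append]
    have h1 := ih.2.context [] (posWord v'.toList) (B' := v.toList.length + v'.toList.length)
      (by simp)
    have h2 := ih'.2.context (posWord w.toList) [] (B' := v.toList.length + v'.toList.length)
      (by simp; omega)
    simp only [List.nil_append, List.append_nil] at h1 h2
    exact h1.trans h2

/-- A positive word for the full twist. -/
noncomputable def twistWord (n : ℕ) : List (Fin (n - 1)) := (ofWord_surjective (twist n)).choose

theorem ofWord_twistWord : ofWord _ (twistWord n) = twist n :=
  (ofWord_surjective (twist n)).choose_spec

@[simp] theorem length_twistWord : (twistWord n).length = n * (n - 1) := by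
  rw [← len_twist, ← ofWord_twistWord, len_ofWord]

/-- The word `z^{-k}`, where `z` is the full twist. -/
noncomputable def negTwist (n k : ℕ) : BandWord n :=
  (List.replicate k (invWord (posWord (twistWord n)))).flatten

@[simp] theorem length_negTwist (k : ℕ) : (negTwist n k).length = k * (n * (n - 1)) := by
  simp [negTwist]

theorem negTwist_one : negTwist n 1 = invWord (posWord (twistWord n)) := by simp [negTwist]

theorem negTwist_zero : negTwist n 0 = [] := by simp [negTwist]

theorem negTwist_add (k l : ℕ) : negTwist n (k + l) = negTwist n k ++ negTwist n l := by
  rw [negTwist, List.replicate_add, List.flatten_append]; rfl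

theorem toBraid_negTwist (k : ℕ) :
    BandWord.toBraid (negTwist n k) = (toGroup n (twist n) ^ k)⁻¹ := by
  induction k with
  | zero => simp [negTwist, BandWord.toBraid]
  | succ k ih =>
    have h := (wordEq_mul_inv (posWord (twistWord n)) le_rfl).toBraid
    rw [BandWord.toBraid_append, toBraid_posWord, ofWord_twistWord] at h
    rw [negTwist_add, BandWord.toBraid_append, ih, negTwist_one, eq_inv_of_mul_eq_one_right h,
      pow_succ', mul_inv_rev]

/-- Words can be moved across `z^{-k}`. -/
theorem wordEq_posWord_negTwist (w : List (Fin (n - 1))) (k : ℕ) {B : ℕ}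
    (hB : w.length + (k + 2) * (n * (n - 1)) ≤ B) :
    WordEq B (posWord w ++ negTwist n k) (negTwist n k ++ posWord w) := by
  have h1 : ∀ {B}, w.length + 3 * (n * (n - 1)) ≤ B →
      WordEq B (posWord w ++ negTwist n 1) (negTwist n 1 ++ posWord w) := by
    intro B hB
    rw [negTwist_one]
    have e1 := (wordEq_inv_mul (posWord (twistWord n)) le_rfl).symm.context (B' := B) []
      (posWord w ++ invWord (posWord (twistWord n))) (by simp; omega)
    have h := wordEq_posWord (v := twistWord n ++ w) (w := w ++ twistWord n)
      (by rw [ofWord_append, ofWord_append, ofWord_twistWord, twist_comm])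
    have e2 := h.2.context (B' := B) (invWord (posWord (twistWord n)))
      (invWord (posWord (twistWord n))) (by simp; omega)
    have e3 := (wordEq_mul_inv (posWord (twistWord n)) le_rfl).context (B' := B)
      (invWord (posWord (twistWord n)) ++ posWord w) [] (by simp; omega)
    simp only [List.append_nil, List.nil_append, posWord_append, List.append_assoc] at e1 e2 e3
    exact e1.trans (e2.trans e3)
  induction k generalizing B with
  | zero => simpa [negTwist_zero] using WordEq.refl _ _
  | succ k ih =>
    rw [negTwist_add]
    have e1 := (ih le_rfl).context (B' := B) [] (negTwist n 1) (by simp; nlinarith)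
    have e2 := (h1 le_rfl).context (B' := B) (negTwist n k) [] (by simp; nlinarith)
    simp only [List.append_nil, List.nil_append, List.append_assoc] at e1 e2 ⊢
    exact e1.trans e2

theorem pos_of_three_le (hn : 3 ≤ n) : 1 ≤ n * (n - 1) :=
  Nat.mul_pos (by omega) (by omega)

theorem exists_sigma_inv (hn : 3 ≤ n) (i : Fin (n - 1)) :
    ∃ w : List (Fin (n - 1)), w.length + 1 ≤ n * (n - 1) ∧
      WordEq (4 * (n * (n - 1))) [letter i.val.lt_succ_self (by omega) false]
        (negTwist n 1 ++ posWord w) := by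
  obtain ⟨x, hx⟩ := gen_dvd_twist i
  obtain ⟨w, rfl⟩ := ofWord_surjective x
  have hlen : n * (n - 1) = 1 + w.length := by
    rw [← len_twist, hx]; simp
  have hζ := pos_of_three_le hn
  refine ⟨w, by omega, ?_⟩
  set σ : BandLetter n := letter i.val.lt_succ_self (by omega) true
  change WordEq _ [σ.inv] _
  have e1 := (wordEq_mul_inv (posWord (twistWord n)) le_rfl).symm.context
    (B' := 4 * (n * (n - 1))) [σ.inv] [] (by simp; omega)
  have h := wordEq_posWord (v := twistWord n) (w := i :: w)
    (by rw [ofWord_twistWord, hx, ofWord_cons])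
  have e2 := h.2.context (B' := 4 * (n * (n - 1))) [σ.inv] (invWord (posWord (twistWord n)))
    (by simp; omega)
  have e3 := ((Rule.cancel σ.inv).wordEq le_rfl).context (B' := 4 * (n * (n - 1))) []
    (posWord w ++ invWord (posWord (twistWord n))) (by simp; omega)
  have e4 := wordEq_posWord_negTwist w 1 (B := 4 * (n * (n - 1))) (by omega)
  rw [negTwist_one] at e4 ⊢
  rw [BandLetter.inv_inv] at e3
  simp only [List.append_nil, List.nil_append, List.cons_append] at e1 e2 e3
  exact e1.trans (e2.trans (e3.trans e4))

/-- A band letter as a fraction with a power of the full twist as denominator. -/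
theorem exists_frac_letter (hn : 3 ≤ n) {i j : ℕ} (hij : i < j) (hj : j < n) (s : Bool) :
    ∃ (k : ℕ) (w : List (Fin (n - 1))), k ≤ j - i ∧ w.length ≤ (j - i) * (n * (n - 1)) ∧
      WordEq ((2 * (j - i) + 6) * (n * (n - 1))) [letter hij hj s]
        (negTwist n k ++ posWord w) := by
  have hζ := pos_of_three_le hn
  obtain ⟨d, rfl⟩ := Nat.exists_eq_add_of_lt hij
  induction d with
  | zero =>
    cases s with
    | true => exact ⟨0, [⟨i, by omega⟩], by omega, by simpa using hζ, WordEq.refl _ _⟩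
    | false =>
      obtain ⟨w, hw, h⟩ := exists_sigma_inv hn ⟨i, by omega⟩
      exact ⟨1, w, by omega, by simp; omega, h.mono (Nat.mul_le_mul_right _ (by omega))⟩
  | succ d ih =>
    obtain ⟨k, w, hk, hw, h⟩ := ih (by omega) (by omega)
    obtain ⟨r, hr, hσ⟩ := exists_sigma_inv hn ⟨i + d + 1, by omega⟩
    have e1 : i + d + 1 - i = d + 1 := by omega
    have e2 : i + (d + 1) + 1 - i = d + 2 := by omega
    rw [e1] at hk hw h
    simp only [e2]
    generalize hζeq : n * (n - 1) = ζ at *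
    have hlen : ∀ k, (negTwist n k).length = k * ζ := by simp [← hζeq]
    have hkζ : k * ζ ≤ (d + 1) * ζ := Nat.mul_le_mul_right _ hk
    have hB : (2 * (d + 2) + 6) * ζ = 2 * ((d + 1) * ζ) + 8 * ζ := by ring
    have hB' : (2 * (d + 1) + 6) * ζ = 2 * ((d + 1) * ζ) + 6 * ζ := by ring
    rw [hB]
    rw [hB'] at h
    set σ : BandLetter n := letter (i + d + 1).lt_succ_self (by omega) true with hσdef
    -- `a_{i,j+1} = σ_j a_{ij} σ_j⁻¹`, also for the inverses
    have hconj : ∀ s, WordEq (7 * ζ) [letter hij hj s] [σ, letter (show i < i + d + 1 by omega)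
        (by omega) s, σ.inv] := by
      have ht : WordEq 3 [letter hij hj true] [σ, letter (show i < i + d + 1 by omega)
          (by omega) true, σ.inv] := by
        have e1 := ((Rule.cancel σ).wordEq le_rfl).symm.context (B' := 3) [letter hij hj true] []
          (by simp)
        have e2 := ((Rule.slide (n := n) (show i < i + d + 1 by omega) hj).wordEq
          le_rfl).symm.context (B' := 3) [] [σ.inv] (by simp)
        exact e1.trans e2
      intro s
      cases s with
      | true => exact ht.mono (by omega)
      | false =>
        have := ht.invWord (B' := 7) (by simp) (by simp) (by simp)
        simp only [invWord, List.map_cons, List.map_nil, BandLetter.inv_inv, List.reverse_cons,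
          List.reverse_nil, List.nil_append, List.cons_append] at this
        exact this.mono (by omega)
    have f1 := (hconj s).mono (B' := 2 * ((d + 1) * ζ) + 8 * ζ) (by omega)
    have f2 := h.context (B' := 2 * ((d + 1) * ζ) + 8 * ζ) [σ] [σ.inv] (by simp; omega)
    have f3 := (wordEq_posWord_negTwist [⟨i + d + 1, by omega⟩] k le_rfl).context
      (B' := 2 * ((d + 1) * ζ) + 8 * ζ) [] (posWord w ++ [σ.inv]) (by
        rw [hζeq]; simp; rw [add_mul]; omega)
    have f4 := hσ.context (B' := 2 * ((d + 1) * ζ) + 8 * ζ)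
      (negTwist n k ++ posWord (⟨i + d + 1, by omega⟩ :: w)) [] (by simp [hlen]; omega)
    have f5 := (wordEq_posWord_negTwist (⟨i + d + 1, by omega⟩ :: w) 1 le_rfl).context
      (B' := 2 * ((d + 1) * ζ) + 8 * ζ) (negTwist n k) (posWord r) (by
        rw [hζeq]; simp [hlen]; omega)
    refine ⟨k + 1, ⟨i + d + 1, by omega⟩ :: w ++ r, by omega, ?_, ?_⟩
    · have : (w.length + r.length + 1) ≤ (d + 2) * ζ := by
        rw [show (d + 2) * ζ = (d + 1) * ζ + ζ by ring]; omega
      simpa [add_assoc, add_comm, add_left_comm] using this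
    · rw [negTwist_add, posWord_append]
      simp only [List.append_nil, List.nil_append, List.append_assoc, List.cons_append]
        at f1 f2 f3 f4 f5 ⊢
      exact f1.trans (f2.trans (f3.trans (f4.trans f5)))

/-- A word of length at most `L` as a fraction with a bounded denominator. -/
theorem exists_frac_word (hn : 3 ≤ n) (W : BandWord n) :
    ∃ (k : ℕ) (w : List (Fin (n - 1))), k ≤ n * W.length ∧
      w.length ≤ n * W.length * (n * (n - 1)) ∧
      WordEq ((2 * (n * W.length) + 2 * n + 8) * (n * (n - 1))) W (negTwist n k ++ posWord w) := by
  have hζ := pos_of_three_le hn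
  induction W with
  | nil => exact ⟨0, [], by simp, by simp, WordEq.refl _ _⟩
  | cons x W ih =>
    obtain ⟨k, w, hk, hw, h⟩ := ih
    obtain ⟨⟨i, hi⟩, ⟨j, hj⟩, hij, s⟩ := x
    obtain ⟨k', w', hk', hw', h'⟩ := exists_frac_letter hn (show i < j from hij) hj s
    have hd : j - i ≤ n := by omega
    generalize j - i = d at *
    generalize hζeq : n * (n - 1) = ζ at *
    have hlen : ∀ k, (negTwist n k).length = k * ζ := by simp [← hζeq]
    have hkζ : k * ζ ≤ n * W.length * ζ := Nat.mul_le_mul_right _ hk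
    have hkζ' : k' * ζ ≤ d * ζ := Nat.mul_le_mul_right _ hk'
    have hdζ : d * ζ ≤ n * ζ := Nat.mul_le_mul_right _ hd
    have e1 : n * (W.length + 1) * ζ = n * W.length * ζ + n * ζ := by ring
    have e2 : (2 * (n * (W.length + 1)) + 2 * n + 8) * ζ
      = 2 * (n * W.length * ζ) + 4 * (n * ζ) + 8 * ζ := by ring
    have e3 : (2 * (n * W.length) + 2 * n + 8) * ζ
      = 2 * (n * W.length * ζ) + 2 * (n * ζ) + 8 * ζ := by ring
    have e4 : (2 * d + 6) * ζ = 2 * (d * ζ) + 6 * ζ := by ring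
    have e5 : n * (W.length + 1) = n * W.length + n := by ring
    have e6 : (k + 2) * ζ = k * ζ + 2 * ζ := by ring
    have hn1 : 3 * ζ ≤ n * ζ := Nat.mul_le_mul_right _ hn
    rw [e3] at h
    rw [e4] at h'
    simp only [List.length_cons]
    rw [e2, e1, e5]
    have f1 := h.context (B' := 2 * (n * W.length * ζ) + 4 * (n * ζ) + 8 * ζ)
      [letter (show i < j from hij) hj s] [] (by simp; omega)
    have f2 := h'.context (B' := 2 * (n * W.length * ζ) + 4 * (n * ζ) + 8 * ζ)
      [] (negTwist n k ++ posWord w) (by simp [hlen]; omega)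
    have f3 := (wordEq_posWord_negTwist w' k le_rfl).context
      (B' := 2 * (n * W.length * ζ) + 4 * (n * ζ) + 8 * ζ) (negTwist n k') (posWord w) (by
        rw [hζeq, e6]; simp [hlen]; omega)
    refine ⟨k' + k, w' ++ w, by omega, by simp; omega, ?_⟩
    rw [negTwist_add, posWord_append]
    simp only [List.append_nil, List.nil_append, List.append_assoc, List.cons_append]
      at f1 f2 f3 ⊢
    exact f1.trans (f2.trans f3)

/-- Expansion of a fraction by a power of the full twist. -/
theorem exists_frac_expand (k m : ℕ) (w : List (Fin (n - 1))) :
    ∃ w' : List (Fin (n - 1)), w'.length = w.length + m * (n * (n - 1)) ∧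
      WordEq (w.length + (k + 2 * m) * (n * (n - 1))) (negTwist n k ++ posWord w)
        (negTwist n (k + m) ++ posWord w') := by
  induction m with
  | zero => exact ⟨w, by simp, WordEq.refl _ _⟩
  | succ m ih =>
    obtain ⟨w', hw', h⟩ := ih
    have e1 : (k + 2 * (m + 1)) * (n * (n - 1))
      = (k + 2 * m) * (n * (n - 1)) + 2 * (n * (n - 1)) := by ring
    have e2 : (k + 2 * m) * (n * (n - 1))
      = (k + m) * (n * (n - 1)) + m * (n * (n - 1)) := by ring
    refine ⟨twistWord n ++ w', by rw [List.length_append, hw', length_twistWord]; ring, ?_⟩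
    have f := (wordEq_inv_mul (posWord (twistWord n)) le_rfl).symm.context
      (B' := w.length + (k + 2 * (m + 1)) * (n * (n - 1))) (negTwist n (k + m)) (posWord w') (by
        simp; omega)
    rw [← add_assoc k, negTwist_add (k + m), negTwist_one, posWord_append]
    simp only [List.append_nil, List.append_assoc] at f ⊢
    exact (h.mono (by omega)).trans f

theorem exists_frac_word' (hn : 3 ≤ n) (W : BandWord n) {L : ℕ} (hL : W.length ≤ L) :
    ∃ w : List (Fin (n - 1)), w.length ≤ 2 * (n * L) * (n * (n - 1)) ∧
      WordEq ((3 * (n * L) + 2 * n + 8) * (n * (n - 1))) W (negTwist n (n * L) ++ posWord w) := by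
  obtain ⟨k, w, hk, hw, h⟩ := exists_frac_word hn W
  obtain ⟨w', hw', h'⟩ := exists_frac_expand k (n * L - k) w
  have h1 : n * W.length ≤ n * L := Nat.mul_le_mul_left _ hL
  have h2 := Nat.mul_le_mul_right (n * (n - 1)) h1
  generalize n * (n - 1) = ζ at *
  generalize n * W.length = A at *
  generalize n * L = C at *
  obtain ⟨m, rfl⟩ := Nat.exists_eq_add_of_le (hk.trans h1)
  rw [Nat.add_sub_cancel_left] at hw' h'
  refine ⟨w', ?_, (h.mono ?_).trans (h'.mono ?_)⟩
  · nlinarith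
  · nlinarith
  · nlinarith

/-- One step of conjugation by a divisor of the full twist, performed on fractions. -/
theorem cyclicEq_of_mul_eq {v w s : List (Fin (n - 1))} (hs : s.length ≤ n * (n - 1))
    (h : ofWord (SimpleGraph.pathGraph (n - 1)) (v ++ s) = ofWord _ (s ++ w)) (k : ℕ) {B : ℕ}
    (hB : v.length + (k + 4) * (n * (n - 1)) ≤ B) :
    CyclicEq B (negTwist n k ++ posWord v) (negTwist n k ++ posWord w) := by
  obtain ⟨hlen, h⟩ := wordEq_posWord h
  have e : (k + 4) * (n * (n - 1)) = k * (n * (n - 1)) + 4 * (n * (n - 1)) := by ring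
  have e' : (k + 2) * (n * (n - 1)) = k * (n * (n - 1)) + 2 * (n * (n - 1)) := by ring
  simp only [List.length_append] at hlen
  have f1 := (wordEq_mul_inv (posWord s) le_rfl).symm.context (B' := B)
    (negTwist n k ++ posWord v) [] (by simp; omega)
  have f2 := h.context (B' := B) (negTwist n k) (invWord (posWord s)) (by simp; omega)
  have f3 := (wordEq_posWord_negTwist s k le_rfl).symm.context (B' := B) []
    (posWord w ++ invWord (posWord s)) (by rw [e']; simp; omega)
  have f4 := (wordEq_inv_mul (posWord s) le_rfl).context (B' := B) []
    (negTwist n k ++ posWord w) (by simp; omega)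
  simp only [List.append_nil, List.nil_append, List.append_assoc, posWord_append] at f1 f2 f3 f4
  refine EqvGen.trans _ _ _ (f1.trans (f2.trans f3)).cyclicEq
    (EqvGen.trans _ _ _ (EqvGen.rel _ _ ⟨Or.inr ⟨posWord s ++ (negTwist n k ++ posWord w),
      invWord (posWord s), by simp, rfl⟩, ?_, ?_⟩) f4.cyclicEq)
  · simp; omega
  · simp; omega

/-- Words representing conjugate braids can be transformed into each other by the rules and cyclic
rotations, within a length that depends linearly on the lengths of the words. -/
theorem cyclicEq_of_isConj (hn : 3 ≤ n) {V W : BandWord n} {L : ℕ} (hV : V.length ≤ L)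
    (hW : W.length ≤ L) (h : IsConj V.toBraid W.toBraid) :
    CyclicEq ((3 * (n * L) + 2 * n + 8) * (n * (n - 1))) V W := by
  obtain ⟨v, hv, hVv⟩ := exists_frac_word' hn V hV
  obtain ⟨w, hw, hWw⟩ := exists_frac_word' hn W hW
  refine EqvGen.trans _ _ _ hVv.cyclicEq (EqvGen.trans _ _ _ ?_ hWw.symm.cyclicEq)
  rw [hVv.toBraid, hWw.toBraid, BandWord.toBraid_append, BandWord.toBraid_append,
    toBraid_negTwist, toBraid_posWord, toBraid_posWord] at h
  have hconj : IsConj (toGroup n (ofWord _ v)) (toGroup n (ofWord _ w)) := by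
    obtain ⟨g, hg⟩ := isConj_iff.1 h
    refine isConj_iff.2 ⟨g, ?_⟩
    have hc := ((show Commute _ _ from toGroup_twist_comm g).pow_left (n * L)).inv_left.eq
    rw [← mul_assoc, ← hc, mul_assoc, mul_assoc, mul_right_inj] at hg
    rw [← hg, mul_assoc]
  suffices H : ∀ P Q : BraidMonoid n,
      ReflTransGen (fun P Q : BraidMonoid n => ∃ s, s ∣ twist n ∧ P * s = s * Q) P Q →
      ∀ v w, ofWord _ v = P → ofWord _ w = Q → v.length ≤ 2 * (n * L) * (n * (n - 1)) →
      CyclicEq ((3 * (n * L) + 2 * n + 8) * (n * (n - 1)))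
        (negTwist n (n * L) ++ posWord v) (negTwist n (n * L) ++ posWord w) from
    H _ _ (conj_chain hconj) v w rfl rfl hv
  intro P Q hPQ
  have hn6 : 4 * (n * (n - 1)) ≤ (2 * n + 8) * (n * (n - 1)) := Nat.mul_le_mul_right _ (by omega)
  induction hPQ using ReflTransGen.head_induction_on with
  | refl =>
    intro v w hv hw hl
    have h := wordEq_posWord (hv.trans hw.symm)
    have := h.2.context (B' := (3 * (n * L) + 2 * n + 8) * (n * (n - 1))) (negTwist n (n * L)) []
      (by simp; nlinarith)
    simpa using this.cyclicEq
  | @head P R hstep _ ih =>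
    intro v w hv hw hl
    obtain ⟨s, ⟨t, ht⟩, hs⟩ := hstep
    obtain ⟨s, rfl⟩ := ofWord_surjective s
    obtain ⟨r, hr⟩ := ofWord_surjective R
    have hlen := congrArg len hs
    rw [← hv, ← hr] at hlen hs
    simp only [len_mul, len_ofWord] at hlen
    have hsl : s.length ≤ n * (n - 1) := by rw [← len_twist, ht]; simp
    refine EqvGen.trans _ _ _ ?_ (ih r w hr hw (by omega))
    exact cyclicEq_of_mul_eq hsl (by simpa using hs) _ (by nlinarith)

end BraidGroup

/-! ### Words as numbers, and the graph of elementary transformations -/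

namespace BraidGroup

open Relation

variable {n : ℕ}

/-- The base in which words are encoded: the number of pairs of indices, once for each sign. -/
def base (n : ℕ) : ℕ := n * n + n * n

/-- The code of `a_{ij}`; its inverse has the code `code n i j + n * n`. The codes with `j ≤ i`,
among them `0`, stand for blanks. -/
def code (n i j : ℕ) : ℕ := i * n + j

theorem code_lt {i j : ℕ} (hi : i < n) (hj : j < n) : code n i j < n * n := by
  rw [code]; nlinarith

theorem code_div {i j : ℕ} (hj : j < n) : code n i j / n = i := by
  rw [code, add_comm, Nat.add_mul_div_right _ _ (by omega), Nat.div_eq_of_lt hj, zero_add]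

theorem code_mod {i j : ℕ} (hj : j < n) : code n i j % n = j := by
  rw [code, add_comm, Nat.add_mul_mod_self_right, Nat.mod_eq_of_lt hj]

/-- The braid with a given code. -/
def codeBraid (n c : ℕ) : BraidGroup n :=
  if c % (n * n) / n < c % (n * n) % n then
    if c < n * n then band n (c % (n * n) / n) (c % (n * n) % n)
    else (band n (c % (n * n) / n) (c % (n * n) % n))⁻¹
  else 1

theorem codeBraid_code {i j : ℕ} (hi : i < n) (hj : j < n) :
    codeBraid n (code n i j) = if i < j then band n i j else 1 := by
  rw [codeBraid, Nat.mod_eq_of_lt (code_lt hi hj), code_div hj, code_mod hj,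
    if_pos (code_lt hi hj)]

theorem codeBraid_code_add {i j : ℕ} (hi : i < n) (hj : j < n) :
    codeBraid n (code n i j + n * n) = (codeBraid n (code n i j))⁻¹ := by
  rw [codeBraid_code hi hj, codeBraid, Nat.add_mod_right, Nat.mod_eq_of_lt (code_lt hi hj),
    code_div hj, code_mod hj,
    if_neg (show ¬ code n i j + n * n < n * n by omega)]
  split_ifs <;> simp

theorem codeBraid_zero : codeBraid n 0 = 1 := by simp [codeBraid]

/-- The braid of a word given as a number, the first letter being the lowest digit. -/
def numBraid (n u : ℕ) : BraidGroup n := ((Nat.digits (base n) u).map (codeBraid n)).prod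

/-- The number of negative letters in a word given as a number. -/
def negCount (n u : ℕ) : ℕ := ((Nat.digits (base n) u).map (· / (n * n))).sum

theorem one_lt_base (hn : 0 < n) : 1 < base n := by rw [base]; nlinarith

theorem numBraid_zero : numBraid n 0 = 1 := by simp [numBraid]

theorem negCount_zero : negCount n 0 = 0 := by simp [negCount]

theorem numBraid_cons (hn : 0 < n) {x A : ℕ} (hx : x < base n) :
    numBraid n (x + base n * A) = codeBraid n x * numBraid n A := by
  by_cases h : x = 0 ∧ A = 0
  · simp [h.1, h.2, numBraid, codeBraid_zero]
  · rw [numBraid, Nat.digits_add _ (one_lt_base hn) _ _ hx (by omega)]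
    simp [numBraid]

theorem negCount_cons (hn : 0 < n) {x A : ℕ} (hx : x < base n) :
    negCount n (x + base n * A) = x / (n * n) + negCount n A := by
  by_cases h : x = 0 ∧ A = 0
  · simp [h.1, h.2, negCount]
  · rw [negCount, Nat.digits_add _ (one_lt_base hn) _ _ hx (by omega)]
    simp [negCount]

theorem numBraid_snoc (hn : 0 < n) {x A k : ℕ} (hx : x < base n) (hA : A < base n ^ k) :
    numBraid n (A + base n ^ k * x) = numBraid n A * codeBraid n x := by
  induction k generalizing A with
  | zero =>
    obtain rfl : A = 0 := by simpa using hA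
    simpa [numBraid_zero] using numBraid_cons hn (A := 0) hx
  | succ k ih =>
    have hb := one_lt_base hn
    have h1 : A % base n < base n := Nat.mod_lt _ (by omega)
    have h2 : A / base n < base n ^ k := by
      rw [Nat.div_lt_iff_lt_mul (by omega), ← pow_succ]; exact hA
    have e : A + base n ^ (k + 1) * x = A % base n + base n * (A / base n + base n ^ k * x) := by
      nth_rw 1 [← Nat.mod_add_div A (base n)]; ring
    rw [e, numBraid_cons hn h1, ih h2, ← mul_assoc, ← numBraid_cons hn h1, Nat.mod_add_div]

theorem numBraid_mem_filtration (hn : 0 < n) (u : ℕ) :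
    numBraid n u ∈ filtration n (negCount n u) := by
  induction u using Nat.strong_induction_on with
  | _ u ih =>
  have hb := one_lt_base hn
  by_cases hu : u = 0
  · subst hu
    rw [numBraid_zero]
    exact ⟨[], rfl, by simp [BandWord.nb]⟩
  have hx : u % base n < base n := Nat.mod_lt _ (by omega)
  have hA := ih (u / base n) (Nat.div_lt_self (by omega) hb)
  rw [← Nat.mod_add_div u (base n), numBraid_cons hn hx, negCount_cons hn hx]
  refine filtration_mul ?_ hA
  generalize u % base n = c at hx
  rw [codeBraid]
  have hi : c % (n * n) / n < n := by
    rw [Nat.div_lt_iff_lt_mul hn]; exact Nat.mod_lt _ (Nat.mul_pos hn hn)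
  have hj : c % (n * n) % n < n := Nat.mod_lt _ hn
  split_ifs with h1 h2
  · exact ⟨[letter h1 hj true], by simp [BandWord.toBraid, toBraid_letter_true],
      by simp [BandWord.nb, letter]⟩
  · refine ⟨[letter h1 hj false], by simp [BandWord.toBraid, BandLetter.toBraid, letter], ?_⟩
    rw [Nat.le_div_iff_mul_le (Nat.mul_pos hn hn)]
    simp [BandWord.nb, letter]
    omega
  · exact ⟨[], rfl, by simp [BandWord.nb]⟩

/-- The rules for a pair of codes: cancellation of a letter with its inverse, shift of a blank, and
the relations between two band generators of `Rule`. -/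
inductive CodeRule (n : ℕ) : ℕ → ℕ → ℕ → ℕ → Prop
  | cancel {i j : ℕ} : i < n → j < n → CodeRule n (code n i j) (code n i j + n * n) 0 0
  | cancel' {i j : ℕ} : i < n → j < n → CodeRule n (code n i j + n * n) (code n i j) 0 0
  | blank {i j : ℕ} : i < n → j < n → CodeRule n (code n i j) 0 0 (code n i j)
  | blank' {i j : ℕ} : i < n → j < n → CodeRule n (code n i j + n * n) 0 0 (code n i j + n * n)
  | slide {i j : ℕ} : j < n - 1 → i < j →
      CodeRule n (code n j (j + 1)) (code n i j) (code n i (j + 1)) (code n j (j + 1))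
  | turn {i j : ℕ} : j < n - 1 → i < j →
      CodeRule n (code n i j) (code n i (j + 1)) (code n j (j + 1)) (code n i j)
  | comm {i j : ℕ} : j < n - 2 → i < j →
      CodeRule n (code n i (i + 1)) (code n (j + 1) (j + 2)) (code n (j + 1) (j + 2))
        (code n i (i + 1))

/-- The edges of the graph of elementary transformations of words of length `m + 2`: cyclic
rotations by one letter, and applications of a rule to the first two letters. -/
inductive Edge (n m : ℕ) : ℕ → ℕ → Prop
  | rotate {x A : ℕ} : x < base n → A < base n ^ (m + 1) →
      Edge n m (x + base n * A) (A + base n ^ (m + 1) * x)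
  | head {x y x' y' A : ℕ} : CodeRule n x y x' y' → A < base n ^ m →
      Edge n m (x + base n * (y + base n * A)) (x' + base n * (y' + base n * A))

theorem CodeRule.lt {x y x' y' : ℕ} (hn : 0 < n) (h : CodeRule n x y x' y') :
    x < base n ∧ y < base n ∧ x' < base n ∧ y' < base n := by
  have key : ∀ {i j}, i < n → j < n → code n i j < n * n := code_lt
  have hn' : 0 < n * n := Nat.mul_pos hn hn
  rw [base]
  cases h with
  | cancel hi hj | cancel' hi hj | blank hi hj | blank' hi hj => have := key hi hj; omega
  | @slide i j hj hij | @turn i j hj hij =>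
    have h1 := key (i := j) (j := j + 1) (by omega) (by omega)
    have h2 := key (i := i) (j := j) (by omega) (by omega)
    have h3 := key (i := i) (j := j + 1) (by omega) (by omega)
    omega
  | @comm i j hj hij =>
    have h1 := key (i := j + 1) (j := j + 2) (by omega) (by omega)
    have h2 := key (i := i) (j := i + 1) (by omega) (by omega)
    omega

theorem CodeRule.braid_eq {x y x' y' : ℕ} (h : CodeRule n x y x' y') :
    codeBraid n x * codeBraid n y = codeBraid n x' * codeBraid n y' := by
  cases h with
  | cancel hi hj | cancel' hi hj => simp [codeBraid_code_add hi hj, codeBraid_zero]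
  | blank hi hj | blank' hi hj => simp [codeBraid_zero]
  | @slide i j hj hij =>
    rw [codeBraid_code (by omega) (by omega), codeBraid_code (by omega) (by omega),
      codeBraid_code (by omega) (by omega), if_pos (by omega), if_pos hij, if_pos (by omega),
      band_succ hij, band_succ_self]
    group
  | @turn i j hj hij =>
    rw [codeBraid_code (by omega) (by omega), codeBraid_code (by omega) (by omega),
      codeBraid_code (by omega) (by omega), if_pos (by omega), if_pos (by omega), if_pos (by omega),
      band_mul_band_succ hij hj, band_succ_self]
  | @comm i j hj hij =>
    rw [codeBraid_code (by omega) (by omega), codeBraid_code (by omega) (by omega),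
      if_pos (by omega), if_pos (by omega), band_succ_self, band_succ_self,
      sigma_comm (by omega)]

theorem Edge.isConj {m u v : ℕ} (hn : 0 < n) (h : Edge n m u v) :
    IsConj (numBraid n u) (numBraid n v) := by
  cases h with
  | @rotate x A hx hA =>
    rw [numBraid_cons hn hx, numBraid_snoc hn hx hA]
    exact isConj_iff.2 ⟨(codeBraid n x)⁻¹, by group⟩
  | head h hA =>
    obtain ⟨h1, h2, h3, h4⟩ := h.lt hn
    rw [numBraid_cons hn h1, numBraid_cons hn h2, numBraid_cons hn h3, numBraid_cons hn h4,
      ← mul_assoc, h.braid_eq, mul_assoc]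

theorem add_mul_lt_mul {x q A B : ℕ} (hx : x < q) (hA : A < B) : x + q * A < q * B := by
  nlinarith [Nat.mul_le_mul_left q (Nat.succ_le_of_lt hA)]

theorem Edge.lt {m u v : ℕ} (hn : 0 < n) (h : Edge n m u v) :
    u < base n ^ (m + 2) ∧ v < base n ^ (m + 2) := by
  have e : base n ^ (m + 2) = base n * base n ^ (m + 1) := by ring
  have e' : base n ^ (m + 2) = base n ^ (m + 1) * base n := by ring
  have e'' : base n ^ (m + 2) = base n * (base n * base n ^ m) := by ring
  cases h with
  | rotate hx hA =>
    exact ⟨e ▸ add_mul_lt_mul hx hA, e' ▸ add_mul_lt_mul hA hx⟩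
  | head h hA =>
    obtain ⟨h1, h2, h3, h4⟩ := h.lt hn
    rw [e'']
    exact ⟨add_mul_lt_mul h1 (add_mul_lt_mul h2 hA), add_mul_lt_mul h3 (add_mul_lt_mul h4 hA)⟩

/-! ### Padded words -/

/-- The code of a letter or, for `none`, of a blank. -/
def optCode : Option (BandLetter n) → ℕ
  | none => 0
  | some x => if x.sign then code n x.i x.j else code n x.i x.j + n * n

/-- The number of a word with blanks. -/
def numWord (l : List (Option (BandLetter n))) : ℕ := Nat.ofDigits (base n) (l.map optCode)

theorem numWord_cons (x : Option (BandLetter n)) (l : List (Option (BandLetter n))) :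
    numWord (x :: l) = optCode x + base n * numWord l := by simp [numWord, Nat.ofDigits_cons]

theorem numWord_append (l l' : List (Option (BandLetter n))) :
    numWord (l ++ l') = numWord l + base n ^ l.length * numWord l' := by
  simp [numWord, Nat.ofDigits_append]

theorem optCode_lt (hn : 0 < n) (x : Option (BandLetter n)) : optCode x < base n := by
  have hn' : 0 < n * n := Nat.mul_pos hn hn
  rw [base]
  cases x with
  | none => rw [optCode]; omega
  | some x =>
    have := code_lt x.i.2 x.j.2
    rw [optCode]
    split_ifs <;> omega

theorem numWord_lt (hn : 0 < n) (l : List (Option (BandLetter n))) :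
    numWord l < base n ^ l.length := by
  have := Nat.ofDigits_lt_base_pow_length (l := l.map optCode) (one_lt_base hn)
    (by simpa using fun x _ => optCode_lt hn x)
  simpa only [numWord, List.length_map] using this

theorem codeBraid_optCode (x : BandLetter n) : codeBraid n (optCode (some x)) = x.toBraid := by
  obtain ⟨i, j, hij, s⟩ := x
  have : i.val < j.val := hij
  cases s with
  | true => simp [optCode, codeBraid_code, BandLetter.toBraid, this]
  | false => simp [optCode, codeBraid_code_add, codeBraid_code, BandLetter.toBraid, this]

theorem numBraid_numWord (hn : 0 < n) (W : BandWord n) :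
    numBraid n (numWord (W.map some)) = W.toBraid := by
  induction W with
  | nil => simp [numWord, numBraid_zero, BandWord.toBraid]
  | cons x W ih =>
    rw [List.map_cons, numWord_cons, numBraid_cons hn (optCode_lt hn _), ih, codeBraid_optCode,
      BandWord.toBraid_cons]

theorem negCount_numWord (hn : 0 < n) (W : BandWord n) :
    negCount n (numWord (W.map some)) = W.nb := by
  have hn' : 0 < n * n := Nat.mul_pos hn hn
  induction W with
  | nil => simp [numWord, negCount_zero, BandWord.nb]
  | cons x W ih =>
    rw [List.map_cons, numWord_cons, negCount_cons hn (optCode_lt hn _), ih]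
    obtain ⟨i, j, hij, s⟩ := x
    have h := code_lt i.2 j.2
    cases s with
    | true => simp [optCode, BandWord.nb, Nat.div_eq_of_lt h]
    | false =>
      have : (code n i j + n * n) / (n * n) = 1 := by
        rw [Nat.add_div_right _ hn', Nat.div_eq_of_lt h]
      simp [optCode, BandWord.nb, this, add_comm]

theorem numWord_append_blank (l : List (Option (BandLetter n))) (k : ℕ) :
    numWord (l ++ List.replicate k none) = numWord l := by
  simp [numWord, optCode]

/-- Connection of two words with blanks in the graph of elementary transformations. -/
def Connected (m : ℕ) (l l' : List (Option (BandLetter n))) : Prop :=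
  EqvGen (Edge n m) (numWord l) (numWord l')

variable {m : ℕ}

theorem Connected.refl (l : List (Option (BandLetter n))) : Connected m l l := EqvGen.refl _

theorem Connected.trans {l l' l'' : List (Option (BandLetter n))} (h : Connected m l l')
    (h' : Connected m l' l'') : Connected m l l'' := EqvGen.trans _ _ _ h h'

theorem Connected.symm {l l' : List (Option (BandLetter n))} (h : Connected m l l') :
    Connected m l' l := EqvGen.symm _ _ h

theorem connected_rotate (hn : 0 < n) (p s : List (Option (BandLetter n)))
    (h : p.length + s.length = m + 2) : Connected m (p ++ s) (s ++ p) := by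
  induction p generalizing s with
  | nil => simpa using Connected.refl _
  | cons x p ih =>
    have h1 : Connected m (x :: (p ++ s)) ((p ++ s) ++ [x]) := by
      refine EqvGen.rel _ _ ?_
      have hl : (p ++ s).length = m + 1 := by simp at h ⊢; omega
      rw [numWord_cons, numWord_append (p ++ s), hl]
      have e : numWord [x] = optCode x := by simp [numWord]
      rw [e]
      exact Edge.rotate (optCode_lt hn x) (hl ▸ numWord_lt hn _)
    have h2 := ih (s ++ [x]) (by simp at h ⊢; omega)
    simp only [List.append_assoc, List.cons_append, List.nil_append] at h1 h2 ⊢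
    exact h1.trans h2

/-- A rule can be applied at every place of a word. -/
theorem connected_rule (hn : 0 < n) {x y x' y' : Option (BandLetter n)}
    (h : CodeRule n (optCode x) (optCode y) (optCode x') (optCode y'))
    (p s : List (Option (BandLetter n))) (hl : p.length + s.length = m) :
    Connected m (p ++ x :: y :: s) (p ++ x' :: y' :: s) := by
  have h1 := connected_rotate (m := m) hn p (x :: y :: s) (by simp; omega)
  have h2 := connected_rotate (m := m) hn (x' :: y' :: s) p (by simp; omega)
  refine h1.trans (Connected.trans (EqvGen.rel _ _ ?_) h2)
  simp only [List.cons_append, numWord_cons]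
  refine Edge.head h ?_
  have := numWord_lt hn (s ++ p)
  rwa [List.length_append, add_comm, hl] at this

theorem connected_blank (hn : 0 < n) (k : ℕ) (p s : List (Option (BandLetter n))) (w : BandWord n)
    (hl : p.length + k + w.length + s.length = m + 2) :
    Connected m (p ++ w.map some ++ List.replicate k none ++ s)
      (p ++ List.replicate k none ++ w.map some ++ s) := by
  have step : ∀ (p s : List (Option (BandLetter n))) (w : BandWord n),
      p.length + 1 + w.length + s.length = m + 2 →
      Connected m (p ++ w.map some ++ none :: s) (p ++ none :: (w.map some ++ s)) := by
    intro p s w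
    induction w generalizing p with
    | nil => intro; simpa using Connected.refl _
    | cons x w ih =>
      intro hl
      rw [List.length_cons] at hl
      have h1 := ih (p ++ [some x]) (by simp; omega)
      have hx : CodeRule n (optCode (some x)) (optCode (none : Option (BandLetter n)))
          (optCode (none : Option (BandLetter n))) (optCode (some x)) := by
        obtain ⟨i, j, hij, s⟩ := x
        cases s with
        | true => exact CodeRule.blank i.2 j.2
        | false => exact CodeRule.blank' i.2 j.2
      have h2 := connected_rule hn hx p (w.map some ++ s) (m := m) (by simp; omega)
      simp only [List.append_assoc, List.cons_append, List.nil_append, List.map_cons] at h1 h2 ⊢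
      exact h1.trans h2
  induction k generalizing s with
  | zero => simpa using Connected.refl _
  | succ k ih =>
    have h1 := ih (none :: s) (by simp; omega)
    have h2 := step (p ++ List.replicate k none) s w (by simp; omega)
    rw [List.replicate_succ']
    simp only [List.append_assoc, List.cons_append, List.nil_append] at h1 h2 ⊢
    exact h1.trans h2

/-- A word filled up with blanks to the length `k`. -/
def padded (k : ℕ) (u : BandWord n) : List (Option (BandLetter n)) :=
  u.map some ++ List.replicate (k - u.length) none

theorem connected_rewrite (hn : 0 < n) {l r : BandWord n} (h : Rule l r) (p s : BandWord n)
    (hl : (p ++ l ++ s).length ≤ m + 2) :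
    Connected m (padded (m + 2) (p ++ l ++ s)) (padded (m + 2) (p ++ r ++ s)) := by
  -- all rules but the cancellation replace two letters by two letters
  have key : ∀ {x y x' y' : BandLetter n},
      CodeRule n (optCode (some x)) (optCode (some y)) (optCode (some x')) (optCode (some y')) →
      (p ++ [x, y] ++ s).length ≤ m + 2 →
      Connected m (padded (m + 2) (p ++ [x, y] ++ s)) (padded (m + 2) (p ++ [x', y'] ++ s)) := by
    intro x y x' y' h hl
    simp only [List.length_append, List.length_cons, List.length_nil] at hl
    have := connected_rule hn h (p.map some)
      (s.map some ++ List.replicate (m + 2 - (p.length + (s.length + 2))) none) (m := m)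
      (by simp; omega)
    simpa [padded, add_assoc] using this
  cases h with
  | cancel x =>
    simp only [List.length_append, List.length_cons, List.length_nil] at hl
    have hx : CodeRule n (optCode (some x)) (optCode (some x.inv))
        (optCode (none : Option (BandLetter n))) (optCode (none : Option (BandLetter n))) := by
      obtain ⟨i, j, hij, s⟩ := x
      cases s with
      | true => exact CodeRule.cancel i.2 j.2
      | false => exact CodeRule.cancel' i.2 j.2
    have h1 := connected_rule hn hx (p.map some)
      (s.map some ++ List.replicate (m + 2 - (p.length + 2 + s.length)) none) (m := m)
      (by simp; omega)
    have h2 := (connected_blank hn 2 (p.map some)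
      (List.replicate (m + 2 - (p.length + 2 + s.length)) none) s (m := m) (by simp; omega)).symm
    have e : m + 2 - (p.length + s.length) = 2 + (m + 2 - (p.length + 2 + s.length)) := by omega
    have h3 := h1.trans (l'' := p.map some ++ s.map some ++ List.replicate 2 none ++
      List.replicate (m + 2 - (p.length + 2 + s.length)) none) (by
        simpa [List.replicate_succ] using h2)
    simp only [padded, List.map_append, List.length_append, List.append_assoc, List.length_cons,
      List.length_nil, List.append_nil, e, List.replicate_add] at h3 ⊢
    simpa [add_assoc] using h3
  | @slide i j hij hj => exact key (CodeRule.slide (show j < n - 1 by omega) hij) hl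
  | @turn i j hij hj => exact key (CodeRule.turn (show j < n - 1 by omega) hij) hl
  | @comm i j hij hj => exact key (CodeRule.comm (show j < n - 2 by omega) hij) hl

theorem CyclicEq.connected (hn : 0 < n) {u v : BandWord n} (h : CyclicEq (m + 2) u v) :
    Connected m (padded (m + 2) u) (padded (m + 2) v) := by
  induction h with
  | rel u v h =>
    obtain ⟨⟨p, s, l, r, h, rfl, rfl⟩ | ⟨p, s, rfl, rfl⟩, h1, h2⟩ := h
    · exact connected_rewrite hn h p s h1
    · rw [List.length_append] at h1
      have e1 := connected_rotate (m := m) hn (p.map some)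
        (s.map some ++ List.replicate (m + 2 - (p.length + s.length)) none) (by simp; omega)
      have e2 := (connected_blank (m := m) hn (m + 2 - (p.length + s.length)) (s.map some) [] p
        (by simp; omega)).symm
      simp only [padded, List.map_append, List.length_append, add_comm s.length, List.append_assoc,
        List.append_nil] at e1 e2 ⊢
      exact e1.trans e2
  | refl => exact EqvGen.refl _
  | symm _ _ _ ih => exact ih.symm
  | trans _ _ _ _ _ ih ih' => exact ih.trans ih'

/-- Being conjugate into a step `k ≤ 1` of the filtration is a reachability problem in the graph of
elementary transformations of words of moderate length. -/
theorem exists_conj_filtration_iff (hn : 3 ≤ n) (W : BandWord n) {k : ℕ} (hk : k ≤ 1)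
    (hm : 11 * (n * n * n * (W.length + 1)) ≤ m) :
    (∃ γ, IsConj W.toBraid γ ∧ γ ∈ filtration n k) ↔
      ∃ u, EqvGen (Edge n m) (numWord (W.map some)) u ∧ negCount n u ≤ k := by
  have hn0 : 0 < n := by omega
  constructor
  · rintro ⟨_, hγ, V, rfl, hV⟩
    have hlen : V.length ≤ W.length + 2 := by
      have := expSum_conj hγ
      rw [BandWord.expSum_toBraid, BandWord.expSum_toBraid] at this
      omega
    have h := cyclicEq_of_isConj hn (show W.length ≤ W.length + 2 by omega) hlen hγ
    have hB : (3 * (n * (W.length + 2)) + 2 * n + 8) * (n * (n - 1)) ≤ m + 2 := by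
      have h1 : 3 * (n * (W.length + 2)) + 2 * n + 8 ≤ 11 * (n * (W.length + 1)) := by nlinarith
      have h2 : n * (n - 1) ≤ n * n := Nat.mul_le_mul_left _ (by omega)
      calc _ ≤ 11 * (n * (W.length + 1)) * (n * n) := Nat.mul_le_mul h1 h2
        _ = 11 * (n * n * n * (W.length + 1)) := by ring
        _ ≤ m + 2 := by omega
    have hc := CyclicEq.connected hn0 (m := m)
      (EqvGen.mono (fun _ _ ⟨h, h1, h2⟩ => ⟨h, h1.trans hB, h2.trans hB⟩) _ _ h)
    rw [Connected, padded, padded, numWord_append_blank, numWord_append_blank] at hc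
    exact ⟨_, hc, by rwa [negCount_numWord hn0]⟩
  · rintro ⟨u, hu, hneg⟩
    refine ⟨numBraid n u, ?_, ?_⟩
    · rw [← numBraid_numWord hn0 W]
      clear hneg
      generalize numWord (W.map some) = v at hu
      induction hu with
      | rel _ _ h => exact h.isConj hn0
      | refl => exact IsConj.refl _
      | symm _ _ _ ih => exact ih.symm
      | trans _ _ _ _ _ ih ih' => exact ih.trans ih'
    · obtain ⟨V, hV, hV'⟩ := numBraid_mem_filtration hn0 u
      exact ⟨V, hV, hV'.trans hneg⟩

end BraidGroup

/-! ### A program logic for the random access machine -/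

namespace RAM

/-- The program `p`, started in the state `s`, halts within `T` steps in a state satisfying `Q`. -/
def Run (p : Program) (s : State) (T : ℕ) (Q : State → Prop) : Prop :=
  ∃ t s', Exec p s t s' ∧ t ≤ T ∧ Q s'

/-- The registers a program may write. -/
def regWrites : Program → List ℕ
  | .skip => []
  | .const x _ => [x]
  | .add x _ _ => [x]
  | .sub x _ _ => [x]
  | .load x _ _ => [x]
  | .store _ _ _ => []
  | .seq p q => regWrites p ++ regWrites q
  | .cond _ p q => regWrites p ++ regWrites q
  | .loop _ p => regWrites p

/-- The memory banks a program may write. -/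
def bankWrites : Program → List ℕ
  | .skip => []
  | .const _ _ => []
  | .add _ _ _ => []
  | .sub _ _ _ => []
  | .load _ _ _ => []
  | .store b _ _ => [b]
  | .seq p q => bankWrites p ++ bankWrites q
  | .cond _ p q => bankWrites p ++ bankWrites q
  | .loop _ p => bankWrites p

theorem State.reg_setReg (s : State) (x v r : ℕ) :
    (s.setReg x v).reg r = if r = x then v else s.reg r := by
  simp [State.setReg, Function.update_apply]

theorem State.mem_setReg (s : State) (x v : ℕ) : (s.setReg x v).mem = s.mem := rfl

theorem State.reg_setMem (s : State) (b a v : ℕ) : (s.setMem b a v).reg = s.reg := rfl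

theorem State.mem_setMem (s : State) (b a v b' a' : ℕ) :
    (s.setMem b a v).mem b' a' = if b' = b ∧ a' = a then v else s.mem b' a' := by
  simp only [State.setMem, Function.update_apply]
  by_cases hb : b' = b
  · subst hb; simp [Function.update_apply]
  · simp [hb]

/-- What a program does not write keeps its value. -/
def Frame (p : Program) (s s' : State) : Prop :=
  (∀ r, r ∉ regWrites p → s'.reg r = s.reg r) ∧ ∀ b, b ∉ bankWrites p → s'.mem b = s.mem b

theorem Exec.frame {p : Program} {s s' : State} {t : ℕ} (h : Exec p s t s') : Frame p s s' := by
  induction h with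
  | skip => exact ⟨fun _ _ => rfl, fun _ _ => rfl⟩
  | const s x c | add s x y z | sub s x y z | load s x b y =>
    refine ⟨fun r hr => ?_, fun _ _ => rfl⟩
    rw [State.reg_setReg, if_neg (by simpa [regWrites] using hr)]
  | store s b x y =>
    refine ⟨fun _ _ => rfl, fun b' hb => ?_⟩
    funext a
    rw [State.mem_setMem, if_neg (by simp [bankWrites] at hb; tauto)]
  | seq _ _ ih ih' =>
    refine ⟨fun r hr => ?_, fun b hb => ?_⟩
    · simp only [regWrites, List.mem_append, not_or] at hr
      rw [ih'.1 r hr.2, ih.1 r hr.1]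
    · simp only [bankWrites, List.mem_append, not_or] at hb
      rw [ih'.2 b hb.2, ih.2 b hb.1]
  | condPos _ _ ih =>
    refine ⟨fun r hr => ih.1 r ?_, fun b hb => ih.2 b ?_⟩
    · simp only [regWrites, List.mem_append, not_or] at hr; exact hr.1
    · simp only [bankWrites, List.mem_append, not_or] at hb; exact hb.1
  | condZero _ _ ih =>
    refine ⟨fun r hr => ih.1 r ?_, fun b hb => ih.2 b ?_⟩
    · simp only [regWrites, List.mem_append, not_or] at hr; exact hr.2
    · simp only [bankWrites, List.mem_append, not_or] at hb; exact hb.2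
  | loopPos _ _ _ ih ih' =>
    exact ⟨fun r hr => (ih'.1 r hr).trans (ih.1 r hr), fun b hb => (ih'.2 b hb).trans (ih.2 b hb)⟩
  | loopZero _ => exact ⟨fun _ _ => rfl, fun _ _ => rfl⟩

variable {p q : Program} {s : State} {T T' : ℕ} {Q Q' : State → Prop}

theorem Run.mono (h : Run p s T Q) (hT : T ≤ T') (hQ : ∀ s', Q s' → Q' s') : Run p s T' Q' := by
  obtain ⟨t, s', h1, h2, h3⟩ := h
  exact ⟨t, s', h1, h2.trans hT, hQ _ h3⟩

theorem Run.le (h : Run p s T Q) (hT : T ≤ T') : Run p s T' Q := h.mono hT fun _ h => h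

theorem Run.frame (h : Run p s T Q) : Run p s T fun s' => Q s' ∧ Frame p s s' := by
  obtain ⟨t, s', h1, h2, h3⟩ := h
  exact ⟨t, s', h1, h2, h3, h1.frame⟩

theorem Run.skip (h : Q s) : Run .skip s 1 Q := ⟨1, s, .skip s, le_rfl, h⟩

theorem Run.const {x c : ℕ} (h : Q (s.setReg x c)) : Run (.const x c) s 1 Q :=
  ⟨1, _, .const s x c, le_rfl, h⟩

theorem Run.add {x y z : ℕ} (h : Q (s.setReg x (s.reg y + s.reg z))) : Run (.add x y z) s 1 Q :=
  ⟨1, _, .add s x y z, le_rfl, h⟩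

theorem Run.sub {x y z : ℕ} (h : Q (s.setReg x (s.reg y - s.reg z))) : Run (.sub x y z) s 1 Q :=
  ⟨1, _, .sub s x y z, le_rfl, h⟩

theorem Run.load {x b y : ℕ} (h : Q (s.setReg x (s.mem b (s.reg y)))) : Run (.load x b y) s 1 Q :=
  ⟨1, _, .load s x b y, le_rfl, h⟩

theorem Run.store {b x y : ℕ} (h : Q (s.setMem b (s.reg x) (s.reg y))) :
    Run (.store b x y) s 1 Q :=
  ⟨1, _, .store s b x y, le_rfl, h⟩

theorem Run.seq (h : Run p s T fun s' => Run q s' T' Q) : Run (.seq p q) s (T + T') Q := by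
  obtain ⟨t, s', h1, h2, t', s'', h3, h4, h5⟩ := h
  exact ⟨_, _, .seq h1 h3, Nat.add_le_add h2 h4, h5⟩

theorem Run.cond {x : ℕ} (hp : s.reg x ≠ 0 → Run p s T Q) (hq : s.reg x = 0 → Run q s T Q) :
    Run (.cond x p q) s (T + 1) Q := by
  by_cases hx : s.reg x = 0
  · obtain ⟨t, s', h1, h2, h3⟩ := hq hx
    exact ⟨_, _, .condZero hx h1, by omega, h3⟩
  · obtain ⟨t, s', h1, h2, h3⟩ := hp hx
    exact ⟨_, _, .condPos hx h1, by omega, h3⟩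

/-- A sequence of programs. -/
def block (l : List Program) : Program := l.foldr .seq .skip

theorem Run.nil (h : Q s) : Run (block []) s 1 Q := Run.skip h

theorem Run.cons {l : List Program} (h : Run p s T fun s' => Run (block l) s' T' Q) :
    Run (block (p :: l)) s (T + T') Q := Run.seq h

/-- `for i < b do body`, with the scratch register `2`. -/
def forLoop (i b : ℕ) (body : Program) : Program :=
  .seq (.const i 0) (.seq (.sub 2 b i)
    (.loop 2 (.seq body (.seq (.const 2 1) (.seq (.add i i 2) (.sub 2 b i))))))

/-- The rule for counting loops: besides the invariant, what the loop does not write is available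
in its body. The invariant must not depend on the counter and the scratch register. -/
theorem Run.forLoop {i b : ℕ} {body : Program} {B : ℕ} (I : ℕ → State → Prop)
    (hB : s.reg b = B) (hi : i ∉ regWrites body) (hb : b ∉ regWrites body)
    (hib : i ≠ b ∧ i ≠ 2 ∧ b ≠ 2) (hI : ∀ k s v w, I k s → I k ((s.setReg i v).setReg 2 w))
    (h0 : I 0 s)
    (hstep : ∀ k < B, ∀ s', I k s' → s'.reg i = k → Frame (RAM.forLoop i b body) s s' →
      Run body s' T (I (k + 1))) :
    Run (RAM.forLoop i b body) s (B * (T + 4) + 3) (I B) := by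
  obtain ⟨hib, hi2, hb2⟩ := hib
  have hreg : ∀ s' : State, ∀ v w, ((s'.setReg i v).setReg 2 w).reg b = s'.reg b := by
    intro s' v w
    rw [State.reg_setReg, if_neg hb2, State.reg_setReg, if_neg hib.symm]
  have hrw : ∀ r, r ∉ regWrites (RAM.forLoop i b body) → r ≠ i ∧ r ≠ 2 ∧ r ∉ regWrites body := by
    intro r hr
    simp only [RAM.forLoop, regWrites, List.mem_append, List.mem_singleton] at hr
    tauto
  have hbw : ∀ r, r ∉ bankWrites (RAM.forLoop i b body) → r ∉ bankWrites body := by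
    intro r hr
    simp only [RAM.forLoop, bankWrites, List.mem_append] at hr
    tauto
  have hset : ∀ s' : State, Frame (RAM.forLoop i b body) s s' → ∀ v w,
      Frame (RAM.forLoop i b body) s ((s'.setReg i v).setReg 2 w) := by
    intro s' h v w
    refine ⟨fun r hr => ?_, h.2⟩
    have := hrw r hr
    rw [State.reg_setReg, if_neg this.2.1, State.reg_setReg, if_neg this.1, h.1 r hr]
  -- the remaining `d` rounds
  have key : ∀ d k s', k + d = B → I k s' → s'.reg i = k → s'.reg 2 = d → s'.reg b = B →
      Frame (RAM.forLoop i b body) s s' →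
      Run (.loop 2 (.seq body (.seq (.const 2 1) (.seq (.add i i 2) (.sub 2 b i))))) s'
        (d * (T + 4) + 1) (I B) := by
    intro d
    induction d with
    | zero =>
      intro k s' hk hIk _ h2 _ _
      obtain rfl : k = B := by omega
      exact ⟨1, s', .loopZero h2, by omega, hIk⟩
    | succ d ih =>
      intro k s' hk hIk hki h2 hbB hfr
      obtain ⟨t, s₁, e1, ht, hI₁, hfr₁⟩ := (hstep k (by omega) s' hIk hki hfr).frame
      have hi₁ : s₁.reg i = k := by rw [hfr₁.1 i hi, hki]
      have hb₁ : s₁.reg b = B := by rw [hfr₁.1 b hb, hbB]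
      have e2 := Exec.const s₁ 2 1
      have e3 := Exec.add (s₁.setReg 2 1) i i 2
      have e4 := Exec.sub ((s₁.setReg 2 1).setReg i ((s₁.setReg 2 1).reg i + (s₁.setReg 2 1).reg 2))
        2 b i
      have hs₂ : (((s₁.setReg 2 1).setReg i ((s₁.setReg 2 1).reg i + (s₁.setReg 2 1).reg 2)).setReg
          2 (((s₁.setReg 2 1).setReg i ((s₁.setReg 2 1).reg i + (s₁.setReg 2 1).reg 2)).reg b -
          ((s₁.setReg 2 1).setReg i ((s₁.setReg 2 1).reg i + (s₁.setReg 2 1).reg 2)).reg i))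
          = (s₁.setReg i (k + 1)).setReg 2 (B - (k + 1)) := by
        simp only [State.reg_setReg, if_neg hi2, if_neg hb2, if_neg hib.symm, if_true, hi₁, hb₁]
        ext r
        · simp only [State.reg_setReg]
          split_ifs <;> rfl
        · rfl
      rw [hs₂] at e4
      have hfr₂ : Frame (RAM.forLoop i b body) s s₁ := by
        refine ⟨fun r hr => ?_, fun r hr => ?_⟩
        · rw [hfr₁.1 r (hrw r hr).2.2, hfr.1 r hr]
        · rw [hfr₁.2 r (hbw r hr), hfr.2 r hr]
      obtain ⟨t', s₃, e5, ht', hQ⟩ := ih (k + 1) ((s₁.setReg i (k + 1)).setReg 2 (B - (k + 1)))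
        (by omega) (hI _ _ _ _ hI₁) (by simp [State.reg_setReg, hi2])
        (by simp [State.reg_setReg]; omega) (by rw [hreg, hb₁]) (hset _ hfr₂ _ _)
      refine ⟨_, s₃, .loopPos (by omega) (.seq e1 (.seq e2 (.seq e3 e4))) e5, ?_, hQ⟩
      rw [show (d + 1) * (T + 4) + 1 = d * (T + 4) + 1 + (T + 4) by ring]
      omega
  obtain ⟨t, s', e, ht, hQ⟩ := key B 0 ((s.setReg i 0).setReg 2 B) (by omega) (hI _ _ _ _ h0)
    (by simp [State.reg_setReg, hi2]) (by simp [State.reg_setReg]) (by rw [hreg, hB])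
    (hset s ⟨fun _ _ => rfl, fun _ _ => rfl⟩ _ _)
  have e1 := Exec.const s i 0
  have e2 := Exec.sub (s.setReg i 0) 2 b i
  rw [State.reg_setReg, if_neg hib.symm, State.reg_setReg, if_pos rfl, hB, Nat.sub_zero] at e2
  exact ⟨_, s', .seq e1 (.seq e2 e), by omega, hQ⟩

/-- `d := x * y`, by repeated addition; uses the registers `2` and `3`. -/
def mul (d x y : ℕ) : Program := block [.const d 0, forLoop 3 y (.add d d x)]

theorem Run.mul {d x y Y : ℕ} (hd : d ≠ x ∧ d ≠ y ∧ d ≠ 2 ∧ d ≠ 3 ∧ x ≠ 2 ∧ x ≠ 3 ∧ y ≠ 2 ∧ y ≠ 3)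
    (hY : s.reg y ≤ Y)
    (h : ∀ s', s'.reg d = s.reg x * s.reg y →
      (∀ r, r ≠ d → r ≠ 2 → r ≠ 3 → s'.reg r = s.reg r) → s'.mem = s.mem → Q s') :
    Run (RAM.mul d x y) s (5 * Y + 5) Q := by
  obtain ⟨h1, h2, h3, h4, h5, h6, h7, h8⟩ := hd
  have hloop := (Run.forLoop (s := s.setReg d 0) (i := 3) (b := y) (body := .add d d x)
    (B := s.reg y) (T := 1) (fun k s' => s'.reg d = s.reg x * k)
    (by simp [State.reg_setReg, h2.symm])
    (by simp [regWrites, h4.symm]) (by simp [regWrites, h2.symm]) ⟨h8.symm, by omega, h7⟩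
    (by intro k s' v w h; simpa [State.reg_setReg, h3, h4] using h)
    (by simp [State.reg_setReg])
    (by
      intro k hk s' hI hk3 hfr
      refine Run.add ?_
      have : s'.reg x = s.reg x := by
        rw [hfr.1 x (by simp [RAM.forLoop, regWrites]; omega), State.reg_setReg, if_neg h1.symm]
      simp only [State.reg_setReg, if_true, hI, this]
      ring)).frame
  refine Run.le (Run.cons (Run.const (Run.cons (hloop.mono le_rfl ?_)))) (T := 1 + (_ + 1)) ?_
  · rintro s' ⟨hs, hfr⟩
    refine Run.nil (h s' hs (fun r hr hr2 hr3 => ?_) ?_)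
    · rw [hfr.1 r (by simp [RAM.forLoop, regWrites]; omega), State.reg_setReg, if_neg hr]
    · funext b
      exact hfr.2 b (by simp [RAM.forLoop, bankWrites])
  · omega

end RAM

/-! ### The constants of the computation -/

namespace RAM

open BraidGroup

/-- The length, less two, of the words considered for an input of length `L`, as
`exists_conj_filtration_iff` demands. -/
def wordLen (n L : ℕ) : ℕ := 11 * (n * n * n * (L + 1))

/-- The contents of the registers that hold constants, after the first part of the program: words
of length `m + 2` are considered. -/
structure Consts (n m : ℕ) (s : State) : Prop where
  r0 : s.reg 0 = n
  r4 : s.reg 4 = 1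
  r5 : s.reg 5 = 0
  r6 : s.reg 6 = n * n
  r7 : s.reg 7 = base n
  r9 : s.reg 9 = base n ^ m
  r10 : s.reg 10 = base n ^ (m + 1)
  r11 : s.reg 11 = base n ^ (m + 2)
  r12 : s.reg 12 = base n * base n

theorem Consts.of_agree {n m : ℕ} {s s' : State} (h : Consts n m s)
    (hs : ∀ r ∈ [0, 4, 5, 6, 7, 9, 10, 11, 12], s'.reg r = s.reg r) : Consts n m s' := by
  simp only [List.mem_cons, List.not_mem_nil, or_false, forall_eq_or_imp, forall_eq] at hs
  obtain ⟨h0, h4, h5, h6, h7, h9, h10, h11, h12⟩ := hs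
  constructor
  · rw [h0, h.r0]
  · rw [h4, h.r4]
  · rw [h5, h.r5]
  · rw [h6, h.r6]
  · rw [h7, h.r7]
  · rw [h9, h.r9]
  · rw [h10, h.r10]
  · rw [h11, h.r11]
  · rw [h12, h.r12]

theorem Consts.frame {n m : ℕ} {s s' : State} {p : Program} (h : Consts n m s) (hf : Frame p s s')
    (hp : ∀ r ∈ [0, 4, 5, 6, 7, 9, 10, 11, 12], r ∉ regWrites p) : Consts n m s' :=
  h.of_agree fun r hr => hf.1 r (hp r hr)

/-- The cost of a loop of at most `K` rounds. -/
theorem loop_cost {B T K c e : ℕ} (hK : 1 ≤ K) (hB : B ≤ K) (hT : T ≤ c * K ^ e) :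
    B * (T + 4) + 3 ≤ (c + 7) * K ^ (e + 1) := by
  have h1 : 1 ≤ K ^ e := Nat.one_le_pow _ _ hK
  have h2 : 1 ≤ K ^ (e + 1) := Nat.one_le_pow _ _ hK
  calc B * (T + 4) + 3 ≤ K * (c * K ^ e + 4 * K ^ e) + 3 * K ^ (e + 1) := by
        gcongr <;> omega
    _ = (c + 7) * K ^ (e + 1) := by ring

theorem le_of_three_le {n : ℕ} (hn : 3 ≤ n) (m : ℕ) :
    n ≤ base n ∧ 18 ≤ base n ∧ n * n ≤ base n ∧ base n ≤ base n ^ (m + 2) ∧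
      base n ^ m ≤ base n ^ (m + 2) ∧ base n ^ (m + 1) ≤ base n ^ (m + 2) ∧
      m ≤ base n ^ (m + 2) := by
  have h1 : n * 3 ≤ n * n := Nat.mul_le_mul_left _ hn
  have hb : base n = n * n + n * n := rfl
  have hb0 : 0 < base n := by omega
  refine ⟨by omega, by omega, by omega, ?_, Nat.pow_le_pow_right hb0 (by omega),
    Nat.pow_le_pow_right hb0 (by omega), ?_⟩
  · exact Nat.le_self_pow (by omega) _
  · calc m ≤ 2 ^ m := Nat.lt_two_pow_self.le
      _ ≤ base n ^ m := Nat.pow_le_pow_left (by omega) _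
      _ ≤ base n ^ (m + 2) := Nat.pow_le_pow_right hb0 (by omega)

theorem length_le_wordLen {n : ℕ} (hn : 3 ≤ n) (L : ℕ) : L + 1 ≤ wordLen n L := by
  have h1 : 1 ≤ n * n * n := Nat.mul_pos (Nat.mul_pos (by omega) (by omega)) (by omega)
  have := Nat.mul_le_mul_right (L + 1) h1
  rw [wordLen]; omega

/-- Computation of the constants; the loop computes a power of the base, register `8` holding the
exponent `wordLen n L`. -/
def setup : Program := block [
  .const 4 1, mul 6 0 0, .add 7 6 6, mul 8 6 0, .add 14 1 4, mul 13 8 14, .const 14 11,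
  mul 8 13 14, .const 9 1, forLoop 15 8 (block [mul 14 9 7, .add 9 14 5]), mul 10 9 7,
  mul 11 10 7, mul 12 7 7]

theorem run_setup {n L : ℕ} (hn : 3 ≤ n) {s : State} (h0 : s.reg 0 = n) (h1 : s.reg 1 = L)
    (h5 : s.reg 5 = 0) :
    Run setup s (200 * (base n ^ (wordLen n L + 2)) ^ 2) fun s' =>
      Consts n (wordLen n L) s' ∧ s'.reg 1 = L := by
  obtain ⟨b1, b2, b3, b4, b5, b6, b7⟩ := le_of_three_le hn (wordLen n L)
  have b8 := length_le_wordLen hn L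
  set m := wordLen n L with hm
  set K := base n ^ (m + 2) with hK
  have hloop : ∀ s : State, s.reg 9 = 1 → s.reg 7 = base n → s.reg 8 = m → s.reg 5 = 0 →
      Run (forLoop 15 8 (block [mul 14 9 7, .add 9 14 5])) s (m * ((5 * K + 7) + 4) + 3)
        fun s' => s'.reg 9 = base n ^ m := by
    intro s h9 h7 h8 h5
    refine Run.forLoop (fun k s => s.reg 9 = base n ^ k) h8 (by decide) (by decide) (by decide)
      (fun k s v w h => by simpa [State.reg_setReg] using h) (by simpa using h9) ?_
    intro k _ s' hk _ hf
    have h7' : s'.reg 7 = base n := by rw [hf.1 7 (by decide), h7]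
    have h5' : s'.reg 5 = 0 := by rw [hf.1 5 (by decide), h5]
    refine Run.le (Run.cons <| Run.mul (Y := K) (by decide) (by rw [h7']; exact b4)
      fun s₁ e₁ f₁ _ => Run.cons <| Run.add <| Run.nil ?_) (by omega)
    simp only [State.reg_setReg, if_true, e₁]
    rw [f₁ 5 (by decide) (by decide) (by decide), h5', hk, h7', pow_succ, add_zero]
  refine Run.le (Run.cons <| Run.const <| Run.cons <| Run.mul (Y := K) (by decide) ?_
    fun s₁ e₁ f₁ _ => Run.cons <| Run.add <| Run.cons <| Run.mul (Y := K) (by decide) ?_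
    fun s₂ e₂ f₂ _ => Run.cons <| Run.add <| Run.cons <| Run.mul (Y := K) (by decide) ?_
    fun s₃ e₃ f₃ _ => Run.cons <| Run.const <| Run.cons <| Run.mul (Y := K) (by decide) ?_
    fun s₄ e₄ f₄ _ => Run.cons <| Run.const <| Run.cons <|
      (hloop _ ?_ ?_ ?_ ?_).frame.mono le_rfl
    fun s₅ ⟨e₅, f₅⟩ => Run.cons <| Run.mul (Y := K) (by decide) ?_
    fun s₆ e₆ f₆ _ => Run.cons <| Run.mul (Y := K) (by decide) ?_
    fun s₇ e₇ f₇ _ => Run.cons <| Run.mul (Y := K) (by decide) ?_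
    fun s₈ e₈ f₈ _ => Run.nil ?_) ?_
  · simp [State.reg_setReg, h0]; omega
  · simp [State.reg_setReg, f₁, h0]; omega
  · simp [State.reg_setReg, f₂, f₁, h1]; omega
  · simp [State.reg_setReg]; omega
  · simp [State.reg_setReg]
  · simp [State.reg_setReg, f₄, f₃, f₂, e₁, f₁, h0, base]
  · simp [State.reg_setReg, e₄, e₃, f₂, e₂, f₁, e₁, h0, h1, hm, wordLen]; ring
  · simp [State.reg_setReg, f₄, f₃, f₂, f₁, h5]
  rotate_right
  · have h1 : m * (5 * K + 7 + 4) ≤ K * (5 * K + 11) := Nat.mul_le_mul b7 (by omega)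
    nlinarith
  all_goals
    have g7 : s₅.reg 7 = base n := by
      rw [f₅.1 7 (by decide)]
      simp [State.reg_setReg, f₄, f₃, f₂, e₁, f₁, h0, base]
  · rw [g7]; exact b4
  · rw [f₆ 7 (by decide) (by decide) (by decide), g7]; exact b4
  · rw [f₇ 7 (by decide) (by decide) (by decide), f₆ 7 (by decide) (by decide) (by decide), g7]
    exact b4
  · have g0 := f₅.1 0 (by decide)
    have g1 := f₅.1 1 (by decide)
    have g4 := f₅.1 4 (by decide)
    have g5 := f₅.1 5 (by decide)
    have g6 := f₅.1 6 (by decide)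
    simp [State.reg_setReg, f₄, f₃, f₂, e₁, f₁, h0, h1, h5] at g0 g1 g4 g5 g6
    constructor
    · constructor <;>
        simp [f₈, e₈, f₇, e₇, f₆, e₆, g0, g4, g5, g6, g7, e₅, pow_succ]
    · simp [f₈, f₇, f₆, g1]

/-! ### The number of the input word -/

/-- Computation of the number of the input word in register `13`; register `14` runs through the
powers of the base. -/
def startWord : Program := block [.const 13 0, .const 14 1, forLoop 15 1 (block [.load 21 0 15,
  .load 22 1 15, .load 23 2 15, .sub 23 4 23, mul 24 21 0, .add 24 24 22, mul 25 6 23,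
  .add 24 24 25, mul 25 14 24, .add 13 13 25, mul 25 14 7, .add 14 25 5])]

theorem numWord_take_succ {n : ℕ} (W : BandWord n) {k : ℕ} (hk : k < W.length) :
    numWord ((W.take (k + 1)).map some) =
      numWord ((W.take k).map some) + base n ^ k * optCode (some W[k]) := by
  rw [List.take_succ_eq_append_getElem hk, List.map_append, numWord_append]
  simp [numWord, hk.le]

theorem run_startWord {n m : ℕ} (hn : 3 ≤ n) (W : BandWord n) (hm : W.length ≤ m) {s : State}
    (hs : Consts n m s) (h1 : s.reg 1 = W.length) (hmem : s.mem = (inputState n W).mem) :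
    Run startWord s (100 * (base n ^ (m + 2)) ^ 2) fun s' =>
      Consts n m s' ∧ s'.reg 13 = numWord (W.map some) := by
  obtain ⟨b1, b2, b3, b4, b5, b6, b7⟩ := le_of_three_le hn m
  set K := base n ^ (m + 2) with hK
  have hloop : Run startWord s (1 + (1 + (W.length * ((20 * K + 40) + 4) + 3 + 1)))
      fun s' => s'.reg 13 = numWord (W.map some) := by
    refine Run.cons <| Run.const <| Run.cons <| Run.const <| Run.cons <|
      (Run.forLoop (T := 20 * K + 40) (B := W.length)
      (fun k s => s.reg 13 = numWord ((W.take k).map some) ∧ s.reg 14 = base n ^ k)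
      ?_ (by decide) (by decide) (by decide)
      (fun k s v w h => by simpa [State.reg_setReg] using h) ?_ ?_).mono le_rfl fun s' h =>
      Run.nil ?_
    · simp [State.reg_setReg, h1]
    · simp [State.reg_setReg, numWord]
    · rintro k hk s' ⟨i13, i14⟩ ik hf
      have c' : Consts n m s' := (hs.of_agree (s' := (s.setReg 13 0).setReg 14 1)
        (by simp [State.reg_setReg])).frame hf (by decide)
      have hmem' : s'.mem = (inputState n W).mem := by
        rw [← hmem]; funext b; exact hf.2 b (by simp [bankWrites, forLoop, block, mul])
      have m0 : s'.mem 0 k = W[k].i := by simp [hmem', inputState, hk]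
      have m1 : s'.mem 1 k = W[k].j := by simp [hmem', inputState, hk]
      have m2 : s'.mem 2 k = if W[k].sign then 1 else 0 := by simp [hmem', inputState, hk]
      have hi := W[k].i.isLt
      have hj := W[k].j.isLt
      have hc : W[k].i * n + W[k].j + n * n * (1 - if W[k].sign then 1 else 0) =
          optCode (some W[k]) := by
        cases h : W[k].sign <;> simp [optCode, code, h]
      have hc' : optCode (some W[k]) ≤ K := (optCode_lt (by omega) _).le.trans b4
      refine Run.le (Run.cons <| Run.load <| Run.cons <| Run.load <| Run.cons <| Run.load <|
        Run.cons <| Run.sub <| Run.cons <| Run.mul (Y := K) (by decide) ?_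
        fun s₁ e₁ f₁ _ => Run.cons <| Run.add <| Run.cons <| Run.mul (Y := K) (by decide) ?_
        fun s₂ e₂ f₂ _ => Run.cons <| Run.add <| Run.cons <| Run.mul (Y := K) (by decide) ?_
        fun s₃ e₃ f₃ _ => Run.cons <| Run.add <| Run.cons <| Run.mul (Y := K) (by decide) ?_
        fun s₄ e₄ f₄ _ => Run.cons <| Run.add <| Run.nil ?_) ?_
      rotate_right
      · omega
      · simp [State.reg_setReg, c'.r0]; omega
      all_goals
        simp [State.reg_setReg, State.mem_setReg, c'.r4, c'.r0, ik, m0, m1, m2] at e₁ f₁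
      · simp [State.reg_setReg, f₁]; omega
      · simp [State.reg_setReg, e₁, f₁, c'.r6] at e₂
        simp [e₂, f₂, State.reg_setReg, e₁, f₁, hc, hc']
      · simp [f₃, f₂, State.reg_setReg, f₁, c'.r7, b4]
      · simp [State.reg_setReg, e₁, f₁, c'.r6] at e₂
        simp [e₂, f₂, State.reg_setReg, e₁, f₁, hc, i14] at e₃
        rw [numWord_take_succ W hk]
        simp [e₄, f₄, e₃, f₃, f₂, State.reg_setReg, f₁, i13, i14, c'.r7, c'.r5, pow_succ]
    · simpa using h.1
  refine hloop.frame.mono ?_ fun s' h => ⟨hs.frame h.2 (by decide), h.1⟩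
  have h1 : W.length * (20 * K + 40 + 4) ≤ K * (20 * K + 44) :=
    Nat.mul_le_mul (hm.trans b7) (by omega)
  nlinarith

end RAM

/-! ### The list of edges -/

namespace RAM

open BraidGroup

/-- The banks `3` and `4` hold the first and second components of the list `l` of pairs, and
register `16` its length. -/
structure Holds (l : List (ℕ × ℕ)) (s : State) : Prop where
  length : s.reg 16 = l.length
  fst : ∀ k (hk : k < l.length), s.mem 3 k = l[k].1
  snd : ∀ k (hk : k < l.length), s.mem 4 k = l[k].2

theorem Holds.of_agree {l : List (ℕ × ℕ)} {s s' : State} (h : Holds l s)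
    (h1 : s'.reg 16 = s.reg 16) (h2 : s'.mem 3 = s.mem 3) (h3 : s'.mem 4 = s.mem 4) :
    Holds l s' := by
  refine ⟨by rw [h1, h.length], fun k hk => by rw [h2, h.fst k hk], fun k hk => ?_⟩
  rw [h3, h.snd k hk]

theorem Holds.snoc {l : List (ℕ × ℕ)} {s s' : State} {e : ℕ × ℕ} (h : Holds l s)
    (h1 : s'.reg 16 = l.length + 1)
    (h2 : ∀ k, s'.mem 3 k = if k = l.length then e.1 else s.mem 3 k)
    (h3 : ∀ k, s'.mem 4 k = if k = l.length then e.2 else s.mem 4 k) : Holds (l ++ [e]) s' := by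
  refine ⟨by simp [h1], fun k hk => ?_, fun k hk => ?_⟩
  · rw [h2]
    split_ifs with hkl
    · subst hkl; simp
    · have hk' : k < l.length := by simp at hk; omega
      rw [h.fst k hk', List.getElem_append_left hk']
  · rw [h3]
    split_ifs with hkl
    · subst hkl; simp
    · have hk' : k < l.length := by simp at hk; omega
      rw [h.snd k hk', List.getElem_append_left hk']

/-- Append the pair `(a + m₁ b + t, c + m₂ d + t)`, where `t` is the contents of register `18`. -/
def emit (m₁ m₂ a b c d : ℕ) : Program := block [mul 40 m₁ b, .add 40 40 a, .add 40 40 18,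
  mul 41 m₂ d, .add 41 41 c, .add 41 41 18, .store 3 16 40, .store 4 16 41, .add 16 16 4]

theorem Run.emit {m₁ m₂ a b c d K : ℕ} {s : State} {l : List (ℕ × ℕ)} {Q : State → Prop}
    (hr : ∀ r ∈ [m₁, m₂, a, b, c, d], r ≠ 2 ∧ r ≠ 3 ∧ r ≠ 40 ∧ r ≠ 41) (hb : s.reg b ≤ K)
    (hd : s.reg d ≤ K) (hl : Holds l s) (h4 : s.reg 4 = 1)
    (h : ∀ s', Holds (l ++ [(s.reg a + s.reg m₁ * s.reg b + s.reg 18,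
      s.reg c + s.reg m₂ * s.reg d + s.reg 18)]) s' →
      (∀ r, r ≠ 2 → r ≠ 3 → r ≠ 16 → r ≠ 40 → r ≠ 41 → s'.reg r = s.reg r) → Q s') :
    Run (RAM.emit m₁ m₂ a b c d) s (10 * K + 18) Q := by
  simp only [List.mem_cons, List.not_mem_nil, or_false, forall_eq_or_imp, forall_eq] at hr
  obtain ⟨⟨a1, a2, a3, a4⟩, ⟨b1, b2, b3, b4⟩, ⟨c1, c2, c3, c4⟩, ⟨d1, d2, d3, d4⟩, ⟨e1, e2, e3, e4⟩,
    ⟨g1, g2, g3, g4⟩⟩ := hr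
  refine Run.le (Run.cons <| Run.mul (Y := K) (by omega) hb
    fun s₁ e₁ f₁ q₁ => Run.cons <| Run.add <| Run.cons <| Run.add <| Run.cons <|
      Run.mul (Y := K) (by omega) ?_
    fun s₂ e₂ f₂ q₂ => Run.cons <| Run.add <| Run.cons <| Run.add <| Run.cons <| Run.store <|
      Run.cons <| Run.store <| Run.cons <| Run.add <| Run.nil ?_) (by omega)
  · simp [State.reg_setReg, *]
  · simp [State.reg_setReg, *] at e₂
    simp [State.mem_setReg, q₁] at q₂
    refine h _ (hl.snoc ?_ ?_ ?_) ?_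
    · simp [State.reg_setReg, State.reg_setMem, f₂, f₁, hl.length, h4]
    · intro k
      simp [State.reg_setReg, State.mem_setReg, State.reg_setMem, State.mem_setMem, f₂, f₁, e₁,
        q₂, hl.length, c1, c2, c3]
      congr 1; ring
    · intro k
      simp [State.reg_setReg, State.mem_setReg, State.reg_setMem, State.mem_setMem, hl.length, *]
      congr 1; ring
    · intro r h2 h3 h16 h40 h41
      simp [State.reg_setReg, State.reg_setMem, *]

/-- The rule for loops that append to the list of pairs. -/
theorem Run.appendLoop {i b : ℕ} {body : Program} {s : State} {B K c e : ℕ} {l : List (ℕ × ℕ)}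
    (f : ℕ → List (ℕ × ℕ)) (hl : Holds l s) (hB : s.reg b = B) (hBK : B ≤ K) (hK : 1 ≤ K)
    (hi : i ∉ regWrites body) (hb : b ∉ regWrites body) (hib : (i ≠ b ∧ i ≠ 2 ∧ b ≠ 2) ∧ i ≠ 16)
    (hstep : ∀ k < B, ∀ l' s', Holds l' s' → s'.reg i = k → Frame (RAM.forLoop i b body) s s' →
      Run body s' (c * K ^ e) (Holds (l' ++ f k))) :
    Run (RAM.forLoop i b body) s ((c + 7) * K ^ (e + 1))
      (Holds (l ++ (List.range B).flatMap f)) := by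
  refine Run.le (Run.forLoop (fun k s => Holds (l ++ (List.range k).flatMap f) s) hB hi hb hib.1 ?_
    (by simpa using hl) ?_) (loop_cost hK hBK le_rfl)
  · intro k s v w h
    exact h.of_agree (by simp [State.reg_setReg, hib.2.symm]) rfl rfl
  · intro k hk s' h hik hf
    have := hstep k hk _ s' h hik hf
    simpa [List.range_succ, List.flatMap_append] using this

/-- The pair of vertices of an edge that rewrites the first two letters `x`, `y` of a word to `x'`,
`y'`; here `q` is the base and `A` the number of the rest of the word. -/
def headPair (q A x y x' y' : ℕ) : ℕ × ℕ := (x + q * (y + q * A), x' + q * (y' + q * A))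

/-- The edges that rotate a word. -/
def rotateList (n m : ℕ) : List (ℕ × ℕ) :=
  (List.range (base n ^ (m + 1))).flatMap fun A => (List.range (base n)).flatMap fun x =>
    [(x + base n * A, A + base n ^ (m + 1) * x)]

/-- The edges for cancellation and for moving blanks. -/
def blankList (n A : ℕ) : List (ℕ × ℕ) :=
  (List.range n).flatMap fun i => (List.range n).flatMap fun j =>
    [headPair (base n) A (code n i j) (code n i j + n * n) 0 0,
      headPair (base n) A (code n i j + n * n) (code n i j) 0 0,
      headPair (base n) A (code n i j) 0 0 (code n i j),
      headPair (base n) A (code n i j + n * n) 0 0 (code n i j + n * n)]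

/-- The edges for the relations between bands on three strands. -/
def triangleList (n A : ℕ) : List (ℕ × ℕ) :=
  (List.range (n - 1)).flatMap fun j => (List.range j).flatMap fun i =>
    [headPair (base n) A (code n j (j + 1)) (code n i j) (code n i (j + 1)) (code n j (j + 1)),
      headPair (base n) A (code n i j) (code n i (j + 1)) (code n j (j + 1)) (code n i j)]

/-- The edges for the far commutativity of Artin generators. -/
def farList (n A : ℕ) : List (ℕ × ℕ) :=
  (List.range (n - 1 - 1)).flatMap fun j => (List.range j).flatMap fun i =>
    [headPair (base n) A (code n i (i + 1)) (code n (j + 1) (j + 2)) (code n (j + 1) (j + 2))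
      (code n i (i + 1))]

/-- All edges of the graph of elementary transformations. -/
def edgeList (n m : ℕ) : List (ℕ × ℕ) :=
  rotateList n m ++ (List.range (base n ^ m)).flatMap fun A =>
    blankList n A ++ triangleList n A ++ farList n A

theorem mem_edgeList {n m : ℕ} {e : ℕ × ℕ} : e ∈ edgeList n m ↔ Edge n m e.1 e.2 := by
  obtain ⟨u, v⟩ := e
  simp only [edgeList, rotateList, blankList, triangleList, farList, headPair, List.mem_append,
    List.mem_flatMap, List.mem_range, List.mem_cons, List.not_mem_nil, or_false, Prod.mk.injEq]
  constructor
  · rintro (⟨A, hA, x, hx, rfl, rfl⟩ | ⟨A, hA, (⟨i, hi, j, hj, h⟩ | ⟨j, hj, i, hi, h⟩) |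
      ⟨j, hj, i, hi, rfl, rfl⟩⟩)
    · exact .rotate hx hA
    · obtain ⟨rfl, rfl⟩ | ⟨rfl, rfl⟩ | ⟨rfl, rfl⟩ | ⟨rfl, rfl⟩ := h
      · exact .head (.cancel hi hj) hA
      · exact .head (.cancel' hi hj) hA
      · exact .head (.blank hi hj) hA
      · exact .head (.blank' hi hj) hA
    · obtain ⟨rfl, rfl⟩ | ⟨rfl, rfl⟩ := h
      · exact .head (.slide hj hi) hA
      · exact .head (.turn hj hi) hA
    · exact .head (.comm (by omega) hi) hA
  · rintro (⟨hx, hA⟩ | ⟨h, hA⟩)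
    · exact .inl ⟨_, hA, _, hx, rfl, rfl⟩
    · refine .inr ⟨_, hA, ?_⟩
      cases h with
      | cancel hi hj => exact .inl (.inl ⟨_, hi, _, hj, .inl ⟨rfl, rfl⟩⟩)
      | cancel' hi hj => exact .inl (.inl ⟨_, hi, _, hj, .inr (.inl ⟨rfl, rfl⟩)⟩)
      | blank hi hj => exact .inl (.inl ⟨_, hi, _, hj, .inr (.inr (.inl ⟨rfl, rfl⟩))⟩)
      | blank' hi hj => exact .inl (.inl ⟨_, hi, _, hj, .inr (.inr (.inr ⟨rfl, rfl⟩))⟩)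
      | slide hj hi => exact .inl (.inr ⟨_, hj, _, hi, .inl ⟨rfl, rfl⟩⟩)
      | turn hj hi => exact .inl (.inr ⟨_, hj, _, hi, .inr ⟨rfl, rfl⟩⟩)
      | comm hj hi => exact .inr ⟨_, by omega, _, hi, rfl, rfl⟩

theorem length_flatMap_range_le {α : Type*} {f : ℕ → List α} {B c : ℕ}
    (h : ∀ k < B, (f k).length ≤ c) : ((List.range B).flatMap f).length ≤ B * c := by
  induction B with
  | zero => simp
  | succ B ih =>
    have h1 := ih fun k hk => h k (by omega)
    have h2 := h B (by omega)
    simp only [List.range_succ, List.flatMap_append, List.length_append, List.flatMap_singleton]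
    rw [Nat.succ_mul]
    omega

theorem length_edgeList_le {n m : ℕ} : (edgeList n m).length ≤ 8 * base n ^ (m + 2) := by
  have h1 : (rotateList n m).length ≤ base n ^ (m + 1) * (base n * 1) :=
    length_flatMap_range_le fun A _ => length_flatMap_range_le fun x _ => le_rfl
  have h2 : ((List.range (base n ^ m)).flatMap fun A =>
      blankList n A ++ triangleList n A ++ farList n A).length ≤ base n ^ m * (7 * (n * n)) := by
    refine length_flatMap_range_le fun A _ => ?_
    have a1 : (blankList n A).length ≤ n * (n * 4) :=
      length_flatMap_range_le fun i _ => length_flatMap_range_le fun j _ => le_rfl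
    have a2 : (triangleList n A).length ≤ (n - 1) * (n * 2) :=
      length_flatMap_range_le fun j hj => (length_flatMap_range_le (c := 2) fun i _ => le_rfl).trans
        (Nat.mul_le_mul_right _ (by omega))
    have a3 : (farList n A).length ≤ (n - 1 - 1) * (n * 1) :=
      length_flatMap_range_le fun j hj => (length_flatMap_range_le (c := 1) fun i _ => le_rfl).trans
        (Nat.mul_le_mul_right _ (by omega))
    have a4 : (n - 1) * (n * 2) ≤ n * (n * 2) := Nat.mul_le_mul_right _ (by omega)
    have a5 : (n - 1 - 1) * (n * 1) ≤ n * (n * 1) := Nat.mul_le_mul_right _ (by omega)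
    simp only [List.length_append]
    linarith
  have h3 : 7 * (n * n) ≤ 7 * (base n * base n) := by
    have : n * n ≤ base n := Nat.le_add_right _ _
    nlinarith [Nat.zero_le (base n), Nat.le_mul_self (base n)]
  rw [edgeList, List.length_append]
  calc _ ≤ base n ^ (m + 1) * (base n * 1) + base n ^ m * (7 * (base n * base n)) :=
        Nat.add_le_add h1 (h2.trans (Nat.mul_le_mul_left _ h3))
    _ = 8 * base n ^ (m + 2) := by ring

/-- Enumeration of the edges for cancellation and for moving blanks: the registers `19` and `20`
hold `i` and `j`, the registers `21` and `22` the codes of `a_{ij}` and its inverse, and register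
`18` the unchanged digits `q²A` of the word. -/
def blankEdges : Program := forLoop 19 0 (forLoop 20 0 (block [mul 21 19 0, .add 21 21 20,
  .add 22 21 6, emit 7 7 21 22 5 5, emit 7 7 22 21 5 5, emit 7 7 21 5 5 21, emit 7 7 22 5 5 22]))

/-- Enumeration of the edges for the relations between bands on three strands; register `26` holds
`n - 1`. -/
def triangleEdges : Program := forLoop 20 26 (forLoop 19 20 (block [mul 21 20 0, .add 21 21 20,
  .add 21 21 4, mul 22 19 0, .add 22 22 20, .add 23 22 4, emit 7 7 21 22 23 21,
  emit 7 7 22 23 21 22]))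

/-- Enumeration of the edges for the far commutativity of Artin generators; register `26` holds
`n - 2`. -/
def farEdges : Program := forLoop 20 26 (forLoop 19 20 (block [mul 21 19 0, .add 21 21 19,
  .add 21 21 4, mul 22 20 0, .add 22 22 0, .add 22 22 20, .add 22 22 4, .add 22 22 4,
  emit 7 7 21 22 22 21]))

/-- Enumeration of all edges: the rotations, and then the rules for the first two letters of a word
with the remaining digits `A`, which register `17` holds. -/
def edges : Program := block [.const 16 0, .const 18 0,
  forLoop 17 10 (forLoop 19 7 (emit 7 10 19 17 17 19)),
  forLoop 17 9 (block [mul 18 12 17, blankEdges, .sub 26 0 4, triangleEdges, .sub 26 26 4,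
    farEdges])]

variable {n m A : ℕ} {s : State} {l : List (ℕ × ℕ)}

theorem Run.emitHead {a b c d q A x y x' y' K : ℕ} {Q : State → Prop}
    (hr : ∀ r ∈ [7, 7, a, b, c, d], r ≠ 2 ∧ r ≠ 3 ∧ r ≠ 40 ∧ r ≠ 41) (hl : Holds l s)
    (h4 : s.reg 4 = 1) (h7 : s.reg 7 = q) (h18 : s.reg 18 = q * q * A) (ha : s.reg a = x)
    (hb : s.reg b = y) (hc : s.reg c = x') (hd : s.reg d = y') (hy : y ≤ K) (hy' : y' ≤ K)
    (h : ∀ s', Holds (l ++ [headPair q A x y x' y']) s' →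
      (∀ r, r ≠ 2 → r ≠ 3 → r ≠ 16 → r ≠ 40 → r ≠ 41 → s'.reg r = s.reg r) → Q s') :
    Run (RAM.emit 7 7 a b c d) s (10 * K + 18) Q := by
  refine Run.emit hr (by omega) (by omega) hl h4 fun s' h1 h2 => h s' ?_ h2
  rw [h7, h18, ha, hb, hc, hd] at h1
  convert h1 using 4 <;> rw [headPair] <;> ring_nf

theorem run_blankEdges (hn : 3 ≤ n) (hs : Consts n m s) (hl : Holds l s)
    (ht : s.reg 18 = base n * base n * A) :
    Run blankEdges s (300 * (base n ^ (m + 2)) ^ 3) (Holds (l ++ blankList n A)) := by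
  obtain ⟨b1, b2, b3, b4, b5, b6, b7⟩ := le_of_three_le hn m
  set K := base n ^ (m + 2) with hK
  refine Run.le (Run.appendLoop (K := K) (c := 207) (e := 2) _ hl hs.r0 (by omega) (by omega)
    (by decide) (by decide) (by decide) ?_) (Nat.mul_le_mul_right _ (by omega))
  intro i hi l₁ s₁ hl₁ hi₁ hf₁
  have hs₁ := hs.frame hf₁ (by decide)
  refine Run.appendLoop (K := K) (c := 200) (e := 1) _ hl₁ hs₁.r0 (by omega) (by omega)
    (by decide) (by decide) (by decide) ?_
  intro j hj l₂ s₂ hl₂ hj₂ hf₂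
  have hs₂ := hs₁.frame hf₂ (by decide)
  have hi₂ : s₂.reg 19 = i := by rw [hf₂.1 19 (by decide), hi₁]
  have ht₂ : s₂.reg 18 = base n * base n * A := by
    rw [hf₂.1 18 (by decide), hf₁.1 18 (by decide), ht]
  have hcode := code_lt hi hj
  have hbase : base n = n * n + n * n := rfl
  refine Run.le (Run.cons <| Run.mul (Y := K) (by decide) ?_
    fun s₃ e₃ f₃ q₃ => Run.cons <| Run.add <| Run.cons <| Run.add <|
    Run.cons <| Run.emitHead (K := K) (q := base n) (A := A) (x := code n i j)
      (y := code n i j + n * n) (x' := 0) (y' := 0) (by decide)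
      (hl₂.of_agree ?_ ?_ ?_) ?_ ?_ ?_ ?_ ?_ ?_ ?_ ?_ ?_
    fun s₄ h₄ f₄ => Run.cons <| Run.emitHead (K := K) (q := base n) (A := A)
      (x := code n i j + n * n) (y := code n i j) (x' := 0) (y' := 0) (by decide)
      h₄ ?_ ?_ ?_ ?_ ?_ ?_ ?_ ?_ ?_
    fun s₅ h₅ f₅ => Run.cons <| Run.emitHead (K := K) (q := base n) (A := A) (x := code n i j)
      (y := 0) (x' := 0) (y' := code n i j) (by decide)
      h₅ ?_ ?_ ?_ ?_ ?_ ?_ ?_ ?_ ?_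
    fun s₆ h₆ f₆ => Run.cons <| Run.emitHead (K := K) (q := base n) (A := A)
      (x := code n i j + n * n) (y := 0) (x' := 0) (y' := code n i j + n * n) (by decide)
      h₆ ?_ ?_ ?_ ?_ ?_ ?_ ?_ ?_ ?_
    fun s₇ h₇ f₇ => Run.nil (by simpa using h₇)) ?_
  rotate_right
  · rw [pow_one]; omega
  · rw [hs₂.r0]; omega
  all_goals first
    | omega
    | (simp [State.reg_setReg, State.mem_setReg, *, hs₂.r4, hs₂.r5, hs₂.r6, hs₂.r7, hs₂.r0,
        code])

theorem run_triangleEdges (hn : 3 ≤ n) (hs : Consts n m s) (hl : Holds l s)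
    (ht : s.reg 18 = base n * base n * A) (h26 : s.reg 26 = n - 1) :
    Run triangleEdges s (300 * (base n ^ (m + 2)) ^ 3) (Holds (l ++ triangleList n A)) := by
  obtain ⟨b1, b2, b3, b4, b5, b6, b7⟩ := le_of_three_le hn m
  set K := base n ^ (m + 2) with hK
  refine Run.le (Run.appendLoop (K := K) (c := 207) (e := 2) _ hl h26 (by omega) (by omega)
    (by decide) (by decide) (by decide) ?_) (Nat.mul_le_mul_right _ (by omega))
  intro j hj l₁ s₁ hl₁ hj₁ hf₁
  have hs₁ := hs.frame hf₁ (by decide)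
  refine Run.appendLoop (K := K) (c := 200) (e := 1) _ hl₁ hj₁ (by omega) (by omega)
    (by decide) (by decide) (by decide) ?_
  intro i hi l₂ s₂ hl₂ hi₂ hf₂
  have hs₂ := hs₁.frame hf₂ (by decide)
  have hj₂ : s₂.reg 20 = j := by rw [hf₂.1 20 (by decide), hj₁]
  have ht₂ : s₂.reg 18 = base n * base n * A := by
    rw [hf₂.1 18 (by decide), hf₁.1 18 (by decide), ht]
  have hc₁ : code n i j < n * n := code_lt (by omega) (by omega)
  have hc₂ : code n i (j + 1) < n * n := code_lt (by omega) (by omega)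
  have hc₃ : code n j (j + 1) < n * n := code_lt (by omega) (by omega)
  refine Run.le (Run.cons <| Run.mul (Y := K) (by decide) ?_
    fun s₃ e₃ f₃ q₃ => Run.cons <| Run.add <| Run.cons <| Run.add <| Run.cons <|
      Run.mul (Y := K) (by decide) ?_
    fun s₄ e₄ f₄ q₄ => Run.cons <| Run.add <| Run.cons <| Run.add <|
    Run.cons <| Run.emitHead (K := K) (q := base n) (A := A) (x := code n j (j + 1))
      (y := code n i j) (x' := code n i (j + 1)) (y' := code n j (j + 1)) (by decide)
      (hl₂.of_agree ?_ ?_ ?_) ?_ ?_ ?_ ?_ ?_ ?_ ?_ ?_ ?_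
    fun s₅ h₅ f₅ => Run.cons <| Run.emitHead (K := K) (q := base n) (A := A) (x := code n i j)
      (y := code n i (j + 1)) (x' := code n j (j + 1)) (y' := code n i j) (by decide)
      h₅ ?_ ?_ ?_ ?_ ?_ ?_ ?_ ?_ ?_
    fun s₆ h₆ f₆ => Run.nil (by simpa using h₆)) ?_
  rotate_right
  · rw [pow_one]; omega
  · rw [hs₂.r0]; omega
  · simp [State.reg_setReg, f₃, hs₂.r0]; omega
  all_goals first
    | omega
    | (simp [State.reg_setReg, State.mem_setReg, *, hs₂.r4, hs₂.r7, hs₂.r0, code, add_assoc])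

theorem run_farEdges (hn : 3 ≤ n) (hs : Consts n m s) (hl : Holds l s)
    (ht : s.reg 18 = base n * base n * A) (h26 : s.reg 26 = n - 1 - 1) :
    Run farEdges s (300 * (base n ^ (m + 2)) ^ 3) (Holds (l ++ farList n A)) := by
  obtain ⟨b1, b2, b3, b4, b5, b6, b7⟩ := le_of_three_le hn m
  set K := base n ^ (m + 2) with hK
  refine Run.le (Run.appendLoop (K := K) (c := 207) (e := 2) _ hl h26 (by omega) (by omega)
    (by decide) (by decide) (by decide) ?_) (Nat.mul_le_mul_right _ (by omega))
  intro j hj l₁ s₁ hl₁ hj₁ hf₁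
  have hs₁ := hs.frame hf₁ (by decide)
  refine Run.appendLoop (K := K) (c := 200) (e := 1) _ hl₁ hj₁ (by omega) (by omega)
    (by decide) (by decide) (by decide) ?_
  intro i hi l₂ s₂ hl₂ hi₂ hf₂
  have hs₂ := hs₁.frame hf₂ (by decide)
  have hj₂ : s₂.reg 20 = j := by rw [hf₂.1 20 (by decide), hj₁]
  have ht₂ : s₂.reg 18 = base n * base n * A := by
    rw [hf₂.1 18 (by decide), hf₁.1 18 (by decide), ht]
  have hc₁ : code n i (i + 1) < n * n := code_lt (by omega) (by omega)
  have hc₂ : code n (j + 1) (j + 2) < n * n := code_lt (by omega) (by omega)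
  refine Run.le (Run.cons <| Run.mul (Y := K) (by decide) ?_
    fun s₃ e₃ f₃ q₃ => Run.cons <| Run.add <| Run.cons <| Run.add <| Run.cons <|
      Run.mul (Y := K) (by decide) ?_
    fun s₄ e₄ f₄ q₄ => Run.cons <| Run.add <| Run.cons <| Run.add <| Run.cons <| Run.add <|
    Run.cons <| Run.add <| Run.cons <| Run.emitHead (K := K) (q := base n) (A := A)
      (x := code n i (i + 1)) (y := code n (j + 1) (j + 2)) (x' := code n (j + 1) (j + 2))
      (y' := code n i (i + 1)) (by decide) (hl₂.of_agree ?_ ?_ ?_) ?_ ?_ ?_ ?_ ?_ ?_ ?_ ?_ ?_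
    fun s₅ h₅ f₅ => Run.nil (by simpa using h₅)) ?_
  rotate_right
  · rw [pow_one]; omega
  · rw [hs₂.r0]; omega
  · simp [State.reg_setReg, f₃, hs₂.r0]; omega
  all_goals first
    | omega
    | (simp [State.reg_setReg, State.mem_setReg, *, hs₂.r4, hs₂.r7, hs₂.r0, code, add_assoc,
        add_mul])

theorem run_edges (hn : 3 ≤ n) (hs : Consts n m s) :
    Run edges s (2000 * (base n ^ (m + 2)) ^ 4) fun s' =>
      Consts n m s' ∧ Holds (edgeList n m) s' := by
  obtain ⟨b1, b2, b3, b4, b5, b6, b7⟩ := le_of_three_le hn m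
  set K := base n ^ (m + 2) with hK
  refine (Run.le (T := 1 + (1 + (42 * K ^ 3 + (1007 * K ^ 4 + 1)))) (Run.cons <| Run.const <|
    Run.cons <| Run.const <| Run.cons <| (Run.appendLoop (K := K) (c := 35) (e := 2) (l := [])
      (B := base n ^ (m + 1)) (fun A => (List.range (base n)).flatMap fun x =>
        [(x + base n * A, A + base n ^ (m + 1) * x)]) ?_ ?_ b6 (by omega) (by decide)
      (by decide) (by decide) ?_).frame.mono le_rfl
    fun s₁ ⟨h₁, f₁⟩ => Run.cons <| (Run.appendLoop (K := K) (c := 1000) (e := 3)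
      (B := base n ^ m) (fun A => blankList n A ++ triangleList n A ++ farList n A)
      h₁ ?_ b5 (by omega) (by decide) (by decide) (by decide) ?_).mono le_rfl
    fun s₂ h₂ => Run.nil h₂) ?_).frame.mono le_rfl fun s' h => ⟨hs.frame h.2 (by decide), ?_⟩
  · exact ⟨by simp [State.reg_setReg], fun k hk => by simp at hk, fun k hk => by simp at hk⟩
  · simp [State.reg_setReg, hs.r10]
  · intro A hA l₁ s₁ hl₁ hA₁ hf₁
    have hs₁ : Consts n m s₁ := (hs.of_agree (s' := (s.setReg 16 0).setReg 18 0)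
      (by simp [State.reg_setReg])).frame hf₁ (by decide)
    have ht₁ : s₁.reg 18 = 0 := by rw [hf₁.1 18 (by decide)]; simp [State.reg_setReg]
    refine Run.appendLoop (K := K) (c := 28) (e := 1) _ hl₁ hs₁.r7 b4 (by omega) (by decide)
      (by decide) (by decide) ?_
    intro x hx l₂ s₂ hl₂ hx₂ hf₂
    have hs₂ := hs₁.frame hf₂ (by decide)
    have hA₂ : s₂.reg 17 = A := by rw [hf₂.1 17 (by decide), hA₁]
    have ht₂ : s₂.reg 18 = 0 := by rw [hf₂.1 18 (by decide), ht₁]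
    refine Run.le (Run.emit (K := K) (by decide) (by omega) (by omega) hl₂ hs₂.r4
      fun s₃ h₃ _ => ?_) (by rw [pow_one]; omega)
    simpa [hA₂, hx₂, hs₂.r7, hs₂.r10, ht₂] using h₃
  · have h1 : K ^ 3 ≤ K ^ 4 := Nat.pow_le_pow_right (by omega) (by omega)
    have h2 : K ≤ K ^ 4 := Nat.le_self_pow (by decide) _
    omega
  · simpa [edgeList, rotateList] using h.1
  · rw [f₁.1 9 (by decide)]; simp [State.reg_setReg, hs.r9]
  · intro A hA l₂ s₂ hl₂ hA₂ hf₂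
    have hs₂ : Consts n m s₂ := ((hs.of_agree (s' := (s.setReg 16 0).setReg 18 0)
      (by simp [State.reg_setReg])).frame f₁ (by decide)).frame hf₂ (by decide)
    have h2 : K ≤ K ^ 3 := Nat.le_self_pow (by decide) _
    refine Run.le (T := 5 * K + 5 + (300 * K ^ 3 + (1 + (300 * K ^ 3 + (1 + (300 * K ^ 3 + 1))))))
      (Run.cons <| Run.mul (Y := K) (by decide) (by omega)
      fun s₃ e₃ f₃ q₃ => Run.cons <| (run_blankEdges (m := m) (A := A) (l := l₂) hn ?_ ?_
        ?_).frame.mono le_rfl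
      fun s₄ ⟨h₄, f₄⟩ => Run.cons <| Run.sub <| Run.cons <| (run_triangleEdges (m := m) (A := A)
        (l := l₂ ++ blankList n A) hn ?_ ?_ ?_ ?_).frame.mono le_rfl
      fun s₅ ⟨h₅, f₅⟩ => Run.cons <| Run.sub <| Run.cons <| (run_farEdges (m := m) (A := A)
        (l := l₂ ++ blankList n A ++ triangleList n A) hn ?_ ?_ ?_ ?_).mono le_rfl
      fun s₆ h₆ => Run.nil (by simpa using h₆)) (by omega)
    have c₃ : Consts n m s₃ := hs₂.of_agree (by simp [f₃])
    · exact c₃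
    · exact hl₂.of_agree (f₃ _ (by decide) (by decide) (by decide)) (by rw [q₃]) (by rw [q₃])
    · rw [e₃, hs₂.r12, hA₂]
    all_goals
      have c₄ : Consts n m (s₄.setReg 26 (s₄.reg 0 - s₄.reg 4)) :=
        ((hs₂.of_agree (s' := s₃) (by simp [f₃])).frame f₄ (by decide)).of_agree
          (by simp [State.reg_setReg])
      have t₄ : (s₄.setReg 26 (s₄.reg 0 - s₄.reg 4)).reg 18 = base n * base n * A := by
        rw [State.reg_setReg, if_neg (by decide), f₄.1 18 (by decide), e₃, hs₂.r12, hA₂]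
      have r₄ : (s₄.setReg 26 (s₄.reg 0 - s₄.reg 4)).reg 26 = n - 1 := by
        have h0 := c₄.r0
        have h4 := c₄.r4
        simp only [State.reg_setReg, Nat.reduceEqDiff, if_false, OfNat.zero_ne_ofNat] at h0 h4
        rw [State.reg_setReg, if_pos rfl, h0, h4]
    · exact c₄
    · exact h₄.of_agree rfl rfl rfl
    · exact t₄
    · exact r₄
    all_goals have c₅ := c₄.frame f₅ (by decide)
    · exact c₅.of_agree (by simp [State.reg_setReg])
    · exact h₅.of_agree rfl rfl rfl
    · rw [State.reg_setReg, if_neg (by decide), f₅.1 18 (by decide), t₄]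
    · rw [State.reg_setReg, if_pos rfl, f₅.1 26 (by decide), r₄, c₅.r4]

end RAM

/-! ### Connected components by marking -/

namespace RAM

open BraidGroup Relation

/-- If an end of the edge `e` is marked, then mark both ends. -/
def mark (V : Set ℕ) (e : ℕ × ℕ) : Set ℕ :=
  V ∪ {u | (u = e.1 ∨ u = e.2) ∧ (e.1 ∈ V ∨ e.2 ∈ V)}

/-- One pass over a list of edges. -/
def pass (l : List (ℕ × ℕ)) (V : Set ℕ) : Set ℕ := l.foldl mark V

theorem subset_pass (l : List (ℕ × ℕ)) (V : Set ℕ) : V ⊆ pass l V := by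
  induction l generalizing V with
  | nil => exact subset_rfl
  | cons e l ih => exact Set.subset_union_left.trans (ih (mark V e))

theorem mem_pass {l : List (ℕ × ℕ)} {V : Set ℕ} {e : ℕ × ℕ} (he : e ∈ l) (h : e.1 ∈ V ∨ e.2 ∈ V) :
    e.1 ∈ pass l V ∧ e.2 ∈ pass l V := by
  induction l generalizing V with
  | nil => simp at he
  | cons e' l ih =>
    rcases List.mem_cons.1 he with rfl | he
    · exact ⟨subset_pass l (mark V e) (Or.inr ⟨.inl rfl, h⟩),
        subset_pass l (mark V e) (Or.inr ⟨.inr rfl, h⟩)⟩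
    · exact ih he (h.imp .inl .inl)

theorem pass_subset {l : List (ℕ × ℕ)} {V C : Set ℕ} (hC : ∀ e ∈ l, e.1 ∈ C ↔ e.2 ∈ C)
    (hV : V ⊆ C) : pass l V ⊆ C := by
  induction l generalizing V with
  | nil => exact hV
  | cons e l ih =>
    refine ih (fun e he => hC e (List.mem_cons_of_mem _ he)) ?_
    have he := hC e List.mem_cons_self
    rintro u (hu | ⟨rfl | rfl, h | h⟩)
    · exact hV hu
    · exact hV h
    · exact he.2 (hV h)
    · exact he.1 (hV h)
    · exact hV h

/-- As many passes as there are vertices mark a connected component, because every pass that is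
not the last one marks a further vertex. -/
theorem iterate_pass {l : List (ℕ × ℕ)} {E : ℕ → ℕ → Prop} {K u₀ : ℕ}
    (hl : ∀ e, e ∈ l ↔ E e.1 e.2) (hE : ∀ u v, E u v → u < K ∧ v < K) (hu₀ : u₀ < K) :
    (pass l)^[K] {u₀} = {u | EqvGen E u₀ u} := by
  have hsub : ∀ C : Set ℕ, u₀ ∈ C → (∀ e ∈ l, e.1 ∈ C ↔ e.2 ∈ C) →
      ∀ k, (pass l)^[k] {u₀} ⊆ C := by
    intro C hC hlC k
    induction k with
    | zero => simpa using hC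
    | succ k ih => rw [Function.iterate_succ_apply']; exact pass_subset hlC ih
  apply Set.Subset.antisymm
  · refine hsub _ (EqvGen.refl _) (fun e he => ?_) K
    have := EqvGen.rel _ _ ((hl e).1 he)
    exact ⟨fun h => EqvGen.trans _ _ _ h this, fun h => EqvGen.trans _ _ _ h (EqvGen.symm _ _ this)⟩
  · have hlt : ∀ k, (pass l)^[k] {u₀} ⊆ Set.Iio K :=
      hsub _ hu₀ fun e he => by
        have := hE _ _ ((hl e).1 he)
        simp [this.1, this.2]
    have hfin : ∀ k, ((pass l)^[k] {u₀}).Finite := fun k => (Set.finite_Iio K).subset (hlt k)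
    obtain ⟨k, hk, hfix⟩ : ∃ k ≤ K, pass l ((pass l)^[k] {u₀}) = (pass l)^[k] {u₀} := by
      by_contra! hne
      have hcard : ∀ k ≤ K, k + 1 ≤ ((pass l)^[k] {u₀}).ncard := by
        intro k
        induction k with
        | zero => simp
        | succ k ih =>
          intro hk
          have h1 := ih (by omega)
          have h2 : ((pass l)^[k] {u₀}).ncard < ((pass l)^[k + 1] {u₀}).ncard := by
            refine Set.ncard_lt_ncard ?_ (hfin _)
            rw [Function.iterate_succ_apply']
            exact (subset_pass _ _).ssubset_of_ne (hne k (by omega)).symm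
          omega
      have h1 := hcard K le_rfl
      have h2 := Set.ncard_le_ncard (hlt K) (Set.finite_Iio K)
      rw [← Finset.coe_Iio, Set.ncard_coe_finset, Nat.card_Iio] at h2
      omega
    have hK : (pass l)^[K] {u₀} = (pass l)^[k] {u₀} := by
      obtain ⟨d, rfl⟩ := Nat.exists_eq_add_of_le' hk
      rw [Function.iterate_add_apply, Function.iterate_fixed hfix]
    rw [hK]
    have hu : u₀ ∈ (pass l)^[k] {u₀} := by
      clear hfix hK
      induction k with
      | zero => simp
      | succ k ih =>
        rw [Function.iterate_succ_apply']
        exact subset_pass _ _ (ih (by omega))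
    have hiff : ∀ u v, EqvGen E u v → (u ∈ (pass l)^[k] {u₀} ↔ v ∈ (pass l)^[k] {u₀}) := by
      intro u v h
      induction h with
      | rel u v h =>
        have he := mem_pass (V := (pass l)^[k] {u₀}) ((hl (u, v)).2 h)
        rw [hfix] at he
        exact ⟨fun h => (he (.inl h)).2, fun h => (he (.inr h)).1⟩
      | refl => rfl
      | symm _ _ _ ih => exact ih.symm
      | trans _ _ _ _ _ ih ih' => exact ih.trans ih'
    exact fun v hv => (hiff _ _ hv).1 hu

/-! ### The search -/

/-- Marking of the component of the start vertex: bank `5` is nonzero at the marked vertices. One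
round of the outer loop is one `pass` over the edges. -/
def closure : Program := block [.store 5 13 4, forLoop 15 11 (forLoop 17 16 (block [.load 40 3 17,
  .load 41 4 17, .load 21 5 40, .load 22 5 41, .add 21 21 22,
  .cond 21 (block [.store 5 40 4, .store 5 41 4]) .skip]))]

variable {n m : ℕ} {s : State}

theorem run_closure (hn : 3 ≤ n) (hs : Consts n m s) (hl : Holds (edgeList n m) s)
    (h5 : s.mem 5 = 0) (h13 : s.reg 13 < base n ^ (m + 2)) :
    Run closure s (500 * (base n ^ (m + 2)) ^ 2) fun s' => Consts n m s' ∧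
      ∀ u, s'.mem 5 u ≠ 0 ↔ EqvGen (Edge n m) (s.reg 13) u := by
  obtain ⟨b1, b2, b3, b4, b5, b6, b7⟩ := le_of_three_le hn m
  have hB := length_edgeList_le (n := n) (m := m)
  have hV := iterate_pass (fun e => mem_edgeList) (fun u v h => Edge.lt (by omega) h) h13
  set K := base n ^ (m + 2) with hK
  set l := edgeList n m with hl_def
  let V (k : ℕ) : Set ℕ := (pass l)^[k] {s.reg 13}
  refine (Run.le (T := 1 + (K * ((l.length * (15 + 4) + 3) + 4) + 3 + 1)) (Run.cons <|
    Run.store <| Run.cons <| (Run.forLoop (B := K) (T := l.length * (15 + 4) + 3)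
      (fun k s => {u | s.mem 5 u ≠ 0} = V k) ?_ (by decide) (by decide) (by decide)
      (fun k s v w h => h) ?_ ?_).mono le_rfl fun s' h => Run.nil h) ?_).frame.mono le_rfl
      fun s' h => ⟨hs.frame h.2 (by decide), fun u => ?_⟩
  · rw [State.reg_setMem, hs.r11]
  · ext u
    simp [State.mem_setMem, h5, hs.r4, V]
  · intro k hk s₁ hV₁ _ hf₁
    have hl₁ : Holds l s₁ := by
      refine hl.of_agree (hf₁.1 16 (by decide)) ?_ ?_
      · rw [hf₁.2 3 (by decide)]; funext a; simp [State.mem_setMem]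
      · rw [hf₁.2 4 (by decide)]; funext a; simp [State.mem_setMem]
    have hs₁ : Consts n m s₁ :=
      (hs.of_agree (s' := s.setMem 5 _ _) fun _ _ => rfl).frame hf₁ (by decide)
    refine (Run.forLoop (fun j s => {u | s.mem 5 u ≠ 0} = pass (l.take j) (V k)) hl₁.length
      (by decide) (by decide) (by decide) (fun k s v w h => h) (by simpa [pass] using hV₁)
      ?_).mono le_rfl fun s' h => ?_
    · intro j hj s₂ hV₂ hj₂ hf₂
      have hl₂ : Holds l s₂ :=
        hl₁.of_agree (hf₂.1 16 (by decide)) (hf₂.2 3 (by decide)) (hf₂.2 4 (by decide))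
      have hs₂ := hs₁.frame hf₂ (by decide)
      have hp : pass (l.take (j + 1)) (V k) = mark {u | s₂.mem 5 u ≠ 0} l[j] := by
        rw [hV₂, List.take_succ_eq_append_getElem hj, pass, List.foldl_append]
        rfl
      have m3 := hl₂.fst j hj
      have m4 := hl₂.snd j hj
      refine Run.le (Run.cons <| Run.load <| Run.cons <| Run.load <| Run.cons <| Run.load <|
        Run.cons <| Run.load <| Run.cons <| Run.add <| Run.cons <| Run.cond (T := 3)
        (fun h => Run.cons <| Run.store <| Run.cons <| Run.store <| Run.nil <| Run.nil ?_)
        (fun h => (Run.skip <| Run.nil ?_).le (by omega))) (by omega)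
      · simp [State.reg_setReg, State.mem_setReg, hj₂, m3, m4] at h
        have h' : s₂.mem 5 l[j].1 ≠ 0 ∨ s₂.mem 5 l[j].2 ≠ 0 := by omega
        rw [hp]
        ext u
        simp only [State.reg_setReg, State.mem_setReg, State.reg_setMem, State.mem_setMem, mark,
          Nat.reduceEqDiff, if_true, if_false, hj₂, m3, m4, hs₂.r4, true_and]
        clear hV₂ hp
        generalize l[j] = e at *
        by_cases u₁ : u = e.1 <;> by_cases u₂ : u = e.2 <;> simp [u₁, u₂, h']
      · simp [State.reg_setReg, State.mem_setReg, hj₂, m3, m4] at h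
        rw [hp]
        ext u
        simp [State.mem_setReg, mark, h]
    · rw [h, List.take_length]
      exact (Function.iterate_succ_apply' _ _ _).symm
  · nlinarith
  · have := Set.ext_iff.1 (h.1.trans hV) u
    simpa using this

/-- Tabulation of the numbers of negative letters in bank `6`: the number for `x + qA` comes from
that for `A`, which is smaller unless it is `0`. -/
def negatives : Program := forLoop 17 10 (block [.load 18 6 17, forLoop 19 6 (block [mul 21 7 17,
  .add 21 21 19, .store 6 21 18, .add 21 21 6, .add 22 18 4, .store 6 21 22])])

theorem run_negatives (hn : 3 ≤ n) (hs : Consts n m s) (h6 : s.mem 6 = 0) :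
    Run negatives s (100 * (base n ^ (m + 2)) ^ 3) fun s' => Consts n m s' ∧
      s'.mem 5 = s.mem 5 ∧ ∀ u < base n ^ (m + 2), s'.mem 6 u = negCount n u := by
  obtain ⟨b1, b2, b3, b4, b5, b6, b7⟩ := le_of_three_le hn m
  have hbase : base n = n * n + n * n := rfl
  have hKq : base n * base n ^ (m + 1) = base n ^ (m + 2) := by ring
  set K := base n ^ (m + 2) with hK
  refine ((Run.forLoop (T := 50 * K ^ 2) (fun k s =>
    (∀ u < base n * k, s.mem 6 u = negCount n u) ∧ (k = 0 → s.mem 6 0 = 0)) hs.r10 (by decide)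
    (by decide) (by decide) (fun k s v w h => h) (by simp [h6]) ?_).frame.mono
    ((loop_cost (c := 50) (e := 2) (by omega) b6 le_rfl).trans
      (Nat.mul_le_mul_right _ (by omega))))
    fun s' h => ⟨hs.frame h.2 (by decide), h.2.2 5 (by decide), by simpa [hKq] using h.1.1⟩
  rintro A hA s₁ ⟨h₁, z₁⟩ hA₁ hf₁
  have hs₁ := hs.frame hf₁ (by decide)
  have hc : s₁.mem 6 A = negCount n A := by
    rcases Nat.eq_zero_or_pos A with rfl | hA0
    · rw [z₁ rfl, negCount_zero]
    · refine h₁ A ?_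
      nlinarith
  refine Run.le (Run.cons <| Run.load <| Run.cons <| (Run.forLoop (B := n * n) (T := 5 * K + 20)
    (fun i s => (∀ u < base n * A, s.mem 6 u = negCount n u) ∧
      ∀ x < i, s.mem 6 (base n * A + x) = negCount n A ∧
        s.mem 6 (base n * A + x + n * n) = negCount n A + 1) ?_ (by decide) (by decide) (by decide)
    (fun k s v w h => h) ?_ ?_).mono le_rfl fun s₂ ⟨h₂, g₂⟩ => Run.nil ⟨?_, ?_⟩) ?_
  · simp [State.reg_setReg, hs₁.r6]
  · simpa [State.mem_setReg] using h₁
  · rintro i hi s₂ ⟨h₂, g₂⟩ hi₂ hf₂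
    have hs₂ : Consts n m s₂ := (hs₁.of_agree (s' := s₁.setReg 18 _)
      (by simp [State.reg_setReg])).frame hf₂ (by decide)
    have hA₂ : s₂.reg 17 = A := by
      rw [hf₂.1 17 (by decide), State.reg_setReg, if_neg (by decide), hA₁]
    have hc₂ : s₂.reg 18 = negCount n A := by
      rw [hf₂.1 18 (by decide), State.reg_setReg, if_pos rfl, hA₁, hc]
    refine Run.le (Run.cons <| Run.mul (Y := K) (by decide) (by omega)
      fun s₃ e₃ f₃ q₃ => Run.cons <| Run.add <| Run.cons <| Run.store <| Run.cons <| Run.add <|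
      Run.cons <| Run.add <| Run.cons <| Run.store <| Run.nil ?_) (by omega)
    simp only [State.reg_setReg, State.mem_setReg, State.reg_setMem, State.mem_setMem, true_and,
      Nat.reduceEqDiff, if_true, if_false, f₃ _, ne_eq, not_false_eq_true, e₃, q₃, hA₂, hc₂,
      hs₂.r4, hs₂.r6, hs₂.r7, hi₂]
    refine ⟨fun u hu => ?_, fun x hx => ?_⟩
    · rw [if_neg (by omega), if_neg (by omega), h₂ u hu]
    · rcases Nat.lt_succ_iff_lt_or_eq.1 hx with hx | rfl
      · rw [if_neg (by omega), if_neg (by omega), if_neg (by omega), if_neg (by omega)]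
        exact g₂ x hx
      · have : 0 < n * n := by nlinarith
        rw [if_neg (by omega), if_pos rfl, if_pos rfl]
        exact ⟨rfl, rfl⟩
  · intro u hu
    rcases Nat.lt_or_ge u (base n * A) with h | h
    · exact h₂ u h
    obtain ⟨x, rfl⟩ := Nat.exists_eq_add_of_le h
    have hx : x < base n := by rw [Nat.mul_succ] at hu; omega
    have hn0 : 0 < n * n := by nlinarith
    rw [add_comm (base n * A) x, negCount_cons (by omega) hx, add_comm x]
    rcases Nat.lt_or_ge x (n * n) with h' | h'
    · rw [(g₂ x h').1, Nat.div_eq_of_lt h', zero_add]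
    · obtain ⟨y, rfl⟩ := Nat.exists_eq_add_of_le h'
      have hy : y < n * n := by omega
      rw [Nat.add_div_left _ hn0, Nat.div_eq_of_lt hy, add_comm (n * n) y, ← add_assoc,
        (g₂ y hy).2, add_comm]
  · intro h; omega
  · have h1 : n * n * (5 * K + 20 + 4) ≤ K * (5 * K + 24) := Nat.mul_le_mul (by omega) (by omega)
    nlinarith

/-- Register `24` records whether the component has a word with at most one negative letter,
register `23` whether it has one with no negative letter; the answer is their difference. -/
def decision : Program := block [.const 23 0, .const 24 0, forLoop 15 11 (block [.load 21 5 15,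
  .cond 21 (block [.load 22 6 15, .cond 22 (block [.sub 22 22 4, .cond 22 .skip (.const 24 1)])
    (block [.const 23 1, .const 24 1])]) .skip]), .sub 0 24 23]

open Classical in
theorem run_decision (hs : Consts n m s) {V : Set ℕ} {K : ℕ} (hK : K = base n ^ (m + 2))
    (hK0 : 0 < K) (h5 : ∀ u < K, s.mem 5 u ≠ 0 ↔ u ∈ V) (h6 : ∀ u < K, s.mem 6 u = negCount n u) :
    Run decision s (100 * K) fun s' => s'.reg 0 =
      if (∃ u < K, u ∈ V ∧ negCount n u ≤ 1) ∧ ¬ ∃ u < K, u ∈ V ∧ negCount n u ≤ 0 then 1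
      else 0 := by
  have hex : ∀ (P : ℕ → Prop) k, (∃ u < k + 1, P u) ↔ (∃ u < k, P u) ∨ P k := by
    intro P k
    simp only [Nat.lt_succ_iff_lt_or_eq, or_and_right, exists_or, exists_eq_left]
  refine Run.le (T := 1 + (1 + (K * (20 + 4) + 3 + (1 + 1)))) (Run.cons <| Run.const <| Run.cons <|
    Run.const <| Run.cons <| (Run.forLoop (B := K) (T := 20)
    (fun k s => (s.reg 23 = if ∃ u < k, u ∈ V ∧ negCount n u ≤ 0 then 1 else 0) ∧
      s.reg 24 = if ∃ u < k, u ∈ V ∧ negCount n u ≤ 1 then 1 else 0) ?_ (by decide) (by decide)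
    (by decide) ?_ ?_ ?_).mono le_rfl fun s₁ ⟨h₁, g₁⟩ => Run.cons <| Run.sub <| Run.nil ?_)
    (by omega)
  · simp [State.reg_setReg, hs.r11, hK]
  · intro k s v w h; simpa [State.reg_setReg] using h
  · simp [State.reg_setReg]
  · rintro k hk s₁ ⟨h₁, g₁⟩ hk₁ hf₁
    have hs₁ : Consts n m s₁ := (hs.of_agree (s' := (s.setReg 23 0).setReg 24 0)
      (by simp [State.reg_setReg])).frame hf₁ (by decide)
    have m5 : s₁.mem 5 k ≠ 0 ↔ k ∈ V := by rw [hf₁.2 5 (by decide)]; exact h5 k hk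
    have hV : s₁.mem 5 k = 0 → k ∉ V := fun h h' => m5.2 h' h
    have m6 : s₁.mem 6 k = negCount n k := by rw [hf₁.2 6 (by decide)]; exact h6 k hk
    refine Run.le (T := 1 + (13 + 1 + 1)) (Run.cons <| Run.load <| Run.cons <| Run.cond
      (fun h₂ => Run.le (T := 1 + (7 + 1 + 1)) (Run.cons <| Run.load <| Run.cons <| Run.cond
        (fun h₃ => Run.le (T := 1 + (1 + 1 + 1)) (Run.cons <| Run.sub <| Run.cons <| Run.cond
          (fun h₄ => Run.skip <| Run.nil <| Run.nil <| Run.nil ?_)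
          (fun h₄ => Run.const <| Run.nil <| Run.nil <| Run.nil ?_)) (by omega))
        (fun h₃ => (Run.cons <| Run.const <| Run.cons <| Run.const <| Run.nil <| Run.nil <|
          Run.nil ?_).le (by omega))) (by omega))
      (fun h₂ => (Run.skip <| Run.nil ?_).le (by omega))) (by omega)
    all_goals
      simp only [State.reg_setReg, State.mem_setReg, Nat.reduceEqDiff, if_true, if_false, hk₁, m5,
        m6, hs₁.r4, h₁, g₁] at *
      simp only [hex]
    · have e0 : ¬ negCount n k ≤ 0 := by omega
      have e1 : ¬ negCount n k ≤ 1 := by omega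
      simp [e0, e1]
    · have e0 : ¬ negCount n k ≤ 0 := by omega
      have e1 : negCount n k ≤ 1 := by omega
      simp [e0, e1, h₂]
    · simp [h₂, h₃]
    · simp [hV h₂]
  · simp only [State.reg_setReg, if_true, h₁, g₁]
    by_cases hP : ∃ u < K, u ∈ V ∧ negCount n u ≤ 1 <;>
      by_cases hR : ∃ u < K, u ∈ V ∧ negCount n u ≤ 0 <;>
      simp only [hP, hR, if_true, if_false, not_true, not_false_iff, and_true, and_false]

/-! ### The decision procedure -/

/-- The decision procedure: exhaustive search of the component of the input word in the graph of
elementary transformations. -/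
def decider : Program := block [setup, startWord, edges, closure, negatives, decision]

open Classical in
theorem run_decider (hn : 3 ≤ n) (W : BandWord n) :
    Run decider (inputState n W) (4000 * (base n ^ (wordLen n W.length + 2)) ^ 4) fun s' =>
      s'.reg 0 = if ConjASQPNotSQP W.toBraid then 1 else 0 := by
  set m := wordLen n W.length with hm
  have hWm : W.length ≤ m := (Nat.le_succ _).trans (length_le_wordLen hn _)
  obtain ⟨b1, b2, b3, b4, b5, b6, b7⟩ := le_of_three_le hn m
  set K := base n ^ (m + 2) with hK
  have hbank : ∀ b, 3 ≤ b → (inputState n W).mem b = 0 := by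
    intro b hb
    funext k
    simp only [inputState]
    split
    · rfl
    · rw [if_neg (by omega), if_neg (by omega), if_neg (by omega)]; rfl
  have hlt : numWord (W.map some) < K := by
    refine (numWord_lt (by omega) _).trans_le (Nat.pow_le_pow_right (by omega) ?_)
    rw [List.length_map]; omega
  have hreach : ∀ k ≤ 1, (∃ γ, IsConj W.toBraid γ ∧ γ ∈ filtration n k) ↔
      ∃ u < K, u ∈ {u | EqvGen (Edge n m) (numWord (W.map some)) u} ∧ negCount n u ≤ k := by
    intro k hk
    rw [exists_conj_filtration_iff hn W hk le_rfl]
    have hmem : ∀ u v, EqvGen (Edge n m) u v → (u < K ↔ v < K) := by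
      intro u v h
      induction h with
      | rel u v h => have := h.lt (by omega); exact ⟨fun _ => this.2, fun _ => this.1⟩
      | refl => rfl
      | symm _ _ _ ih => exact ih.symm
      | trans _ _ _ _ _ ih ih' => exact ih.trans ih'
    exact ⟨fun ⟨u, h1, h2⟩ => ⟨u, (hmem _ _ h1).1 hlt, h1, h2⟩, fun ⟨u, _, h1, h2⟩ => ⟨u, h1, h2⟩⟩
  have hconj : ConjASQPNotSQP W.toBraid ↔
      (∃ u < K, u ∈ {u | EqvGen (Edge n m) (numWord (W.map some)) u} ∧ negCount n u ≤ 1) ∧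
      ¬ ∃ u < K, u ∈ {u | EqvGen (Edge n m) (numWord (W.map some)) u} ∧ negCount n u ≤ 0 :=
    and_congr (hreach 1 le_rfl) (not_congr (hreach 0 (by omega)))
  refine Run.le (Run.cons <| (run_setup (L := W.length) hn rfl rfl rfl).frame.mono le_rfl
    fun s₁ ⟨⟨c₁, r₁⟩, f₁⟩ => Run.cons <| (run_startWord hn W hWm c₁ r₁ ?_).frame.mono le_rfl
    fun s₂ ⟨⟨c₂, r₂⟩, f₂⟩ => Run.cons <| (run_edges hn c₂).frame.mono le_rfl
    fun s₃ ⟨⟨c₃, r₃⟩, f₃⟩ => Run.cons <| (run_closure hn c₃ r₃ ?_ ?_).frame.mono le_rfl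
    fun s₄ ⟨⟨c₄, r₄⟩, f₄⟩ => Run.cons <| (run_negatives hn c₄ ?_).mono le_rfl
    fun s₅ ⟨c₅, r₅, t₅⟩ => Run.cons <| (run_decision c₅ hK (by omega) (V :=
      {u | EqvGen (Edge n m) (numWord (W.map some)) u}) ?_ t₅).mono le_rfl
    fun s₆ h₆ => Run.nil ?_) ?_
  rotate_right
  · have h1 : K ≤ K ^ 4 := Nat.le_self_pow (by decide) _
    have h2 : K ^ 2 ≤ K ^ 4 := Nat.pow_le_pow_right (by omega) (by omega)
    have h3 : K ^ 3 ≤ K ^ 4 := Nat.pow_le_pow_right (by omega) (by omega)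
    simp only [← hm, ← hK]
    omega
  · funext b
    exact f₁.2 b (by simp [bankWrites, setup, block, mul, forLoop])
  · rw [f₃.2 5 (by decide), f₂.2 5 (by decide), f₁.2 5 (by decide), hbank 5 (by omega)]
  · rw [f₃.1 13 (by decide), r₂]; exact hlt
  · rw [f₄.2 6 (by decide), f₃.2 6 (by decide), f₂.2 6 (by decide), f₁.2 6 (by decide),
      hbank 6 (by omega)]
  · intro u _
    rw [r₅, r₄, f₃.1 13 (by decide), r₂]
    rfl
  · rw [h₆]
    exact if_congr hconj.symm rfl rfl

/-- The cost of the decision procedure is at most exponential. -/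
theorem cost_le {n L : ℕ} (hn : 3 ≤ n) : 4000 * (base n ^ (wordLen n L + 2)) ^ 4 ≤
    2 ^ ((104 * n ^ 4 + 100) * (L + 1)) := by
  have hb : base n ≤ 2 ^ (2 * n) := by
    obtain ⟨k, rfl⟩ := Nat.exists_eq_add_of_le' (Nat.one_le_of_lt hn)
    have h1 : k + 1 ≤ 2 ^ k := Nat.lt_two_pow_self
    calc base (k + 1) ≤ (2 * (k + 1)) * (2 * (k + 1)) := by rw [base]; nlinarith
      _ ≤ (2 * 2 ^ k) * (2 * 2 ^ k) := by gcongr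
      _ = 2 ^ (2 * (k + 1)) := by ring
  have h1 : 4000 ≤ 2 ^ 12 := by norm_num
  calc 4000 * (base n ^ (wordLen n L + 2)) ^ 4
      ≤ 2 ^ 12 * ((2 ^ (2 * n)) ^ (wordLen n L + 2)) ^ 4 := by gcongr
    _ = 2 ^ (12 + 2 * n * ((wordLen n L + 2) * 4)) := by
      rw [← pow_mul, ← pow_mul, ← pow_add]
    _ ≤ _ := by
      refine Nat.pow_le_pow_right (by omega) ?_
      have h2 : n ≤ n ^ 4 := Nat.le_self_pow (by decide) _
      calc 12 + 2 * n * ((wordLen n L + 2) * 4) = 88 * n ^ 4 * (L + 1) + 16 * n + 12 := by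
            rw [wordLen]; ring
        _ ≤ 88 * n ^ 4 * (L + 1) + 16 * n ^ 4 * (L + 1) + 100 * (L + 1) := by
            have h3 : 16 * n ≤ 16 * n ^ 4 * (L + 1) :=
              (Nat.mul_le_mul_left _ h2).trans (Nat.le_mul_of_pos_right _ (by omega))
            omega
        _ = _ := by ring

end RAM

theorem theorem3p5 :
    -- the characterization
    (∀ n : ℕ, 3 ≤ n → ∀ β : BraidGroup n,
      (BraidGroup.ConjASQPNotSQP β ↔
        ∃ β' ∈ BraidGroup.summitSet β, BraidGroup.HasInf β' (-1) ∧
          ∃ (A₁ : BraidGroup n) (As : List (BraidGroup n)),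
            BraidGroup.IsLCF β' (-1) (A₁ :: As) ∧ BraidGroup.HasBandLength A₁ (n - 2))) ∧
    -- one program decides the problem for all numbers of strands, in exponential time
    (∃ (prog : RAM.Program) (p : Polynomial ℕ), ∀ n : ℕ, 3 ≤ n → ∀ W : BraidGroup.BandWord n,
      ∃ (t : ℕ) (s : RAM.State), RAM.Exec prog (RAM.inputState n W) t s ∧
        t ≤ 2 ^ (p.eval n * (W.length + 1)) ∧
        (BraidGroup.ConjASQPNotSQP (BraidGroup.BandWord.toBraid W) → s.reg 0 = 1) ∧
        (¬ BraidGroup.ConjASQPNotSQP (BraidGroup.BandWord.toBraid W) → s.reg 0 = 0)) := by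
  refine ⟨fun n hn β => BraidGroup.conjASQPNotSQP_iff hn β, RAM.decider,
    104 * Polynomial.X ^ 4 + 100, fun n hn W => ?_⟩
  obtain ⟨t, s, hs, ht, h0⟩ := RAM.run_decider hn W
  refine ⟨t, s, hs, ?_, fun h => ?_, fun h => ?_⟩
  · simpa using ht.trans (RAM.cost_le hn)
  · rw [h0, if_pos h]
  · rw [h0, if_neg h]
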